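/- Let $n\ge 2$, let $\Omega=\mathbb{R}^n\times(0,\infty)$ with points $(x,z)$ and Lebesgue measure $d\mu$, let $\nabla$ be the gradient in $x$, and let $H=L^2(\Omega, z\,d\mu)$ (complex-valued functions) with inner product $\langle\cdot,\cdot\rangle_H$. Put $$b(\varphi,\eta)=\int_\Omega\Big(z\,\partial_z\varphi\,\partial_z\bar\eta+z^{-1/n}\,\nabla\varphi\cdot\nabla\bar\eta\Big)\,d\mu ,$$ $$\mathcal{E}=\{\varphi\in H^1_{loc}(\Omega)\cap H:\ b(\varphi,\varphi)<\infty\},\qquad \|\varphi\|_{\mathcal{E}}^2=b(\varphi,\varphi)+\|\varphi\|_H^2,$$ $$D=\{\varphi\in\mathcal{E}:\ \exists\,C>0\ \ \forall\,\eta\in\mathcal{E},\ |b(\varphi,\eta)|\le C\|\eta\|_H\}.$$ Let $f\in D$ and $g\in\mathcal{E}$. Then there is a unique $\phi\in C([0,\infty);\mathcal{E})\cap C^1([0,\infty);H)$ solving the Cauchy problem $$\partial_{tt}\phi-\frac1z\,\partial_z(z\,\partial_z\phi)-\frac{1}{z^{1+1/n}}\,\Delta_x\phi=0,\qquad \phi(0,\cdot)=f,\quad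 \partial_t\phi(0,\cdot)=g,$$ where the equation means that $\frac{d}{dt}\langle\partial_t\phi(t),\eta\rangle_H=-b(\phi(t),\eta)$ for all $\eta\in\mathcal{E}$ and all $t\ge 0$ (one-sided derivatives at $t=0$). Moreover, for each $t>0$, the trace $\phi(t,\cdot,z)$ of $\phi(t,\cdot)$ on the hyperplane $\mathbb{R}^n\times\{z\}$ exists in $L^2(\mathbb{R}^n)$ for every $z>0$, and $\lim_{z\to0^+}\phi(t,\cdot,z)$ exists in $L^2(\mathbb{R}^n)$ (strong convergence). -/

import Mathlib

open MeasureTheory Set Filter Topology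
open scoped ContDiff ENNReal

noncomputable section

namespace Taub

/-- The tangential space `ℝⁿ`. -/
abbrev Tang (n : ℕ) : Type := EuclideanSpace ℝ (Fin n)

/-- The ambient space `ℝⁿ × ℝ` with current point `(x, z)`; `volume` is Lebesgue measure. -/
abbrev Pt (n : ℕ) : Type := Tang n × ℝ

/-- The open half-space `Ω = ℝⁿ × (0, ∞)`. -/
def Om (n : ℕ) : Set (Pt n) := {p | 0 < p.2}

/-- The coordinate direction `∂/∂xⁱ`. -/
def dirX {n : ℕ} (i : Fin n) : Pt n := (EuclideanSpace.single i 1, 0)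

/-- The coordinate direction `∂/∂z`. -/
def dirZ (n : ℕ) : Pt n := (0, 1)

/-- The test functions `C₀^∞(Ω)`, complex valued. -/
structure IsTest {n : ℕ} (η : Pt n → ℂ) : Prop where
  smooth : ContDiff ℝ ∞ η
  compact : HasCompactSupport η
  subset : tsupport η ⊆ Om n

/-- The class `L²_loc(Ω)`. -/
def MemL2loc {n : ℕ} (u : Pt n → ℂ) : Prop :=
  ∀ K : Set (Pt n), IsCompact K → K ⊆ Om n → MemLp u 2 (volume.restrict K)

/-- `v ∈ L²_loc(Ω)` is the weak derivative of `u` on `Ω` in the direction `e`. -/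
def IsWeakDeriv {n : ℕ} (u : Pt n → ℂ) (e : Pt n) (v : Pt n → ℂ) : Prop :=
  MemL2loc v ∧ ∀ η : Pt n → ℂ, IsTest η →
    ∫ p in Om n, u p * fderiv ℝ η p e = -∫ p in Om n, v p * η p

/-- The local Sobolev space `H¹_loc(Ω)`. -/
def MemH1loc {n : ℕ} (u : Pt n → ℂ) : Prop :=
  MemL2loc u ∧ (∀ i : Fin n, ∃ v, IsWeakDeriv u (dirX i) v) ∧ ∃ v, IsWeakDeriv u (dirZ n) v

open Classical in
/-- The weak derivative of `u` in the direction `e` (unique up to null subsets of `Ω`),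
and `0` if there is none. -/
def weakDeriv {n : ℕ} (u : Pt n → ℂ) (e : Pt n) : Pt n → ℂ :=
  if h : ∃ v, IsWeakDeriv u e v then h.choose else 0

/-- The measure `z dμ` on `Ω`. -/
def wMeasure (n : ℕ) : Measure (Pt n) :=
  (volume.restrict (Om n)).withDensity fun p => ENNReal.ofReal p.2

/-- The Hilbert space `H = L²(Ω, z dμ)`. -/
abbrev H (n : ℕ) : Type := Lp ℂ 2 (wMeasure n)

/-- The form
`b(φ, η) = ∫_Ω (z ∂_z φ conj(∂_z η) + z^(-1/n) ∇φ · conj(∇η)) dμ`. -/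
def bform {n : ℕ} (φ η : H n) : ℂ :=
  ∫ p in Om n,
    ((p.2 : ℝ) : ℂ) * (weakDeriv φ (dirZ n) p * star (weakDeriv η (dirZ n) p)) +
      ((p.2 ^ (-(1 : ℝ) / n) : ℝ) : ℂ) *
        ∑ i : Fin n, weakDeriv φ (dirX i) p * star (weakDeriv η (dirX i) p)

/-- The energy space `{φ ∈ H¹_loc(Ω) ∩ H : b(φ, φ) < ∞}`. -/
def energySpace (n : ℕ) : Set (H n) :=
  {φ | MemH1loc (φ : Pt n → ℂ) ∧
    ∫⁻ p in Om n, ENNReal.ofReal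
      (p.2 * ‖weakDeriv φ (dirZ n) p‖ ^ 2 +
        p.2 ^ (-(1 : ℝ) / n) * ∑ i : Fin n, ‖weakDeriv φ (dirX i) p‖ ^ 2) < ⊤}

/-- The norm of the energy space, `‖φ‖² = b(φ, φ) + ‖φ‖_H²`. -/
def energyNorm {n : ℕ} (φ : H n) : ℝ := Real.sqrt ((bform φ φ).re + ‖φ‖ ^ 2)

/-- The domain `D` of the self-adjoint operator `A` associated with `b`. -/
def domainA (n : ℕ) : Set (H n) :=
  {φ | φ ∈ energySpace n ∧
    ∃ C : ℝ, 0 < C ∧ ∀ η ∈ energySpace n, ‖bform φ η‖ ≤ C * ‖η‖}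

/-- `φ ∈ C([0,∞); 𝓔) ∩ C¹([0,∞); H)` solves `∂_tt φ + A φ = 0` (in the dual of the energy space),
`φ(0) = f`, `∂_t φ(0) = g`. Only the values `φ t` with `0 ≤ t` matter. Recall that
`inner ℂ η ψ = ∫ ψ conj(η) z dμ`. -/
structure IsSolution {n : ℕ} (f g : H n) (φ : ℝ → H n) : Prop where
  mem_energy : ∀ t, 0 ≤ t → φ t ∈ energySpace n
  continuous_energy : ∀ t, 0 ≤ t →
    Tendsto (fun s => energyNorm (φ s - φ t)) (𝓝[Ici 0] t) (𝓝 0)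
  contDiff_H : ContDiffOn ℝ 1 φ (Ici 0)
  equation : ∀ η ∈ energySpace n, ∀ t, 0 ≤ t →
    HasDerivWithinAt (fun s => inner ℂ η (derivWithin φ (Ici 0) s)) (-bform (φ t) η) (Ici 0) t
  init_pos : φ 0 = f
  init_vel : derivWithin φ (Ici 0) 0 = g

/-- `w ∈ L²(ℝⁿ)` is the trace of `u ∈ H¹_loc(Ω)` on the hyperplane `Γ_z₀ = ℝⁿ × {z₀}`, `z₀ > 0`:
the boundary value of `u` in Green's formula on `{z > z₀}`, which determines `w`. -/
def IsTrace {n : ℕ} (u : Pt n → ℂ) (z₀ : ℝ) (w : Lp ℂ 2 (volume : Measure (Tang n))) : Prop :=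
  ∀ η : Pt n → ℂ, IsTest η →
    ∫ p in {p : Pt n | z₀ < p.2},
        (u p * fderiv ℝ η p (dirZ n) + weakDeriv u (dirZ n) p * η p) =
      -∫ x : Tang n, w x * η (x, z₀)

end Taub

end

/-! Existence and uniqueness are spectral. Let `J` be the embedding of the energy space into `H`, an
injective contraction. Since `b(φ, η)` is the energy inner product minus the `H` inner product, the
bounded operator `R = J J*` plays the role of `(1 + A)⁻¹`, where `A` is the operator of `b`; a
spectral value `r ∈ [0, 1]` of `R` corresponds to the value `1/r - 1` of `A`, hence to the frequency
`ω = √(1/r - 1)`. The polar decomposition `J = √R W`, with `W` isometric, transports the problem to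
`H`, where the solution should be `cos(t√A) W f + A^(-1/2) sin(t√A) W g`. The hypothesis `f ∈ D`
means `f = J* h`, so that `W f = √R h`. Every function of `r` that then occurs is continuous on `[0,
1]` and Lipschitz in `t` uniformly in `r`, so the continuous functional calculus of `R` suffices and
no unbounded operator is needed (`exists_wave`). The same formulas show that the solution stays in
`D`. For uniqueness, a weak solution is smoothed by `R` and the energy of the smoothed solution is
conserved (`wave_eq_zero`).

It remains to find the traces of one `u ∈ D`, that is, one with `|b(u, η)| ≤ C ‖η‖_H`. The
coefficients of `b` do not depend on `x`, so Nirenberg's difference quotients apply: testing with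
`D₋ₜ(χ² Dₜ u)`, where `χ` cuts off near `z = 0`, bounds `χ Dₜ ∂ᵢu` in `L²(z^(-1/n) dμ)` uniformly in
`t` (`exists_bound_diffQuotient`).

Next, test with `θ(x) β(z)`, where `β` is a logarithmic ramp: `z β' = 1` on `[a, b)`, and `β = 0`
beyond `b`. The normal part of `b` becomes exactly the integral of `∂_z u` against `conj θ` over the
strip `a ≤ z < b`. In the tangential part the derivative of `θ` is moved onto `∇u`, at a cost
bounded by the tangential regularity. Because `n ≥ 2`, the function `z^(-1/n) log² z` is integrable
at `0`, and everything else is `O(b^(1/4)) ‖θ‖` (`exists_strip_bound`). The difference of two traces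
is the integral of `∂_z u` over the strip between them, so by duality the traces are Cauchy in `L²`
as `z → 0` (`exists_trace_tendsto`). -/

noncomputable section

open MeasureTheory Set Filter Topology
open scoped ContDiff ENNReal

namespace Taub

/-! ### Scalar functions of the spectral value of the resolvent. -/

/-- The frequency `√(1/r - 1)` attached to the spectral value `r` of the resolvent `(1 + A)⁻¹`. -/
def freq (r : ℝ) : ℝ := √(1 / r - 1)

/-- The function `sin (t ω) / ω` of the spectral value `r`, where `ω = freq r`. -/
def sinQ (t r : ℝ) : ℝ := if r = 0 then 0 else t * Real.sinc (t * freq r)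

/-- The function `√r √(1 - r) sin (t ω)` of the spectral value `r`. -/
def sinP (t r : ℝ) : ℝ := √r * √(1 - r) * Real.sin (t * freq r)

/-- The function `√r cos (t ω)` of the spectral value `r`. -/
def cosP (t r : ℝ) : ℝ := √r * Real.cos (t * freq r)

lemma freq_nonneg (r : ℝ) : 0 ≤ freq r := Real.sqrt_nonneg _

lemma freq_zero : freq 0 = 0 := by
  rw [freq, Real.sqrt_eq_zero']; norm_num

lemma sqrt_mul_freq {r : ℝ} (h0 : 0 < r) : √r * freq r = √(1 - r) := by
  rw [freq, ← Real.sqrt_mul h0.le]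
  congr 1
  field_simp

lemma freq_mul_sinQ (t r : ℝ) : freq r * sinQ t r = Real.sin (t * freq r) := by
  unfold sinQ
  split_ifs with h
  · simp [h, freq_zero]
  · rcases eq_or_ne (t * freq r) 0 with h0 | h0
    · rw [h0]; simp only [Real.sin_zero, Real.sinc_zero]; linarith
    · rw [Real.sinc_of_ne_zero h0]
      have : freq r ≠ 0 := right_ne_zero_of_mul h0
      have : t ≠ 0 := left_ne_zero_of_mul h0
      field_simp

lemma hasDerivAt_sinQ {r : ℝ} (hr : r ≠ 0) (t : ℝ) :
    HasDerivAt (fun t => sinQ t r) (Real.cos (t * freq r)) t := by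
  rcases eq_or_ne (freq r) 0 with h | h
  · have : (fun t => sinQ t r) = fun t => t := by
      ext t; simp [sinQ, hr, h]
    rw [this, h]; simpa using hasDerivAt_id' t
  · have : (fun t => sinQ t r) = fun t => Real.sin (t * freq r) / freq r := by
      ext t; rw [← freq_mul_sinQ]; field_simp
    rw [this]
    have h1 := ((Real.hasDerivAt_sin (t * freq r)).comp t
      ((hasDerivAt_id t).mul_const (freq r))).div_const (freq r)
    refine h1.congr_deriv ?_
    field_simp

lemma hasDerivAt_cosP (r t : ℝ) :
    HasDerivAt (fun t => cosP t r) (-(√r * freq r * Real.sin (t * freq r))) t := by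
  have h1 := ((Real.hasDerivAt_cos (t * freq r)).comp t
      ((hasDerivAt_id t).mul_const (freq r))).const_mul (√r)
  refine h1.congr_deriv ?_
  ring

lemma hasDerivAt_sinP (r t : ℝ) :
    HasDerivAt (fun t => sinP t r) (√r * √(1 - r) * freq r * Real.cos (t * freq r)) t := by
  have h1 := ((Real.hasDerivAt_sin (t * freq r)).comp t
      ((hasDerivAt_id t).mul_const (freq r))).const_mul (√r * √(1 - r))
  refine h1.congr_deriv ?_
  ring

lemma sqrt_mul_freq_le {r : ℝ} (hr : r ∈ Icc (0 : ℝ) 1) : √r * freq r ≤ 1 := by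
  rcases eq_or_lt_of_le hr.1 with h | h
  · simp [← h]
  · rw [sqrt_mul_freq h, Real.sqrt_le_one]; linarith

lemma sqrt_one_sub_le {r : ℝ} (hr : r ∈ Icc (0 : ℝ) 1) : √(1 - r) ≤ 1 := by
  rw [Real.sqrt_le_one]; linarith [hr.1]

lemma abs_sub_le_of_hasDerivAt {F F' : ℝ → ℝ} {K : ℝ} (hd : ∀ t, HasDerivAt F (F' t) t)
    (hK : ∀ t, |F' t| ≤ K) (t s : ℝ) : |F t - F s| ≤ K * |t - s| := by
  simpa using convex_univ.norm_image_sub_le_of_norm_hasDerivWithin_le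
    (fun x _ => (hd x).hasDerivWithinAt) (fun x _ => hK x) (mem_univ s) (mem_univ t)

lemma abs_cosP_sub_le {r : ℝ} (hr : r ∈ Icc (0 : ℝ) 1) (t s : ℝ) :
    |cosP t r - cosP s r| ≤ 1 * |t - s| := by
  refine abs_sub_le_of_hasDerivAt (fun t => hasDerivAt_cosP r t) (fun t => ?_) t s
  rw [abs_neg, abs_mul, abs_of_nonneg (mul_nonneg (Real.sqrt_nonneg _) (freq_nonneg _))]
  exact mul_le_one₀ (sqrt_mul_freq_le hr) (abs_nonneg _) (Real.abs_sin_le_one _)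

lemma abs_sinP_sub_le {r : ℝ} (hr : r ∈ Icc (0 : ℝ) 1) (t s : ℝ) :
    |sinP t r - sinP s r| ≤ 1 * |t - s| := by
  refine abs_sub_le_of_hasDerivAt (fun t => hasDerivAt_sinP r t) (fun t => ?_) t s
  have h1 : √r * √(1 - r) * freq r = √(1 - r) * (√r * freq r) := by ring
  have h0 := mul_nonneg (Real.sqrt_nonneg r) (freq_nonneg r)
  rw [h1, abs_mul, abs_of_nonneg (mul_nonneg (Real.sqrt_nonneg _) h0)]
  exact mul_le_one₀ (mul_le_one₀ (sqrt_one_sub_le hr) h0 (sqrt_mul_freq_le hr))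
    (abs_nonneg _) (Real.abs_cos_le_one _)

lemma abs_sinQ_sub_le (r t s : ℝ) : |sinQ t r - sinQ s r| ≤ 1 * |t - s| := by
  rcases eq_or_ne r 0 with h | h
  · simp [sinQ, h]
  · exact abs_sub_le_of_hasDerivAt (fun t => hasDerivAt_sinQ h t)
      (fun t => Real.abs_cos_le_one _) t s

lemma sqrt_mul_sqrt_one_sub_mul_freq {r : ℝ} (hr : r ∈ Icc (0 : ℝ) 1) :
    √r * (√r * √(1 - r) * freq r) = √r * (1 - r) := by
  rcases eq_or_lt_of_le hr.1 with h | h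
  · simp [← h]
  · rw [show √r * (√r * √(1 - r) * freq r) = √r * √(1 - r) * (√r * freq r) by ring,
      sqrt_mul_freq h, mul_assoc, Real.mul_self_sqrt (by linarith [hr.2])]

/-- From `r ω² = 1 - r` one gets `(1 - r) sin(tω)/ω = r ω sin(tω)`. This is the scalar form of
applying `1 - R` to the second term of the solution. -/
lemma one_sub_mul_sinQ {r : ℝ} (hr : r ∈ Icc (0 : ℝ) 1) (t : ℝ) :
    (1 - r) * sinQ t r = sinP t r := by
  rcases eq_or_lt_of_le hr.1 with h | h
  · simp [← h, sinQ, sinP]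
  · rw [sinP, ← freq_mul_sinQ]
    calc (1 - r) * sinQ t r = √(1 - r) * √(1 - r) * sinQ t r := by
          rw [Real.mul_self_sqrt (by linarith [hr.2])]
      _ = √(1 - r) * (√r * freq r) * sinQ t r := by rw [sqrt_mul_freq h]
      _ = _ := by ring

lemma continuousOn_freq : ContinuousOn freq (Ioc 0 1) := by
  unfold freq
  refine ContinuousOn.sqrt (ContinuousOn.sub (ContinuousOn.div continuousOn_const continuousOn_id ?_)
    continuousOn_const)
  intro x hx; exact hx.1.ne'

/-- As `r → 0` the frequency blows up and the trigonometric factors oscillate; continuity at `0`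
comes only from the decay of the amplitude. -/
lemma continuousOn_of_abs_le_sqrt {F : ℝ → ℝ} {C : ℝ} (hF : ContinuousOn F (Ioc 0 1))
    (hC : ∀ r ∈ Icc (0 : ℝ) 1, |F r| ≤ C * √r) : ContinuousOn F (Icc 0 1) := by
  intro r hr
  rcases eq_or_lt_of_le hr.1 with h | h
  · subst h
    have h0 : F 0 = 0 := by simpa using hC 0 hr
    rw [ContinuousWithinAt, h0, tendsto_zero_iff_abs_tendsto_zero]
    refine squeeze_zero' (Eventually.of_forall fun _ => abs_nonneg _)
      (eventually_nhdsWithin_of_forall hC) ?_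
    have : Continuous fun r : ℝ => C * √r := by fun_prop
    simpa using (this.tendsto 0).mono_left nhdsWithin_le_nhds
  · have h1 := hF r ⟨h, hr.2⟩
    refine h1.mono_of_mem_nhdsWithin ?_
    rw [mem_nhdsWithin]
    exact ⟨Ioi 0, isOpen_Ioi, h, fun x hx => ⟨hx.1, hx.2.2⟩⟩

lemma abs_cosP_le (t r : ℝ) : |cosP t r| ≤ √r := by
  rw [cosP, abs_mul, abs_of_nonneg (Real.sqrt_nonneg _)]
  exact mul_le_of_le_one_right (Real.sqrt_nonneg _) (Real.abs_cos_le_one _)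

lemma abs_sinP_le {r : ℝ} (hr : r ∈ Icc (0 : ℝ) 1) (t : ℝ) : |sinP t r| ≤ √r := by
  rw [sinP, abs_mul, abs_of_nonneg (mul_nonneg (Real.sqrt_nonneg _) (Real.sqrt_nonneg _)),
    mul_assoc]
  exact mul_le_of_le_one_right (Real.sqrt_nonneg _)
    (mul_le_one₀ (sqrt_one_sub_le hr) (abs_nonneg _) (Real.abs_sin_le_one _))

lemma continuousOn_cosP (t : ℝ) : ContinuousOn (cosP t) (Icc 0 1) := by
  refine continuousOn_of_abs_le_sqrt (C := 1) ?_ (fun r _ => by simpa using abs_cosP_le t r)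
  have := continuousOn_freq
  exact ContinuousOn.mul (by fun_prop)
    (Real.continuous_cos.comp_continuousOn (continuousOn_const.mul this))

lemma continuousOn_sinP (t : ℝ) : ContinuousOn (sinP t) (Icc 0 1) := by
  refine continuousOn_of_abs_le_sqrt (C := 1) ?_ (fun r hr => by simpa using abs_sinP_le hr t)
  have := continuousOn_freq
  exact ContinuousOn.mul (by fun_prop)
    (Real.continuous_sin.comp_continuousOn (continuousOn_const.mul this))

lemma continuousOn_sinQ (t : ℝ) : ContinuousOn (sinQ t) (Icc 0 1) := by
  refine continuousOn_of_abs_le_sqrt (C := 2 * (1 + |t|)) ?_ (fun r hr => ?_)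
  · have := continuousOn_freq
    have h1 : ContinuousOn (fun r => t * Real.sinc (t * freq r)) (Ioc 0 1) :=
      continuousOn_const.mul
        (Real.continuous_sinc.comp_continuousOn (continuousOn_const.mul this))
    refine h1.congr fun r hr => ?_
    simp [sinQ, hr.1.ne']
  · have ht : |sinQ t r| ≤ |t| := by
      have := abs_sinQ_sub_le r t 0
      simpa [sinQ] using this
    -- For `r ≤ 1/2`, `(1 - r) |sinQ t r| ≤ √r` gives the bound `2 √r`; for `r ≥ 1/2`, `√r ≥ 1/2`
    -- and `|sinQ t r| ≤ |t|`. The constant `2 (1 + |t|)` covers both.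
    rcases le_total r (1 / 2) with h | h
    · have h1 : |(1 - r) * sinQ t r| ≤ √r := by
        rw [one_sub_mul_sinQ hr]; exact abs_sinP_le hr t
      rw [abs_mul, abs_of_nonneg (by linarith)] at h1
      have h2 := abs_nonneg (sinQ t r)
      have h3 := mul_nonneg (abs_nonneg t) (Real.sqrt_nonneg r)
      nlinarith
    · have h1 : 1 / 2 ≤ √r := by
        apply Real.le_sqrt_of_sq_le; linarith
      have h3 := abs_nonneg t
      nlinarith

/-! ### Continuous functional calculus depending on a parameter. -/

section CFC

variable {H : Type*} [NormedAddCommGroup H] [InnerProductSpace ℂ H] [CompleteSpace H]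
  {R : H →L[ℂ] H}

lemma continuous_cfc_param (hspec : spectrum ℝ R ⊆ Icc 0 1)
    {F : ℝ → ℝ → ℝ} {K : ℝ} (hF : ∀ t, ContinuousOn (F t) (Icc 0 1))
    (hL : ∀ r ∈ Icc (0 : ℝ) 1, ∀ t s, |F t r - F s r| ≤ K * |t - s|) :
    Continuous fun t => cfc (F t) R := by
  have hK : 0 ≤ K := by
    have := hL 0 (by simp) 1 0
    simpa using (abs_nonneg _).trans this
  refine (LipschitzWith.of_dist_le_mul (K := ⟨K, hK⟩) fun t s => ?_).continuous
  rw [dist_eq_norm, ← cfc_sub _ _ R ((hF t).mono hspec) ((hF s).mono hspec), Real.dist_eq]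
  exact norm_cfc_le (mul_nonneg hK (abs_nonneg _)) fun r hr => hL r (hspec hr) t s

/-- A Lipschitz bound on `F'` that is uniform in `r` makes the first-order Taylor remainder `O(|s -
t|²)` uniformly on the spectrum, hence in operator norm. -/
lemma hasDerivAt_cfc_param (hspec : spectrum ℝ R ⊆ Icc 0 1)
    {F F' : ℝ → ℝ → ℝ} {K : ℝ} (hF : ∀ t, ContinuousOn (F t) (Icc 0 1))
    (hF' : ∀ t, ContinuousOn (F' t) (Icc 0 1))
    (hd : ∀ r ∈ Icc (0 : ℝ) 1, ∀ t, HasDerivAt (fun t => F t r) (F' t r) t)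
    (hL : ∀ r ∈ Icc (0 : ℝ) 1, ∀ t s, |F' t r - F' s r| ≤ K * |t - s|) (t : ℝ) :
    HasDerivAt (fun t => cfc (F t) R) (cfc (F' t) R) t := by
  have hK : 0 ≤ K := by
    have := hL 0 (by simp) 1 0
    simpa using (abs_nonneg _).trans this
  have key : ∀ s, ‖cfc (F s) R - cfc (F t) R - (s - t) • cfc (F' t) R‖ ≤ K * |s - t| * |s - t| := by
    intro s
    have c1 := (hF s).mono hspec
    have c2 := (hF t).mono hspec
    have c3 := (hF' t).mono hspec
    rw [← cfc_smul (s - t) (F' t) R c3, ← cfc_sub _ _ R c1 c2,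
      ← cfc_sub (fun r => F s r - F t r) (fun r => (s - t) • F' t r) R (c1.sub c2)
        (c3.const_smul (s - t))]
    refine norm_cfc_le (by positivity) fun r hr => ?_
    have hr := hspec hr
    -- Mean value inequality for `x ↦ F x r - (x - t) F' t r`, whose derivative is at most `K |s -
    -- t|` between `t` and `s`.
    have := (convex_uIcc t s).norm_image_sub_le_of_norm_hasDerivWithin_le
      (f := fun x => F x r - (x - t) * F' t r) (f' := fun x => F' x r - F' t r) (C := K * |s - t|)
      (fun x _ => ((hd r hr x).sub (by
        simpa using ((hasDerivAt_id x).sub_const t).mul_const (F' t r))).hasDerivWithinAt)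
      (fun x hx => (hL r hr x t).trans (mul_le_mul_of_nonneg_left (abs_sub_left_of_mem_uIcc hx) hK))
      left_mem_uIcc right_mem_uIcc
    simp only [sub_self, zero_mul, sub_zero, Real.norm_eq_abs] at this
    rw [Real.norm_eq_abs, smul_eq_mul]
    convert this using 2
    ring
  rw [hasDerivAt_iff_isLittleO]
  rw [Asymptotics.isLittleO_iff]
  intro c hc
  have : ∀ᶠ s in 𝓝 t, K * |s - t| < c := by
    have h : Continuous fun s => K * |s - t| := by fun_prop
    exact h.continuousAt.eventually_lt continuousAt_const (by simpa using hc)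
  filter_upwards [this] with s hs
  refine (key s).trans ?_
  rw [Real.norm_eq_abs]
  exact mul_le_mul_of_nonneg_right hs.le (abs_nonneg _)

/-- Self-adjointness gives `‖p(R) x‖² = ⟪p²(R) x, x⟫`, and `q² - p² ≥ 0` on the spectrum. With `q =
√r` this yields bounds by `‖√R x‖`, which is how membership in the domain is checked. -/
lemma norm_cfc_apply_le (hspec : spectrum ℝ R ⊆ Icc 0 1) {p q : ℝ → ℝ}
    (hp : ContinuousOn p (Icc 0 1)) (hq : ContinuousOn q (Icc 0 1))
    (h : ∀ r ∈ Icc (0 : ℝ) 1, |p r| ≤ q r) (x : H) : ‖cfc p R x‖ ≤ ‖cfc q R x‖ := by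
  have sq : ∀ {p : ℝ → ℝ}, ContinuousOn p (Icc 0 1) →
      ‖cfc p R x‖ ^ 2 = RCLike.re (inner ℂ (cfc (fun r => p r * p r) R x) x) := by
    intro p hp
    rw [cfc_mul p p R (hp.mono hspec) (hp.mono hspec)]
    have hs : IsSelfAdjoint (cfc p R) := cfc_predicate p R
    have := (ContinuousLinearMap.isSelfAdjoint_iff_isSymmetric.1 hs) (cfc p R x) x
    rw [mul_apply_eq_comp]
    simp only [ContinuousLinearMap.coe_coe] at this
    rw [this, inner_self_eq_norm_sq]
  have h0 : (0 : H →L[ℂ] H) ≤ cfc (fun r => q r * q r - p r * p r) R := by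
    refine cfc_nonneg fun r hr => ?_
    have := h r (hspec hr)
    have := abs_le_abs_of_nonneg (abs_nonneg _) this
    have := sq_le_sq' (by linarith [abs_nonneg (p r)]) (h r (hspec hr))
    rw [sq_abs] at this
    nlinarith
  rw [cfc_sub (fun r => q r * q r) (fun r => p r * p r) R ((hq.mul hq).mono hspec) ((hp.mul hp).mono hspec),
    ContinuousLinearMap.nonneg_iff_isPositive] at h0
  have h1 := h0.re_inner_nonneg_left x
  rw [sub_apply, inner_sub_left, map_sub, ← sq hp, ← sq hq] at h1
  exact le_of_sq_le_sq (by linarith) (norm_nonneg _)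

end CFC

lemma hasDerivAt_clm_apply {H : Type*} [NormedAddCommGroup H] [InnerProductSpace ℂ H]
    {A : ℝ → H →L[ℂ] H} {A' : H →L[ℂ] H} {t : ℝ} (hA : HasDerivAt A A' t)
    (x : H) : HasDerivAt (fun t => A t x) (A' x) t :=
  (((ContinuousLinearMap.apply ℂ H x).restrictScalars ℝ).hasFDerivAt).comp_hasDerivAt t hA

/-! ### The abstract wave equation for an injective contraction between Hilbert spaces. -/

section Abstract

variable {E H : Type*} [NormedAddCommGroup E] [InnerProductSpace ℂ E] [CompleteSpace E]
  [NormedAddCommGroup H] [InnerProductSpace ℂ H] [CompleteSpace H]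

open ContinuousLinearMap in
/-- The resolvent `J J*` of the operator associated with the form of `E`. -/
def resolvent (J : E →L[ℂ] H) : H →L[ℂ] H := J ∘L adjoint J

open ContinuousLinearMap in
lemma resolvent_nonneg (J : E →L[ℂ] H) : 0 ≤ resolvent J := by
  rw [nonneg_iff_isPositive]
  exact isPositive_self_comp_adjoint J

lemma resolvent_isSelfAdjoint (J : E →L[ℂ] H) : IsSelfAdjoint (resolvent J) :=
  (resolvent_nonneg J).isSelfAdjoint

open ContinuousLinearMap in
lemma norm_resolvent_le {J : E →L[ℂ] H} (hJ : ‖J‖ ≤ 1) : ‖resolvent J‖ ≤ 1 := by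
  refine (opNorm_comp_le _ _).trans ?_
  rw [LinearIsometryEquiv.norm_map]
  exact mul_le_one₀ hJ (norm_nonneg _) hJ

lemma spectrum_resolvent {J : E →L[ℂ] H} (hJ : ‖J‖ ≤ 1) :
    spectrum ℝ (resolvent J) ⊆ Icc 0 1 := by
  rcases subsingleton_or_nontrivial H with h | h
  · have : Subsingleton (H →L[ℂ] H) := inferInstance
    rw [spectrum.of_subsingleton]; simp
  · intro r hr
    refine ⟨spectrum_nonneg_of_nonneg (resolvent_nonneg J) hr, ?_⟩
    have := spectrum.norm_le_norm_of_mem hr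
    exact (le_abs_self r).trans (this.trans (norm_resolvent_le hJ))

open ContinuousLinearMap in
lemma denseRange_adjoint {J : E →L[ℂ] H} (hinj : Function.Injective J) :
    DenseRange (adjoint J) := by
  have h : (adjoint J).range.topologicalClosure = ⊤ := by
    rw [Submodule.topologicalClosure_eq_top_iff, orthogonal_range, adjoint_adjoint]
    exact LinearMap.ker_eq_bot.2 hinj
  have := Submodule.dense_iff_topologicalClosure_eq_top.2 h
  exact this

open ContinuousLinearMap in
/-- The polar decomposition of an injective contraction. -/
lemma exists_polar {J : E →L[ℂ] H} (hinj : Function.Injective J) (hJ : ‖J‖ ≤ 1) :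
    ∃ W : E →L[ℂ] H, adjoint W ∘L W = .id ℂ E ∧ cfc Real.sqrt (resolvent J) ∘L W = J ∧
      J ∘L adjoint W = cfc Real.sqrt (resolvent J) := by
  set S := cfc Real.sqrt (resolvent J) with hS
  have hSS : S * S = resolvent J := by
    rw [hS, ← cfc_mul _ _ _ (by fun_prop) (by fun_prop)]
    conv_rhs => rw [← cfc_id' ℝ (resolvent J) (resolvent_isSelfAdjoint J)]
    refine cfc_congr fun r hr => ?_
    exact Real.mul_self_sqrt (spectrum_resolvent hJ hr).1
  have hSa : IsSelfAdjoint S := cfc_predicate _ _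
  have hSa' : adjoint S = S := hSa.adjoint_eq
  have hinner : ∀ x y, inner ℂ (S x) (S y) = inner ℂ (adjoint J x) (adjoint J y) := by
    intro x y
    rw [adjoint_inner_right, ← adjoint_inner_right S, hSa', ← mul_apply_eq_comp, hSS,
      ← adjoint_inner_right, ← adjoint_inner_right,
      adjoint_adjoint]
    rfl
  have hd := denseRange_adjoint hinj
  -- Both squared norms equal `⟪R x, x⟫`, so `J* x ↦ S x` is well defined and isometric on the range
  -- of `J*`, which is dense because `J` is injective. `W` is its extension.
  have hnorm : ∀ x, ‖S x‖ = ‖adjoint J x‖ := by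
    intro x
    have := hinner x x
    rw [inner_self_eq_norm_sq_to_K, inner_self_eq_norm_sq_to_K] at this
    have h2 : ‖S x‖ ^ 2 = ‖adjoint J x‖ ^ 2 := by exact_mod_cast this
    exact (pow_left_inj₀ (norm_nonneg _) (norm_nonneg _) two_ne_zero).1 h2
  let W : E →L[ℂ] H := (S : H →ₗ[ℂ] H).extendOfNorm (adjoint J : H →ₗ[ℂ] E)
  have hW : ∀ x, W (adjoint J x) = S x := fun x =>
    LinearMap.extendOfNorm_eq (f := (S : H →ₗ[ℂ] H)) (e := (adjoint J : H →ₗ[ℂ] E)) hd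
      ⟨1, fun x => by simpa using (hnorm x).le⟩ x
  have hWJ : W ∘L adjoint J = S := by ext x; exact hW x
  have hJW : J ∘L adjoint W = S := by
    rw [← hSa', ← hWJ, adjoint_comp, adjoint_adjoint]
  have hWW : adjoint W ∘L W = .id ℂ E := by
    have : (adjoint W ∘L W : E → E) = id := by
      refine hd.equalizer (by fun_prop) continuous_id ?_
      ext x
      refine hd.eq_of_inner_left (𝕜 := ℂ) (fun y => ?_)
      simp only [Function.comp_apply, coe_comp, id_eq]
      rw [adjoint_inner_left, hW, hW, hinner]
    ext x; exact congrFun this x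
  refine ⟨W, hWW, ?_, hJW⟩
  rw [← hJW, comp_assoc, hWW, comp_id]

open ContinuousLinearMap in
/-- A functional on `E` that is bounded for the norm of `H` is represented by a vector of `H`. -/
lemma exists_adjoint_eq {J : E →L[ℂ] H} {f : E} {C : ℝ}
    (hf : ∀ e, ‖inner ℂ f e‖ ≤ C * ‖J e‖) : ∃ h : H, adjoint J h = f := by
  -- The functional factors through the range of `J`. It extends to the closure of that range, where
  -- the Riesz theorem provides the representing vector.
  let p : Submodule ℂ H := J.range.topologicalClosure
  let e' : E →ₗ[ℂ] p := (J : E →ₗ[ℂ] H).codRestrict p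
    (fun x => J.range.le_topologicalClosure ⟨x, rfl⟩)
  have hd : DenseRange e' := by
    have h1 : Dense (Set.range fun x : J.range => (⟨x.1, J.range.le_topologicalClosure x.2⟩ : p)) := by
      intro y
      rw [closure_subtype, ← range_comp]
      have := y.2
      change (y : H) ∈ closure (Set.range fun x : J.range => (x : H))
      rw [show (Set.range fun x : J.range => (x : H)) = J.range from Subtype.range_coe]
      exact this
  
    refine h1.mono ?_
    rintro _ ⟨⟨_, x, rfl⟩, rfl⟩
    exact ⟨x, rfl⟩
  let l : p →L[ℂ] ℂ := ((innerSL ℂ f : E →L[ℂ] ℂ) : E →ₗ[ℂ] ℂ).extendOfNorm e'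
  have hl : ∀ x, l (e' x) = inner ℂ f x := fun x =>
    LinearMap.extendOfNorm_eq (f := ((innerSL ℂ f : E →L[ℂ] ℂ) : E →ₗ[ℂ] ℂ)) (e := e') hd
      ⟨C, hf⟩ x
  have : CompleteSpace p := J.range.isClosed_topologicalClosure.completeSpace_coe
  let h : p := (InnerProductSpace.toDual ℂ p).symm l
  refine ⟨h, ext_inner_right ℂ fun x => ?_⟩
  rw [adjoint_inner_left, ← hl, ← InnerProductSpace.toDual_symm_apply]
  rfl

open ContinuousLinearMap in
/-- Existence for the abstract wave equation with form `⟪η, u⟫_E - ⟪J η, J u⟫_H`. -/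
theorem exists_wave {J : E →L[ℂ] H} (hinj : Function.Injective J) (hJ : ‖J‖ ≤ 1) {f g : E} {C : ℝ}
    (hf : ∀ e, ‖inner ℂ e f - inner ℂ (J e) (J f)‖ ≤ C * ‖J e‖) :
    ∃ (φ : ℝ → E) (ψ : ℝ → H), Continuous φ ∧ Continuous ψ ∧
      (∀ t, HasDerivAt (fun t => J (φ t)) (ψ t) t) ∧ φ 0 = f ∧ ψ 0 = J g ∧
      (∀ e t, HasDerivAt (fun t => inner ℂ (J e) (ψ t))
        (-(inner ℂ e (φ t) - inner ℂ (J e) (J (φ t)))) t) ∧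
      ∀ t, ∃ C, ∀ e, ‖inner ℂ e (φ t) - inner ℂ (J e) (J (φ t))‖ ≤ C * ‖J e‖ := by
  obtain ⟨W, hWW, hSW, hJW⟩ := exists_polar hinj hJ
  set R := resolvent J with hRdef
  have hspec : spectrum ℝ R ⊆ Icc 0 1 := spectrum_resolvent hJ
  have hR : IsSelfAdjoint R := resolvent_isSelfAdjoint J
  set S := cfc Real.sqrt R with hS
  have hSa : adjoint S = S := (cfc_predicate Real.sqrt R : IsSelfAdjoint S).adjoint_eq
  have cS : ContinuousOn Real.sqrt (spectrum ℝ R) := by fun_prop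
  -- The initial position lies in the domain exactly when its full energy pairing is also
  -- `H`-bounded; the term `⟪J e, J f⟫` costs the extra `‖J f‖`. Formally `h = (1 + A) f`.
  obtain ⟨h, rfl⟩ : ∃ h : H, adjoint J h = f := by
    refine exists_adjoint_eq (C := C + ‖J f‖) fun e => ?_
    rw [norm_inner_symm]
    have h1 := norm_inner_le_norm (𝕜 := ℂ) (J e) (J f)
    have := norm_sub_norm_le (inner ℂ e f) (inner ℂ (J e) (J f))
    linarith [hf e]
  have hmul : ∀ {F : ℝ → ℝ}, ContinuousOn F (Icc 0 1) →
      S ∘L cfc F R = cfc (fun r => √r * F r) R := fun hF =>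
    (cfc_mul Real.sqrt _ R cS (hF.mono hspec)).symm
  have hone : ∀ {F : ℝ → ℝ}, ContinuousOn F (Icc 0 1) → ∀ x,
      cfc F R x - R (cfc F R x) = cfc (fun r => (1 - r) * F r) R x := by
    intro F hF x
    have h1 : cfc F R - R * cfc F R = cfc (fun r => (1 - r) * F r) R := by
      nth_rewrite 2 [← cfc_id' ℝ R hR]
      rw [← cfc_mul _ _ R (by fun_prop) (hF.mono hspec),
        ← cfc_sub F (fun r => r * F r) R (hF.mono hspec)
          (continuousOn_id.mul (hF.mono hspec))]
      refine cfc_congr fun r _ => ?_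
      ring
    rw [← h1]; rfl
  have cC := continuousOn_cosP
  have cP := continuousOn_sinP
  have cQ := continuousOn_sinQ
  have c1 : ContinuousOn (fun r : ℝ => 1 - r) (Icc 0 1) := by fun_prop
  have cs : ContinuousOn (fun r : ℝ => √r) (Icc 0 1) := by fun_prop
  -- `u` is the formal solution `cos(tω) W f + sin(tω)/ω W g`, with `W f = √R h` absorbed into
  -- `cosP`. The solution will be `W* u`, and `J W* = √R`, so `ψ` is the derivative of `√R u`: on
  -- the spectrum, `√r cosP` has derivative `-sinP` and `√r sinQ` has derivative `cosP`.
  let u : ℝ → H := fun t => cfc (cosP t) R h + cfc (sinQ t) R (W g)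
  let ψ : ℝ → H := fun t => -cfc (sinP t) R h + cfc (cosP t) R (W g)
  have hcos : Continuous fun t => cfc (cosP t) R :=
    continuous_cfc_param hspec cC fun r hr => abs_cosP_sub_le hr
  have hsinP : Continuous fun t => cfc (sinP t) R :=
    continuous_cfc_param hspec cP fun r hr => abs_sinP_sub_le hr
  have hsinQ : Continuous fun t => cfc (sinQ t) R :=
    continuous_cfc_param hspec cQ fun r hr => abs_sinQ_sub_le r
  have hu : Continuous u := (hcos.clm_apply continuous_const).add (hsinQ.clm_apply continuous_const)
  have hψ : Continuous ψ :=
    (hsinP.clm_apply continuous_const).neg.add (hcos.clm_apply continuous_const)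
  have hJu : ∀ t, J (adjoint W (u t)) = S (u t) := fun t => DFunLike.congr_fun hJW _
  have hJS : ∀ e, J e = S (W e) := fun e => (DFunLike.congr_fun hSW e).symm
  -- derivatives of the operator families
  have d1 : ∀ t, HasDerivAt (fun t => cfc (fun r => √r * cosP t r) R)
      (cfc (fun r => -sinP t r) R) t := by
    refine hasDerivAt_cfc_param (K := 1) (F' := fun t r => -sinP t r) hspec
      (fun t => cs.mul (cC t)) (fun t => (cP t).neg) (fun r hr t => ?_) (fun r hr t s => ?_)
    · refine ((hasDerivAt_cosP r t).const_mul (√r)).congr_deriv ?_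
      rcases eq_or_lt_of_le hr.1 with h | h
      · simp [← h, sinP]
      · rw [sinP, ← sqrt_mul_freq h]; ring
    · rw [neg_sub_neg, abs_sub_comm]; exact abs_sinP_sub_le hr t s
  have d2 : ∀ t, HasDerivAt (fun t => cfc (fun r => √r * sinQ t r) R) (cfc (cosP t) R) t := by
    refine hasDerivAt_cfc_param (K := 1) hspec
      (fun t => cs.mul (cQ t)) cC (fun r hr t => ?_) (fun r hr => abs_cosP_sub_le hr)
    rcases eq_or_ne r 0 with h | h
    · simpa [h, cosP, sinQ] using hasDerivAt_const t (0 : ℝ)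
    · exact (hasDerivAt_sinQ h t).const_mul (√r)
  have d3 : ∀ t, HasDerivAt (fun t => cfc (fun r => √r * sinP t r) R)
      (cfc (fun r => (1 - r) * cosP t r) R) t := by
    refine hasDerivAt_cfc_param (K := 1) (F' := fun t r => (1 - r) * cosP t r) hspec
      (fun t => cs.mul (cP t)) (fun t => c1.mul (cC t)) (fun r hr t => ?_) (fun r hr t s => ?_)
    · refine ((hasDerivAt_sinP r t).const_mul (√r)).congr_deriv ?_
      rw [← mul_assoc, sqrt_mul_sqrt_one_sub_mul_freq hr, cosP]; ring
    · rw [← mul_sub, abs_mul]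
      have h1 : |1 - r| ≤ 1 := abs_le.2 ⟨by linarith [hr.2], by linarith [hr.1]⟩
      exact (mul_le_of_le_one_left (abs_nonneg _) h1).trans (abs_cosP_sub_le hr t s)
  -- Transported by `W`, the form is represented by `1 - R`: the energy pairing is `⟪W e, u⟫`, and
  -- the `H` pairing is `⟪√R W e, √R u⟫ = ⟪W e, R u⟫`.
  have hb : ∀ e t, inner ℂ e (adjoint W (u t)) - inner ℂ (J e) (J (adjoint W (u t))) =
      inner ℂ (W e) (u t - R (u t)) := by
    intro e t
    rw [adjoint_inner_right, inner_sub_right, hJu, hJS, ← adjoint_inner_right S, hSa]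
    congr 2
    have : S * S = R := by
      rw [hS, ← cfc_mul _ _ _ cS cS]
      conv_rhs => rw [← cfc_id' ℝ R hR]
      exact cfc_congr fun r hr => Real.mul_self_sqrt (hspec hr).1
    rw [← this]; rfl
  have hu1 : ∀ t, u t - R (u t) = cfc (fun r => (1 - r) * cosP t r) R h + cfc (sinP t) R (W g) := by
    intro t
    have e1 : cfc (sinP t) R = cfc (fun r => (1 - r) * sinQ t r) R :=
      cfc_congr fun r hr => (one_sub_mul_sinQ (hspec hr) t).symm
    rw [e1, ← hone (cC t), ← hone (cQ t)]
    simp only [u, map_add]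
    abel
  refine ⟨fun t => adjoint W (u t), ψ, by fun_prop, hψ, ?_, ?_, ?_, ?_, ?_⟩
  · intro t
    have h1 : (fun t => J (adjoint W (u t))) = fun t =>
        cfc (fun r => √r * cosP t r) R h + cfc (fun r => √r * sinQ t r) R (W g) := by
      ext t
      rw [hJu, ← hmul (cC t), ← hmul (cQ t)]
      simp [u]
    rw [h1]
    refine ((hasDerivAt_clm_apply (d1 t) h).add
      (hasDerivAt_clm_apply (d2 t) (W g))).congr_deriv ?_
    simp only [ψ]
    rw [cfc_neg]; rfl
  · apply hinj
    have h1 : cfc (cosP 0) R = S := by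
      rw [hS]; refine cfc_congr fun r _ => ?_
      simp [cosP]
    have h2 : cfc (sinQ 0) R = 0 := by
      rw [← cfc_zero ℝ R]; refine cfc_congr fun r _ => ?_
      simp [sinQ]
    rw [hJu]
    simp only [u, h1, h2, zero_apply, add_zero]
    have : S * S = R := by
      rw [hS, ← cfc_mul _ _ _ cS cS]
      conv_rhs => rw [← cfc_id' ℝ R hR]
      exact cfc_congr fun r hr => Real.mul_self_sqrt (hspec hr).1
    exact DFunLike.congr_fun this h
  · have h1 : cfc (cosP 0) R = S := by
      rw [hS]; refine cfc_congr fun r _ => ?_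
      simp [cosP]
    have h2 : cfc (sinP 0) R = 0 := by
      rw [← cfc_zero ℝ R]; refine cfc_congr fun r _ => ?_
      simp [sinP]
    simp only [ψ, h1, h2, zero_apply, neg_zero, zero_add]
    exact (hJS g).symm
  -- The factor `√R` of `J e = √R W e` is moved onto `ψ`. This makes the families norm
  -- differentiable in `t`, and their derivative is `-(1 - R) u`.
  · intro e t
    have h1 : (fun t => inner ℂ (J e) (ψ t)) = fun t => inner ℂ (W e)
        (-cfc (fun r => √r * sinP t r) R h + cfc (fun r => √r * cosP t r) R (W g)) := by
      ext t
      rw [hJS, ← hmul (cC t), ← hmul (cP t), ← adjoint_inner_right S, hSa]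
      simp [ψ, inner_add_right]
    rw [h1, hb, hu1]
    have h2 := (hasDerivAt_clm_apply (d3 t) h).neg.add
      (hasDerivAt_clm_apply (d1 t) (W g))
    have h3 := (hasDerivAt_const t (W e)).inner ℂ h2
    refine h3.congr_deriv ?_
    simp only [add_zero, inner_zero_left]
    rw [cfc_neg, ← inner_neg_right]
    congr 1
    simp [add_comm]
  · intro t
    refine ⟨‖h‖ + ‖W g‖, fun e => ?_⟩
    rw [hb, hu1, inner_add_right]
    -- A multiplier dominated by `√r` pairs with `W e` at a cost of at most `‖√R W e‖ = ‖J e‖`. Both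
    -- multipliers in `(1 - R) u` are of this kind, so the solution remains in the domain.
    have key : ∀ {F : ℝ → ℝ}, ContinuousOn F (Icc 0 1) → (∀ r ∈ Icc (0 : ℝ) 1, |F r| ≤ √r) →
        ∀ x, ‖inner ℂ (W e) (cfc F R x)‖ ≤ ‖x‖ * ‖J e‖ := by
      intro F hF hle x
      have hs : adjoint (cfc F R) = cfc F R :=
        (cfc_predicate F R : IsSelfAdjoint (cfc F R)).adjoint_eq
      rw [← hs, adjoint_inner_right, mul_comm, hJS]
      refine (norm_inner_le_norm _ _).trans ?_
      exact mul_le_mul_of_nonneg_right (norm_cfc_apply_le hspec hF cs hle _) (norm_nonneg _)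
    rw [add_mul]
    refine (norm_add_le _ _).trans (add_le_add (key (c1.mul (cC t)) (fun r hr => ?_) h)
      (key (cP t) (fun r hr => abs_sinP_le hr t) _))
    change |(1 - r) * cosP t r| ≤ √r
    rw [abs_mul]
    have h1 : |1 - r| ≤ 1 := abs_le.2 ⟨by linarith [hr.2], by linarith [hr.1]⟩
    exact (mul_le_of_le_one_left (abs_nonneg _) h1).trans (abs_cosP_le t r)

-- A weak derivative that is norm continuous is a strong derivative: pairing with the Taylor
-- remainder itself turns the scalar mean value inequality into a bound on its norm.
omit [CompleteSpace H] in
lemma hasDerivWithinAt_of_inner {p q : ℝ → H} (hq : ContinuousOn q (Ici 0))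
    (h : ∀ y, ∀ t ∈ Ici (0 : ℝ),
      HasDerivWithinAt (fun s => inner ℂ y (p s)) (inner ℂ y (q t)) (Ici 0) t)
    {t : ℝ} (ht : t ∈ Ici (0 : ℝ)) : HasDerivWithinAt p (q t) (Ici 0) t := by
  rw [hasDerivWithinAt_iff_isLittleO, Asymptotics.isLittleO_iff]
  intro ε hε
  have h1 := Metric.continuousWithinAt_iff.1 (hq t ht) ε hε
  obtain ⟨δ, hδ, h2⟩ := h1
  have h3 : ∀ᶠ s in 𝓝[Ici 0] t, dist s t < δ :=
    nhdsWithin_le_nhds (Metric.ball_mem_nhds t hδ)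
  filter_upwards [h3, self_mem_nhdsWithin] with s hs hs0
  have hsub : uIcc t s ⊆ Ici 0 := fun x hx => le_trans (le_inf ht hs0) hx.1
  -- The remainder at the fixed time `s`, used as the test vector; the mean value inequality gives
  -- `‖d‖² ≤ ‖d‖ ε |s - t|`.
  obtain ⟨d, hd⟩ : ∃ d, d = p s - p t - (s - t) • q t := ⟨_, rfl⟩
  have key := (convex_uIcc t s).norm_image_sub_le_of_norm_hasDerivWithin_le
      (f := fun x => inner ℂ d (p x) - (x - t) • inner ℂ d (q t))
      (f' := fun x => inner ℂ d (q x) - (1 : ℝ) • inner ℂ d (q t)) (C := ‖d‖ * ε)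
      (fun x hx => ((h d x (hsub hx)).mono hsub).sub
        (((hasDerivAt_id' x).sub_const t).smul_const (inner ℂ d (q t))).hasDerivWithinAt)
      (fun x hx => by
        rw [one_smul, ← inner_sub_right]
        refine (norm_inner_le_norm _ _).trans (mul_le_mul_of_nonneg_left ?_ (norm_nonneg _))
        rw [← dist_eq_norm]
        refine (h2 (hsub hx) (lt_of_le_of_lt ?_ hs)).le
        rw [Real.dist_eq, Real.dist_eq]
        exact abs_sub_left_of_mem_uIcc hx)
      left_mem_uIcc right_mem_uIcc
  have e1 : inner ℂ d (p s) - (s - t) • inner ℂ d (q t) -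
      (inner ℂ d (p t) - (t - t) • inner ℂ d (q t)) = inner ℂ d d := by
    have e2 : inner ℂ d d = inner ℂ d (p s - p t - (s - t) • q t) := congrArg _ hd
    rw [e2, inner_sub_right, inner_sub_right, RCLike.real_smul_eq_coe_smul (K := ℂ) (s - t) (q t),
      inner_smul_right, Complex.real_smul]
    simp; ring
  have e3 : ‖inner ℂ d d‖ = ‖d‖ * ‖d‖ := by
    rw [inner_self_eq_norm_sq_to_K, norm_pow, sq]; simp
  rw [e1, e3] at key
  rw [← hd]
  rcases eq_or_lt_of_le (norm_nonneg d) with h0 | h0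
  · rw [← h0]; positivity
  · have : ‖d‖ * ‖d‖ ≤ ‖d‖ * (ε * ‖s - t‖) := by rw [← mul_assoc]; nlinarith
    exact le_of_mul_le_mul_left this h0

open ContinuousLinearMap in
/-- Uniqueness for the abstract wave equation with form `⟪η, u⟫_E - ⟪J η, J u⟫_H`. -/
theorem wave_eq_zero {J : E →L[ℂ] H} (hJ : ‖J‖ ≤ 1) {φ : ℝ → E} {ψ : ℝ → H}
    (hd : ∀ t ∈ Ici (0 : ℝ), HasDerivWithinAt (fun t => J (φ t)) (ψ t) (Ici 0) t)
    (heq : ∀ e, ∀ t ∈ Ici (0 : ℝ), HasDerivWithinAt (fun t => inner ℂ (J e) (ψ t))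
        (-(inner ℂ e (φ t) - inner ℂ (J e) (J (φ t)))) (Ici 0) t)
    (h0 : J (φ 0) = 0) (h1 : ψ 0 = 0) {t : ℝ} (ht : 0 ≤ t) : J (φ t) = 0 := by
  set R := resolvent J with hRdef
  have hRs : ∀ x y, inner ℂ (R x) y = inner ℂ x (R y) := fun x y =>
    isSelfAdjoint_iff_isSymmetric.1 (resolvent_isSelfAdjoint J) x y
  have hRJ : ∀ x y, inner ℂ (R x) y = inner ℂ (adjoint J x) (adjoint J y) := fun x y =>
    (adjoint_inner_right J (adjoint J x) y).symm
  set w : ℝ → H := fun t => J (φ t) with hw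
  have hwc : ContinuousOn w (Ici 0) := fun t ht => (hd t ht).continuousWithinAt
  set q : ℝ → H := fun t => -(w t - R (w t)) with hq
  have hqc : ContinuousOn q (Ici 0) := (hwc.sub (R.continuous.comp_continuousOn hwc)).neg
  -- Testing with `e = J* y` replaces `J e` by `R y`. Thus `R ψ` has the weak derivative `-(w - R
  -- w)`, which is continuous in `H`, and the derivative is strong.
  have hp : ∀ t ∈ Ici (0 : ℝ), HasDerivWithinAt (fun t => R (ψ t)) (q t) (Ici 0) t := by
    intro t ht
    refine hasDerivWithinAt_of_inner hqc (fun y t ht => ?_) ht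
    have := heq (adjoint J y) t ht
    simp only [adjoint_inner_left] at this
    have e1 : ∀ x, inner ℂ (J (adjoint J y)) x = inner ℂ y (R x) := fun x => hRs y x
    simp only [e1] at this
    refine this.congr_deriv ?_
    rw [hq, inner_neg_right, inner_sub_right]
  have hRw : ∀ t ∈ Ici (0 : ℝ), HasDerivWithinAt (fun t => R (w t)) (R (ψ t)) (Ici 0) t :=
    fun t ht => ((R.restrictScalars ℝ).hasFDerivAt.hasFDerivWithinAt).comp_hasDerivWithinAt t
      (hd t ht) (mapsTo_univ _ _)
  -- The energy of the smoothed solution `R w`: its velocity is `R ψ`, and `w - R w` stands for `A R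
  -- w`.
  set G : ℝ → ℂ := fun t => inner ℂ (R (ψ t)) (R (ψ t)) + inner ℂ (w t - R (w t)) (R (w t)) with hG
  have hGd : ∀ t ∈ Ici (0 : ℝ), HasDerivWithinAt (fun t => (G t).re) 0 (Ici 0) t := by
    intro t ht
    have h1 := ((hp t ht).inner ℂ (hp t ht)).add
      (((hd t ht).sub (hRw t ht)).inner ℂ (hRw t ht))
    have h2 := (Complex.reCLM.hasFDerivAt.hasFDerivWithinAt).comp_hasDerivWithinAt t
      h1 (mapsTo_univ _ _)
    refine h2.congr_deriv ?_
    simp only [hq, Pi.sub_apply, map_neg, map_sub, Complex.reCLM_apply, Complex.add_re,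
      inner_neg_left, inner_neg_right,
      Complex.neg_re, inner_sub_left, inner_sub_right, Complex.sub_re, hRs]
    have c : ∀ x y : H, (inner ℂ x y).re = (inner ℂ y x).re := fun x y => inner_re_symm (𝕜 := ℂ) x y
    rw [c (w t) (R (ψ t)), c (w t) (R (R (ψ t)))]
    simp only [hRs]
    ring
  have hG0 : ∀ t, 0 ≤ t → (G t).re = 0 := by
    intro t ht
    have := constant_of_has_deriv_right_zero (f := fun t => (G t).re) (a := 0) (b := t)
      (fun x hx => ((hGd x hx.1).continuousWithinAt).mono Icc_subset_Ici_self)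
      (fun x hx => (hGd x hx.1).mono (Ici_subset_Ici.2 hx.1)) t ⟨ht, le_rfl⟩
    rw [this]
    simp [hG, h1, hw, h0]
  -- This quantity is `‖J* x‖² - ‖J J* x‖²`, and `J` is a contraction.
  have hpos : ∀ x, 0 ≤ (inner ℂ (x - R x) (R x)).re := by
    intro x
    have e1 : (inner ℂ x (R x)).re = ‖adjoint J x‖ ^ 2 := by
      rw [← hRs, hRJ]; exact inner_self_eq_norm_sq (𝕜 := ℂ) _
    have e2 : (inner ℂ (R x) (R x)).re = ‖R x‖ ^ 2 := inner_self_eq_norm_sq (𝕜 := ℂ) _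
    have e3 : ‖R x‖ ≤ ‖adjoint J x‖ :=
      (J.le_opNorm _).trans (mul_le_of_le_one_left (norm_nonneg _) hJ)
    rw [inner_sub_left, Complex.sub_re, e1, e2]
    have := pow_le_pow_left₀ (norm_nonneg _) e3 2
    linarith
  have hp0 : ∀ t, 0 ≤ t → R (ψ t) = 0 := by
    intro t ht
    have h2 := hG0 t ht
    have e2 : (inner ℂ (R (ψ t)) (R (ψ t))).re = ‖R (ψ t)‖ ^ 2 := inner_self_eq_norm_sq (𝕜 := ℂ) _
    rw [hG, Complex.add_re, e2] at h2
    have h3 : ‖R (ψ t)‖ ^ 2 ≤ 0 := by linarith [hpos (w t)]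
    exact norm_eq_zero.1 (pow_eq_zero_iff two_ne_zero |>.1 (le_antisymm h3 (sq_nonneg _)))
  have hR0 : R (w t) = 0 := by
    have := constant_of_has_deriv_right_zero (f := fun t => R (w t)) (a := 0) (b := t)
      (fun x hx => ((hRw x hx.1).continuousWithinAt).mono Icc_subset_Ici_self)
      (fun x hx => by
        have := (hRw x hx.1).mono (Ici_subset_Ici.2 hx.1)
        rwa [hp0 x hx.1] at this) t ⟨ht, le_rfl⟩
    rw [this]; simp [hw, h0]
  -- `R w = 0` gives `‖J* w‖² = ⟪R w, w⟫ = 0`. Since `w = J φ`, also `‖w‖² = ⟪J* w, φ⟫ = 0`.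
  have h3 : adjoint J (w t) = 0 := by
    rw [← inner_self_eq_zero (𝕜 := ℂ), ← hRJ, hR0, inner_zero_left]
  change w t = 0
  rw [← inner_self_eq_zero (𝕜 := ℂ)]
  rw [hw, ← adjoint_inner_left]
  change inner ℂ (adjoint J (w t)) _ = _
  rw [h3, inner_zero_left]

end Abstract


/-! ### Weighted `L²` spaces on the half-space and test functions. -/

variable {n : ℕ}

/-- A positive continuous weight on `(0, ∞)`. -/
structure IsWeight (w : ℝ → ℝ) : Prop where
  meas : Measurable w
  pos : ∀ z, 0 < z → 0 < w z
  cont : ContinuousOn w (Ioi 0)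

/-- The measure `w(z) dμ` on `Ω`. -/
def wL (n : ℕ) (w : ℝ → ℝ) : Measure (Pt n) :=
  (volume.restrict (Om n)).withDensity fun p => ENNReal.ofReal (w p.2)

lemma isOpen_Om : IsOpen (Om n) := isOpen_lt continuous_const continuous_snd

lemma measurableSet_Om : MeasurableSet (Om n) := isOpen_Om.measurableSet

lemma IsWeight.measurable_ofReal {w : ℝ → ℝ} (hw : IsWeight w) :
    Measurable fun p : Pt n => ENNReal.ofReal (w p.2) :=
  ENNReal.measurable_ofReal.comp (hw.meas.comp measurable_snd)

lemma ae_wL {w : ℝ → ℝ} (hw : IsWeight w) {P : Pt n → Prop} :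
    (∀ᵐ p ∂wL n w, P p) ↔ ∀ᵐ p ∂volume.restrict (Om n), P p := by
  rw [wL, ae_withDensity_iff hw.measurable_ofReal]
  have h : ∀ᵐ p ∂volume.restrict (Om n), p ∈ Om n := ae_restrict_mem measurableSet_Om
  constructor
  · intro h1
    filter_upwards [h, h1] with p hp h2
    exact h2 (by simpa using hw.pos _ hp)
  · intro h1
    filter_upwards [h1] with p hp _ using hp

lemma integral_wL {w : ℝ → ℝ} (hw : IsWeight w) (f : Pt n → ℂ) :
    ∫ p, f p ∂wL n w = ∫ p in Om n, (w p.2 : ℂ) * f p := by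
  rw [wL, integral_withDensity_eq_integral_toReal_smul hw.measurable_ofReal
    (by simp)]
  refine setIntegral_congr_fun measurableSet_Om fun p hp => ?_
  simp only [ENNReal.toReal_ofReal (hw.pos _ hp).le, Complex.real_smul]

lemma aestronglyMeasurable_wL {w : ℝ → ℝ} (hw : IsWeight w) {f : Pt n → ℂ} :
    AEStronglyMeasurable f (wL n w) ↔ AEStronglyMeasurable f (volume.restrict (Om n)) := by
  constructor
  · rintro ⟨g, hg, h⟩; exact ⟨g, hg, (ae_wL hw).1 h⟩
  · rintro ⟨g, hg, h⟩; exact ⟨g, hg, (ae_wL hw).2 h⟩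

lemma wL_restrict_le {w₁ w₂ : ℝ → ℝ} {C : ℝ} (hC : 0 ≤ C) {S : Set (Pt n)} (hS : MeasurableSet S)
    (h : ∀ p ∈ S, 0 < p.2 → w₁ p.2 ≤ C * w₂ p.2) (hw : IsWeight w₂) :
    (wL n w₁).restrict S ≤ ENNReal.ofReal C • (wL n w₂).restrict S := by
  rw [wL, wL, restrict_withDensity hS, restrict_withDensity hS, ← withDensity_smul _
    hw.measurable_ofReal]
  refine withDensity_mono ?_
  filter_upwards [ae_restrict_mem hS, ae_restrict_of_ae (ae_restrict_mem measurableSet_Om)]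
    with p hp hp2
  simp only [Pi.smul_apply, smul_eq_mul]
  rw [← ENNReal.ofReal_mul hC]
  exact ENNReal.ofReal_le_ofReal (h p hp hp2)

lemma isWeight_one : IsWeight fun _ => 1 := ⟨measurable_const, by simp, continuousOn_const⟩

lemma wL_one : wL n (fun _ => 1) = volume.restrict (Om n) := by
  simp [wL, withDensity_const]

lemma IsWeight.bounds {w : ℝ → ℝ} (hw : IsWeight w) {K : Set (Pt n)} (hK : IsCompact K)
    (hKO : K ⊆ Om n) : ∃ c C : ℝ, 0 < c ∧ 0 < C ∧ ∀ p ∈ K, c ≤ w p.2 ∧ w p.2 ≤ C := by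
  have hc : ContinuousOn (fun p : Pt n => w p.2) K :=
    hw.cont.comp continuous_snd.continuousOn hKO
  rcases K.eq_empty_or_nonempty with rfl | hne
  · exact ⟨1, 1, one_pos, one_pos, by simp⟩
  · obtain ⟨a, ha, h1⟩ := hK.exists_isMinOn hne hc
    obtain ⟨b, hb, h2⟩ := hK.exists_isMaxOn hne hc
    exact ⟨w a.2, w b.2, hw.pos _ (hKO ha), hw.pos _ (hKO hb), fun p hp => ⟨h1 hp, h2 hp⟩⟩

lemma memLp_restrict_of_wL {w : ℝ → ℝ} (hw : IsWeight w) {S : Set (Pt n)} (hS : MeasurableSet S)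
    (hSO : S ⊆ Om n) {c : ℝ} (hc : 0 < c) (h : ∀ p ∈ S, c ≤ w p.2) {u : Pt n → ℂ}
    (hu : MemLp u 2 (wL n w)) : MemLp u 2 (volume.restrict S) := by
  have h1 := wL_restrict_le (n := n) (w₁ := fun _ => 1) (w₂ := w) (inv_nonneg.2 hc.le) hS
    (fun p hp _ => by rw [inv_mul_eq_div, one_le_div hc]; exact h p hp) hw
  rw [wL_one, Measure.restrict_restrict hS, inter_eq_left.2 hSO] at h1
  exact (hu.restrict S).of_measure_le_smul ENNReal.ofReal_ne_top h1

/-- On a compact subset of `Ω` the weight is continuous and positive, hence bounded below. -/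
lemma memL2loc_of_wL {w : ℝ → ℝ} (hw : IsWeight w) {u : Pt n → ℂ} (hu : MemLp u 2 (wL n w)) :
    MemL2loc u := by
  intro K hK hKO
  obtain ⟨c, C, hc, -, h⟩ := hw.bounds hK hKO
  exact memLp_restrict_of_wL hw hK.measurableSet hKO hc (fun p hp => (h p hp).1) hu

lemma wL_lt_top_of_isCompact {w : ℝ → ℝ} (hw : IsWeight w) {K : Set (Pt n)} (hK : IsCompact K)
    (hKO : K ⊆ Om n) : wL n w K < ⊤ := by
  obtain ⟨c, C, hc, hC, h⟩ := hw.bounds hK hKO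
  have h1 := wL_restrict_le (n := n) (w₁ := w) (w₂ := fun _ => 1) hC.le hK.measurableSet
    (fun p hp _ => by rw [mul_one]; exact (h p hp).2) isWeight_one
  have h2 := h1 univ
  rw [wL_one, Measure.restrict_restrict hK.measurableSet, inter_eq_left.2 hKO] at h2
  simp only [MeasurableSet.univ, Measure.restrict_apply, univ_inter, Measure.smul_apply,
    smul_eq_mul] at h2
  exact h2.trans_lt (ENNReal.mul_lt_top ENNReal.ofReal_lt_top hK.measure_lt_top)

lemma memLp_of_isCompact {w : ℝ → ℝ} (hw : IsWeight w) {K : Set (Pt n)} (hK : IsCompact K)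
    (hKO : K ⊆ Om n) {f : Pt n → ℂ} (hf : AEStronglyMeasurable f (wL n w)) {C : ℝ}
    (hb : ∀ p ∈ K, ‖f p‖ ≤ C) (h0 : ∀ p, p ∉ K → f p = 0) : MemLp f 2 (wL n w) := by
  have : f = K.indicator f := by
    ext p; by_cases hp : p ∈ K
    · simp [hp]
    · simp [hp, h0 p hp]
  rw [this, memLp_indicator_iff_restrict hK.measurableSet]
  have : IsFiniteMeasure ((wL n w).restrict K) :=
    ⟨by simpa using wL_lt_top_of_isCompact hw hK hKO⟩
  exact MemLp.of_bound hf.restrict C (ae_restrict_of_forall_mem hK.measurableSet hb)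

-- Division by the weight cancels the weight of the inner product, so that pairing with this vector
-- is the unweighted integral against `η`.
lemma IsTest.memLp_dual {η : Pt n → ℂ} (hη : IsTest η) {w : ℝ → ℝ} (hw : IsWeight w) :
    MemLp (fun p => star (η p) / (w p.2 : ℂ)) 2 (wL n w) := by
  obtain ⟨c, C, hc, hC, h⟩ := hw.bounds hη.compact hη.subset
  obtain ⟨M, hM⟩ := hη.compact.exists_bound_of_continuous hη.smooth.continuous
  have hm : Measurable fun p => star (η p) / (w p.2 : ℂ) :=
    (hη.smooth.continuous.star.measurable).div
      (Complex.measurable_ofReal.comp (hw.meas.comp measurable_snd))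
  refine memLp_of_isCompact (C := M / c) hw hη.compact hη.subset hm.aestronglyMeasurable
    (fun p hp => ?_) fun p hp => by simp [image_eq_zero_of_notMem_tsupport hp]
  have h1 := (h p hp).1
  rw [norm_div, norm_star, Complex.norm_real, Real.norm_of_nonneg (hc.le.trans h1)]
  exact div_le_div₀ ((norm_nonneg _).trans (hM p)) (hM p) hc h1

/-- The vector of `L²(w dμ)` that represents integration against a test function. -/
def IsTest.dual {η : Pt n → ℂ} (hη : IsTest η) {w : ℝ → ℝ} (hw : IsWeight w) :
    Lp ℂ 2 (wL n w) := (hη.memLp_dual hw).toLp _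

lemma inner_Lp_wL {w : ℝ → ℝ} (hw : IsWeight w) (U V : Lp ℂ 2 (wL n w)) :
    inner ℂ U V = ∫ p in Om n, (w p.2 : ℂ) * (V p * star (U p)) := by
  rw [L2.inner_def, integral_wL hw]
  rfl

lemma IsTest.inner_dual {η : Pt n → ℂ} (hη : IsTest η) {w : ℝ → ℝ} (hw : IsWeight w)
    (U : Lp ℂ 2 (wL n w)) : inner ℂ (hη.dual hw) U = ∫ p in Om n, U p * η p := by
  rw [inner_Lp_wL hw]
  have h := (ae_wL hw).1 (hη.memLp_dual hw).coeFn_toLp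
  refine integral_congr_ae ?_
  filter_upwards [h, ae_restrict_mem measurableSet_Om] with p hp hpO
  have : (w p.2 : ℂ) ≠ 0 := by exact_mod_cast (hw.pos _ hpO).ne'
  rw [IsTest.dual, hp]
  simp only [star_div₀, RCLike.star_def, Complex.conj_ofReal, Complex.conj_conj]
  field_simp

lemma IsTest.fderiv {η : Pt n → ℂ} (hη : IsTest η) (e : Pt n) :
    IsTest fun p => fderiv ℝ η p e :=
  ⟨(hη.smooth.fderiv_right (m := ∞) (by simp)).clm_apply contDiff_const,
    hη.compact.fderiv_apply ℝ e,
    ((tsupport_fderiv_apply_subset ℝ e).trans hη.subset)⟩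

lemma memL2loc_locallyIntegrableOn {u : Pt n → ℂ} (hu : MemL2loc u) :
    LocallyIntegrableOn u (Om n) volume := by
  rw [locallyIntegrableOn_iff isOpen_Om.isLocallyClosed]
  intro K hKO hK
  have : IsFiniteMeasure (volume.restrict K) := ⟨by simpa using hK.measure_lt_top⟩
  exact (hu K hK hKO).integrable one_le_two

lemma MemL2loc.integrable_mul {f : Pt n → ℂ} (hf : MemL2loc f) {g : Pt n → ℂ} (hg : Continuous g)
    (hc : HasCompactSupport g) (hs : tsupport g ⊆ Om n) :
    Integrable (fun p => f p * g p) (volume.restrict (Om n)) := by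
  obtain ⟨C, hC⟩ := hc.exists_bound_of_continuous hg
  have h1 : IntegrableOn (fun p => f p * g p) (tsupport g) volume :=
    ((memL2loc_locallyIntegrableOn hf).integrableOn_compact_subset hs hc).mul_bdd (c := C)
      hg.aestronglyMeasurable (Eventually.of_forall hC)
  exact h1.of_forall_sdiff_eq_zero measurableSet_Om fun p hp => by
    simp [image_eq_zero_of_notMem_tsupport hp.2]

lemma MemL2loc.integrable_mul_test {f : Pt n → ℂ} (hf : MemL2loc f) {η : Pt n → ℂ}
    (hη : IsTest η) : Integrable (fun p => f p * η p) (volume.restrict (Om n)) :=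
  hf.integrable_mul hη.smooth.continuous hη.compact hη.subset

/-- Locally square integrable functions are determined by their integrals against test
functions. -/
lemma ae_eq_of_test {u v : Pt n → ℂ} (hu : MemL2loc u) (hv : MemL2loc v)
    (h : ∀ η, IsTest η → ∫ p in Om n, u p * η p = ∫ p in Om n, v p * η p) :
    ∀ᵐ p ∂volume.restrict (Om n), u p = v p := by
  have hi : LocallyIntegrableOn (fun p => u p - v p) (Om n) volume :=
    (memL2loc_locallyIntegrableOn hu).sub (memL2loc_locallyIntegrableOn hv)
  have := isOpen_Om.ae_eq_zero_of_integral_contDiff_smul_eq_zero hi ?_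
  · rw [ae_restrict_iff' measurableSet_Om]
    filter_upwards [this] with p hp hpO
    exact sub_eq_zero.1 (hp hpO)
  · intro g h1 h2 h3
    have hη : IsTest fun p => (g p : ℂ) :=
      ⟨Complex.ofRealCLM.contDiff.comp h1, h2.comp_left (g := fun x : ℝ => (x : ℂ)) (by simp),
        (tsupport_comp_subset (g := fun x : ℝ => (x : ℂ)) (by simp) g).trans h3⟩
    have e := h _ hη
    have e2 : ∫ p, g p • (u p - v p) = ∫ p in Om n, (u p * (g p : ℂ) - v p * (g p : ℂ)) := by
      rw [← setIntegral_eq_integral_of_forall_compl_eq_zero (s := Om n)]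
      · refine integral_congr_ae (Eventually.of_forall fun p => ?_)
        simp only [Complex.real_smul]; ring
      · intro p hp
        simp [image_eq_zero_of_notMem_tsupport (fun h => hp (h3 h))]
    rw [e2, integral_sub (hu.integrable_mul_test hη) (hv.integrable_mul_test hη), e, sub_self]


/-! ### The energy space as a Hilbert space. -/

/-- The coordinate directions of `ℝⁿ × ℝ`: `none` for `z`, `some i` for `xⁱ`. -/
def dir : Option (Fin n) → Pt n
  | none => dirZ n
  | some i => dirX i

/-- The weights of the form `b`: `z` for `∂_z`, and `z^(-1/n)` for the tangential derivatives. -/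
def wt (n : ℕ) : Option (Fin n) → ℝ → ℝ
  | none => fun z => z
  | some _ => fun z => z ^ (-(1 : ℝ) / n)

lemma isWeight_id : IsWeight fun z => z := ⟨measurable_id, fun _ h => h, continuousOn_id⟩

lemma isWeight_rpow (s : ℝ) : IsWeight fun z => z ^ s :=
  ⟨measurable_id.pow_const s, fun _ h => Real.rpow_pos_of_pos h s,
    fun _ h => (Real.continuousAt_rpow_const _ _ (Or.inl (ne_of_gt h))).continuousWithinAt⟩

lemma isWeight_wt : ∀ j, IsWeight (wt n j)
  | none => isWeight_id
  | some _ => isWeight_rpow _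

lemma wMeasure_eq : wMeasure n = wL n fun z => z := rfl

/-- `u` belongs to the energy space, with weak derivatives `v`. -/
structure IsEn (u : Pt n → ℂ) (v : Option (Fin n) → Pt n → ℂ) : Prop where
  memLp : MemLp u 2 (wMeasure n)
  memLp_deriv : ∀ j, MemLp (v j) 2 (wL n (wt n j))
  weak : ∀ j η, IsTest η →
    ∫ p in Om n, u p * fderiv ℝ η p (dir j) = -∫ p in Om n, v j p * η p

lemma IsEn.memL2loc {u : Pt n → ℂ} {v : Option (Fin n) → Pt n → ℂ} (h : IsEn u v) :
    MemL2loc u := memL2loc_of_wL isWeight_id h.memLp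

lemma IsEn.isWeakDeriv {u : Pt n → ℂ} {v : Option (Fin n) → Pt n → ℂ} (h : IsEn u v)
    (j : Option (Fin n)) : IsWeakDeriv u (dir j) (v j) :=
  ⟨memL2loc_of_wL (isWeight_wt j) (h.memLp_deriv j), h.weak j⟩

lemma IsWeakDeriv.weakDeriv_ae_eq {u v : Pt n → ℂ} {e : Pt n} (h : IsWeakDeriv u e v) :
    ∀ᵐ p ∂volume.restrict (Om n), weakDeriv u e p = v p := by
  have hex : ∃ v, IsWeakDeriv u e v := ⟨v, h⟩
  have h1 : IsWeakDeriv u e (weakDeriv u e) := by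
    rw [weakDeriv, dif_pos hex]; exact hex.choose_spec
  refine ae_eq_of_test h1.1 h.1 fun η hη => ?_
  rw [← neg_inj, ← h1.2 η hη, h.2 η hη]

/-- The vector of `H` that represents integration against a test function. -/
def IsTest.dualH {η : Pt n → ℂ} (hη : IsTest η) : H n :=
  (hη.dual (w := fun z => z) isWeight_id : Lp ℂ 2 (wL n fun z => z))

lemma IsTest.inner_dualH {η : Pt n → ℂ} (hη : IsTest η) (U : H n) :
    inner ℂ hη.dualH U = ∫ p in Om n, U p * η p :=
  hη.inner_dual (w := fun z => z) isWeight_id U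

/-- The ambient Hilbert space of the pairs `(u, ∇u)`. -/
abbrev Amb (n : ℕ) : Type :=
  WithLp 2 (H n × PiLp 2 fun j : Option (Fin n) => Lp ℂ 2 (wL n (wt n j)))

/-- The component of index `j` of a gradient. -/
def Amb.grad (j : Option (Fin n)) : Amb n →L[ℂ] Lp ℂ 2 (wL n (wt n j)) :=
  (PiLp.proj 2 (fun j : Option (Fin n) => Lp ℂ 2 (wL n (wt n j))) j) ∘L WithLp.sndL 2 ℂ _ _

/-- The component in `H`. -/
def Amb.val : Amb n →L[ℂ] H n := WithLp.fstL 2 ℂ _ _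

/-- The energy space as a closed subspace of a Hilbert space. -/
def enSubmodule (n : ℕ) : Submodule ℂ (Amb n) where
  carrier := {e | ∀ j η, ∀ hη : IsTest η,
    inner ℂ (hη.fderiv (dir j)).dualH (Amb.val e) =
      -inner ℂ (hη.dual (isWeight_wt j)) (Amb.grad j e)}
  add_mem' {a b} ha hb j η hη := by
    rw [map_add, map_add, inner_add_right, inner_add_right, ha j η hη, hb j η hη]; ring
  zero_mem' j η hη := by rw [map_zero, map_zero, inner_zero_right, inner_zero_right, neg_zero]
  smul_mem' c a ha j η hη := by
    rw [map_smul, map_smul, inner_smul_right, inner_smul_right, ha j η hη]; ring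

lemma isClosed_enSubmodule : IsClosed (enSubmodule n : Set (Amb n)) := by
  have : (enSubmodule n : Set (Amb n)) = ⋂ j, ⋂ η, ⋂ hη : IsTest η, {e : Amb n |
    inner ℂ (hη.fderiv (dir j)).dualH (Amb.val e) =
      -inner ℂ (hη.dual (isWeight_wt j)) (Amb.grad j e)} := by
    ext e; simp only [mem_iInter]; rfl
  rw [this]
  -- Each weak derivative identity is an equation between continuous functionals, because
  -- integration against a test function is an inner product in the weighted space. Completeness of
  -- the energy space follows.
  refine isClosed_iInter fun j => isClosed_iInter fun η => isClosed_iInter fun hη => ?_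
  exact isClosed_eq (by fun_prop) (by fun_prop)

/-- The energy space as a Hilbert space. -/
def En (n : ℕ) : Type := enSubmodule n

instance : NormedAddCommGroup (En n) := inferInstanceAs (NormedAddCommGroup (enSubmodule n))

instance : InnerProductSpace ℂ (En n) := inferInstanceAs (InnerProductSpace ℂ (enSubmodule n))

instance : Inner ℂ (En n) := InnerProductSpace.toInner

instance : CompleteSpace (En n) :=
  (isClosed_enSubmodule.completeSpace_coe : CompleteSpace (enSubmodule n))

/-- The inclusion of the energy space into the ambient space. -/
def En.toAmb : En n →L[ℂ] Amb n := (enSubmodule n).subtypeL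

/-- The embedding of the energy space into `H`. -/
def emb (n : ℕ) : En n →L[ℂ] H n := Amb.val ∘L En.toAmb

/-- The weak derivative on the energy space. -/
def gradE (j : Option (Fin n)) : En n →L[ℂ] Lp ℂ 2 (wL n (wt n j)) :=
  Amb.grad j ∘L En.toAmb

lemma norm_emb_le : ‖emb n‖ ≤ 1 :=
  ContinuousLinearMap.opNorm_le_bound _ zero_le_one fun e => by
    rw [one_mul]; exact WithLp.norm_fst_le (x := En.toAmb e)

lemma inner_En (e e' : En n) :
    inner ℂ e e' = inner ℂ (emb n e) (emb n e') + ∑ j, inner ℂ (gradE j e) (gradE j e') := by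
  change inner ℂ (En.toAmb e) (En.toAmb e') = _
  rw [WithLp.prod_inner_apply, PiLp.inner_apply]
  rfl

lemma isEn_En (e : En n) : IsEn (emb n e) fun j => gradE j e where
  memLp := Lp.memLp _
  memLp_deriv j := Lp.memLp _
  weak j η hη := by
    have := e.2 j η hη
    rw [IsTest.inner_dualH, IsTest.inner_dual] at this
    exact this

lemma IsEn.exists_En {u : Pt n → ℂ} {v : Option (Fin n) → Pt n → ℂ} (h : IsEn u v) :
    ∃ e : En n, (emb n e =ᵐ[wMeasure n] u) ∧ ∀ j, gradE j e =ᵐ[wL n (wt n j)] v j := by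
  let a : Amb n := WithLp.toLp 2 (h.memLp.toLp u, WithLp.toLp 2 fun j => (h.memLp_deriv j).toLp _)
  have h1 : Amb.val a = h.memLp.toLp u := rfl
  have h2 : ∀ j, Amb.grad j a = (h.memLp_deriv j).toLp _ := fun j => rfl
  refine ⟨⟨a, fun j η hη => ?_⟩, h.memLp.coeFn_toLp, fun j => (h.memLp_deriv j).coeFn_toLp⟩
  rw [IsTest.inner_dualH, IsTest.inner_dual, h1, h2]
  have e1 : ∫ p in Om n, h.memLp.toLp u p * fderiv ℝ η p (dir j) =
      ∫ p in Om n, u p * fderiv ℝ η p (dir j) := by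
    refine integral_congr_ae ?_
    filter_upwards [(ae_wL isWeight_id).1 h.memLp.coeFn_toLp] with p hp
    exact congrArg (· * _) hp
  have e2 : ∫ p in Om n, (h.memLp_deriv j).toLp _ p * η p = ∫ p in Om n, v j p * η p := by
    refine integral_congr_ae ?_
    filter_upwards [(ae_wL (isWeight_wt j)).1 (h.memLp_deriv j).coeFn_toLp] with p hp
    exact congrArg (· * _) hp
  exact e1.trans ((h.weak j η hη).trans (congrArg Neg.neg e2.symm))

/-- The derivative selected by `weakDeriv` and the stored gradient component agree almost everywhere
by uniqueness of weak derivatives; this links the concrete form to the Hilbert space. -/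
lemma weakDeriv_emb (e : En n) (j : Option (Fin n)) :
    ∀ᵐ p ∂volume.restrict (Om n), weakDeriv (emb n e) (dir j) p = gradE j e p :=
  ((isEn_En e).isWeakDeriv j).weakDeriv_ae_eq

lemma emb_injective : Function.Injective (emb n) := by
  rw [injective_iff_map_eq_zero]
  intro e he
  have h0 : ∀ j, gradE j e = 0 := by
    intro j
    have h1 := (isEn_En e).isWeakDeriv j
    have h2 : MemL2loc (0 : Pt n → ℂ) := fun K _ _ => MemLp.zero
    have h3 := ae_eq_of_test h1.1 h2 fun η hη => by
      rw [← neg_inj, ← h1.2 η hη, he]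
      have : ∀ᵐ p ∂volume.restrict (Om n), ((0 : H n) : Pt n → ℂ) p = 0 :=
        (ae_wL isWeight_id).1 (Lp.coeFn_zero ℂ 2 (wMeasure n))
      rw [integral_congr_ae (g := fun _ => 0)]
      · simp
      · filter_upwards [this] with p hp
        rw [hp, zero_mul]
    rw [Lp.ext_iff]
    refine EventuallyEq.trans ?_ (Lp.coeFn_zero _ _ _).symm
    exact (ae_wL (isWeight_wt j)).2 h3
  have := inner_En e e
  simp only [he, h0, inner_zero_left, Finset.sum_const_zero, add_zero] at this
  exact inner_self_eq_zero.1 this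

lemma integrable_mul_star {w : ℝ → ℝ} (hw : IsWeight w) {f g : Pt n → ℂ} (hf : MemLp f 2 (wL n w))
    (hg : MemLp g 2 (wL n w)) :
    Integrable (fun p => (w p.2 : ℂ) * (f p * star (g p))) (volume.restrict (Om n)) := by
  have h1 : Integrable (fun p => f p * star (g p)) (wL n w) := hf.integrable_mul hg.star
  rw [wL, integrable_withDensity_iff_integrable_smul' hw.measurable_ofReal (by simp)] at h1
  refine h1.congr ?_
  filter_upwards [ae_restrict_mem measurableSet_Om] with p hp
  rw [ENNReal.toReal_ofReal (hw.pos _ hp).le, Complex.real_smul]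

/-- The identity that reduces the concrete problem to the abstract one. The arguments are exchanged
because `inner` is conjugate linear in its first entry. -/
lemma bform_emb (e e' : En n) :
    bform (emb n e) (emb n e') = inner ℂ e' e - inner ℂ (emb n e') (emb n e) := by
  rw [inner_En, add_sub_cancel_left]
  have h1 : ∀ j, Integrable (fun p => (wt n j p.2 : ℂ) * (gradE j e p * star (gradE j e' p)))
      (volume.restrict (Om n)) := fun j =>
    integrable_mul_star (isWeight_wt j) (Lp.memLp _) (Lp.memLp _)
  have h2 : ∀ j, inner ℂ (gradE j e') (gradE j e) =
      ∫ p in Om n, (wt n j p.2 : ℂ) * (gradE j e p * star (gradE j e' p)) :=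
    fun j => inner_Lp_wL (isWeight_wt j) _ _
  simp only [h2]
  rw [← integral_finsetSum _ fun j _ => h1 j, bform]
  refine integral_congr_ae ?_
  filter_upwards [ae_all_iff.2 (weakDeriv_emb e), ae_all_iff.2 (weakDeriv_emb e')] with p hp hp'
  rw [Fintype.sum_option, Finset.mul_sum]
  simp only [← hp, ← hp']
  rfl

lemma energyNorm_emb (e : En n) : energyNorm (emb n e) = ‖e‖ := by
  rw [energyNorm, bform_emb]
  have h1 : (inner ℂ e e).re = ‖e‖ ^ 2 := inner_self_eq_norm_sq (𝕜 := ℂ) e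
  have h2 : (inner ℂ (emb n e) (emb n e)).re = ‖emb n e‖ ^ 2 := inner_self_eq_norm_sq (𝕜 := ℂ) _
  rw [Complex.sub_re, h1, h2, sub_add_cancel, Real.sqrt_sq (norm_nonneg _)]

lemma energyDensity_eq (v : Option (Fin n) → Pt n → ℂ) (p : Pt n) :
    p.2 * ‖v none p‖ ^ 2 + p.2 ^ (-(1 : ℝ) / n) * ∑ i : Fin n, ‖v (some i) p‖ ^ 2 =
      ∑ j, wt n j p.2 * ‖v j p‖ ^ 2 := by
  rw [Fintype.sum_option, Finset.mul_sum]; rfl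

lemma integrable_sq_of_memLp {w : ℝ → ℝ} (hw : IsWeight w) {f : Pt n → ℂ}
    (hf : MemLp f 2 (wL n w)) :
    Integrable (fun p => w p.2 * ‖f p‖ ^ 2) (volume.restrict (Om n)) := by
  have := (integrable_mul_star hw hf hf).re
  refine this.congr (Eventually.of_forall fun p => ?_)
  simp only [RCLike.star_def, Complex.mul_conj, ← Complex.ofReal_mul, Complex.normSq_eq_norm_sq]
  exact Complex.ofReal_re _

lemma memLp_of_integrable_sq {w : ℝ → ℝ} (hw : IsWeight w) {f : Pt n → ℂ}
    (hm : AEStronglyMeasurable f (volume.restrict (Om n)))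
    (hf : Integrable (fun p => w p.2 * ‖f p‖ ^ 2) (volume.restrict (Om n))) :
    MemLp f 2 (wL n w) := by
  rw [memLp_two_iff_integrable_sq_norm ((aestronglyMeasurable_wL hw).2 hm), wL,
    integrable_withDensity_iff_integrable_smul' hw.measurable_ofReal (by simp)]
  refine hf.congr ?_
  filter_upwards [ae_restrict_mem measurableSet_Om] with p hp
  rw [ENNReal.toReal_ofReal (hw.pos _ hp).le, smul_eq_mul]

lemma emb_mem_energySpace (e : En n) : emb n e ∈ energySpace n := by
  have h := isEn_En e
  refine ⟨⟨h.memL2loc, fun i => ⟨_, h.isWeakDeriv (some i)⟩, ⟨_, h.isWeakDeriv none⟩⟩, ?_⟩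
  have h1 : Integrable (fun p => ∑ j, wt n j p.2 * ‖gradE j e p‖ ^ 2) (volume.restrict (Om n)) :=
    integrable_finsetSum _ fun j _ => integrable_sq_of_memLp (isWeight_wt j) (Lp.memLp _)
  refine lt_of_eq_of_lt ?_ h1.lintegral_lt_top
  refine lintegral_congr_ae ?_
  filter_upwards [ae_all_iff.2 (weakDeriv_emb e)] with p hp
  have := energyDensity_eq (fun j => weakDeriv (emb n e) (dir j)) p
  simp only [hp] at this
  rw [← this]
  simp only [← hp]
  rfl

lemma exists_emb_eq {φ : H n} (hφ : φ ∈ energySpace n) : ∃ e, emb n e = φ := by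
  obtain ⟨⟨h0, hx, hz⟩, hfin⟩ := hφ
  set v : Option (Fin n) → Pt n → ℂ := fun j => weakDeriv φ (dir j) with hv
  have hw : ∀ j, IsWeakDeriv (φ : Pt n → ℂ) (dir j) (v j) := by
    intro j
    have hex : ∃ v, IsWeakDeriv (φ : Pt n → ℂ) (dir j) v := by
      cases j with
      | none => exact hz
      | some i => exact hx i
    simp only [hv, weakDeriv, dif_pos hex]
    exact hex.choose_spec
  have hm : ∀ j, AEStronglyMeasurable (v j) (volume.restrict (Om n)) := fun j =>
    (memL2loc_locallyIntegrableOn (hw j).1).aestronglyMeasurable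
  have hmw : ∀ j, AEStronglyMeasurable (fun p : Pt n => wt n j p.2 * ‖v j p‖ ^ 2)
      (volume.restrict (Om n)) := fun j =>
    ((isWeight_wt j).meas.comp measurable_snd).aestronglyMeasurable.mul ((hm j).norm.pow 2)
  have hnn : ∀ᵐ p ∂volume.restrict (Om n), ∀ j, 0 ≤ wt n j p.2 * ‖v j p‖ ^ 2 := by
    filter_upwards [ae_restrict_mem measurableSet_Om] with p hp j
    exact mul_nonneg ((isWeight_wt j).pos _ hp).le (sq_nonneg _)
  -- Finiteness of the total energy density is split into its components afterwards; all terms are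
  -- nonnegative on `Ω`.
  have hi : Integrable (fun p => ∑ j, wt n j p.2 * ‖v j p‖ ^ 2) (volume.restrict (Om n)) := by
    rw [← lintegral_ofReal_ne_top_iff_integrable
      (Finset.aestronglyMeasurable_fun_sum _ fun j _ => hmw j)]
    · refine ne_of_lt (lt_of_eq_of_lt (lintegral_congr fun p => ?_) hfin)
      rw [← energyDensity_eq v]; rfl
    · filter_upwards [hnn] with p hp using Finset.sum_nonneg fun j _ => hp j
  have hE : IsEn (φ : Pt n → ℂ) v := ⟨Lp.memLp φ, fun j => by
    refine memLp_of_integrable_sq (isWeight_wt j) (hm j) (hi.mono' (hmw j) ?_)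
    filter_upwards [hnn] with p hp
    rw [Real.norm_of_nonneg (hp j)]
    exact Finset.single_le_sum (f := fun j => wt n j p.2 * ‖v j p‖ ^ 2) (fun j _ => hp j)
      (Finset.mem_univ j), fun j => (hw j).2⟩
  obtain ⟨e, he, -⟩ := hE.exists_En
  exact ⟨e, Lp.ext he⟩


/-! ### The concrete Cauchy problem. -/

/-- Well-posedness of the Cauchy problem. -/
theorem exists_unique_solution {f g : H n} (hf : f ∈ domainA n) (hg : g ∈ energySpace n) :
    ∃ φ : ℝ → H n, IsSolution f g φ ∧ (∀ φ', IsSolution f g φ' → EqOn φ' φ (Ici 0)) ∧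
      ∀ t, φ t ∈ domainA n := by
  obtain ⟨hf1, C, hC, hf2⟩ := hf
  obtain ⟨f, rfl⟩ := exists_emb_eq hf1
  obtain ⟨g, rfl⟩ := exists_emb_eq hg
  have hf3 : ∀ e, ‖inner ℂ e f - inner ℂ (emb n e) (emb n f)‖ ≤ C * ‖emb n e‖ := fun e => by
    rw [← bform_emb]; exact hf2 _ (emb_mem_energySpace e)
  obtain ⟨φ, ψ, hφ, hψ, hd, h0, h1, heq, hdom⟩ := exists_wave emb_injective norm_emb_le (g := g) hf3
  have hderiv : ∀ t ∈ Ici (0 : ℝ), derivWithin (fun t => emb n (φ t)) (Ici 0) t = ψ t :=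
    fun t ht => (hd t).hasDerivWithinAt.derivWithin (uniqueDiffOn_Ici 0 t ht)
  have hsol : IsSolution (emb n f) (emb n g) fun t => emb n (φ t) := by
    refine ⟨fun t _ => emb_mem_energySpace _, fun t _ => ?_, ?_, ?_, ?_, ?_⟩
    · simp only [← map_sub, energyNorm_emb]
      have : Continuous fun s => ‖φ s - φ t‖ := by fun_prop
      simpa using (this.tendsto t).mono_left nhdsWithin_le_nhds
    · have : ContDiff ℝ 1 fun t => emb n (φ t) := by
        rw [contDiff_one_iff_deriv]
        refine ⟨fun t => (hd t).differentiableAt, ?_⟩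
        rw [show deriv (fun t => emb n (φ t)) = ψ from funext fun t => (hd t).deriv]
        exact hψ
      exact this.contDiffOn
    · intro η hη t ht
      obtain ⟨e, rfl⟩ := exists_emb_eq hη
      rw [bform_emb]
      refine (heq e t).hasDerivWithinAt.congr (fun s hs => ?_) ?_
      · rw [hderiv s hs]
      · rw [hderiv t ht]
    · rw [h0]
    · rw [hderiv 0 self_mem_Ici, h1]
  refine ⟨_, hsol, fun φ' hφ' t ht => ?_, fun t => ⟨emb_mem_energySpace _, ?_⟩⟩
  · choose! e he using fun t (ht : t ∈ Ici (0 : ℝ)) => exists_emb_eq (hφ'.mem_energy t ht)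
    have hd' : ∀ t ∈ Ici (0 : ℝ),
        HasDerivWithinAt φ' (derivWithin φ' (Ici 0) t) (Ici 0) t := fun t ht =>
      ((hφ'.contDiff_H.differentiableOn one_ne_zero) t ht).hasDerivWithinAt
    have key := wave_eq_zero (J := emb n) norm_emb_le (φ := fun t => e t - φ t)
      (ψ := fun t => derivWithin φ' (Ici 0) t - ψ t) (fun t ht => ?_) (fun x t ht => ?_) ?_ ?_ ht
    · rw [map_sub, he t ht, sub_eq_zero] at key
      exact key
    · refine ((hd' t ht).sub (hd t).hasDerivWithinAt).congr (fun s hs => ?_) ?_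
      · rw [map_sub, he s hs]; rfl
      · rw [map_sub, he t ht]; rfl
    · have h2 := (hφ'.equation (emb n x) (emb_mem_energySpace x) t ht).sub
        (heq x t).hasDerivWithinAt
      rw [← he t ht, bform_emb] at h2
      simp only [inner_sub_right, map_sub]
      refine h2.congr_deriv ?_
      ring
    · rw [map_sub, he 0 self_mem_Ici, hφ'.init_pos, h0, sub_self]
    · rw [hφ'.init_vel, h1, sub_self]
  · obtain ⟨C, hC⟩ := hdom t
    -- The definition of the domain asks for a strictly positive constant.
    refine ⟨max C 1, by positivity, fun η hη => ?_⟩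
    obtain ⟨e, rfl⟩ := exists_emb_eq hη
    have := bform_emb (φ t) e
    rw [this]
    exact (hC e).trans (mul_le_mul_of_nonneg_right (le_max_left _ _) (norm_nonneg _))


/-! ### Tangential translations and weighted norms. -/

lemma measurePreserving_shift {w : ℝ → ℝ} (hw : IsWeight w) {a : Pt n} (ha : a.2 = 0) :
    MeasurePreserving (fun p => p + a) (wL n w) (wL n w) := by
  have h1 : MeasurePreserving (fun p : Pt n => p + a) (volume.restrict (Om n))
      (volume.restrict (Om n)) := by
    have : (volume : Measure (Pt n)).IsAddRightInvariant :=
      inferInstanceAs ((volume : Measure (Tang n)).prod (volume : Measure ℝ)).IsAddRightInvariant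
    have := (measurePreserving_add_right (volume : Measure (Pt n)) a).restrict_preimage
      (measurableSet_Om (n := n))
    have e : (fun p : Pt n => p + a) ⁻¹' Om n = Om n := by
      ext p; simp [Om, ha]
    rwa [e] at this
  refine ⟨h1.measurable, Measure.ext fun s hs => ?_⟩
  rw [Measure.map_apply h1.measurable hs, wL, withDensity_apply _ hs,
    withDensity_apply _ (h1.measurable hs),
    ← h1.setLIntegral_comp_preimage hs hw.measurable_ofReal]
  simp [ha]

lemma setIntegral_Om_shift {a : Pt n} (ha : a.2 = 0) (f : Pt n → ℂ) :
    ∫ p in Om n, f (p + a) = ∫ p in Om n, f p := by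
  have h := measurePreserving_shift (n := n) isWeight_one ha
  rw [wL_one] at h
  exact h.integral_comp (MeasurableEquiv.addRight a).measurableEmbedding f

/-- The norm of `L²(w dμ)`. -/
def Nw (w : ℝ → ℝ) (f : Pt n → ℂ) : ℝ := (eLpNorm f 2 (wL n w)).toReal

lemma Nw_nonneg (w : ℝ → ℝ) (f : Pt n → ℂ) : 0 ≤ Nw w f := ENNReal.toReal_nonneg

lemma norm_toLp_eq {w : ℝ → ℝ} {f : Pt n → ℂ} (hf : MemLp f 2 (wL n w)) :
    ‖hf.toLp f‖ = Nw w f := Lp.norm_toLp f hf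

lemma norm_pair_le {w : ℝ → ℝ} (hw : IsWeight w) {f g : Pt n → ℂ} (hf : MemLp f 2 (wL n w))
    (hg : MemLp g 2 (wL n w)) :
    ‖∫ p in Om n, (w p.2 : ℂ) * (f p * star (g p))‖ ≤ Nw w f * Nw w g := by
  have h := norm_inner_le_norm (𝕜 := ℂ) (hg.toLp g) (hf.toLp f)
  rw [inner_Lp_wL hw, norm_toLp_eq, norm_toLp_eq, mul_comm] at h
  refine le_of_eq_of_le (congrArg norm (integral_congr_ae ?_)) h
  filter_upwards [(ae_wL hw).1 hf.coeFn_toLp, (ae_wL hw).1 hg.coeFn_toLp] with p h1 h2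
  rw [h1, h2]

lemma Nw_sq {w : ℝ → ℝ} (hw : IsWeight w) {f : Pt n → ℂ} (hf : MemLp f 2 (wL n w)) :
    Nw w f ^ 2 = ∫ p in Om n, w p.2 * ‖f p‖ ^ 2 := by
  have h : ((Nw w f ^ 2 : ℝ) : ℂ) = ∫ p in Om n, (w p.2 : ℂ) * (f p * star (f p)) := by
    rw [← norm_toLp_eq hf]
    have := inner_self_eq_norm_sq_to_K (𝕜 := ℂ) (hf.toLp f)
    rw [inner_Lp_wL hw] at this
    push_cast
    refine Eq.trans this.symm (integral_congr_ae ?_)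
    filter_upwards [(ae_wL hw).1 hf.coeFn_toLp] with p h1
    rw [h1]
  rw [← Complex.ofReal_inj, h, ← integral_complex_ofReal]
  refine integral_congr_ae (Eventually.of_forall fun p => ?_)
  simp only [RCLike.star_def, Complex.mul_conj, ← Complex.ofReal_mul, Complex.normSq_eq_norm_sq]

lemma Nw_le {w₁ w₂ : ℝ → ℝ} (h₁ : IsWeight w₁) (h₂ : IsWeight w₂) {f g : Pt n → ℂ}
    (hf : MemLp f 2 (wL n w₁)) (hg : MemLp g 2 (wL n w₂)) {c : ℝ} (hc : 0 ≤ c)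
    (h : ∀ p ∈ Om n, w₁ p.2 * ‖f p‖ ^ 2 ≤ c ^ 2 * (w₂ p.2 * ‖g p‖ ^ 2)) :
    Nw w₁ f ≤ c * Nw w₂ g := by
  refine le_of_sq_le_sq ?_ (mul_nonneg hc (Nw_nonneg _ _))
  rw [mul_pow, Nw_sq h₁ hf, Nw_sq h₂ hg, ← integral_const_mul]
  exact setIntegral_mono_on (integrable_sq_of_memLp h₁ hf)
    ((integrable_sq_of_memLp h₂ hg).const_mul _) measurableSet_Om h

lemma memLp_of_le {w₁ w₂ : ℝ → ℝ} (h₁ : IsWeight w₁) (h₂ : IsWeight w₂) {f g : Pt n → ℂ}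
    (hf : AEStronglyMeasurable f (volume.restrict (Om n))) (hg : MemLp g 2 (wL n w₂)) {c : ℝ}
    (h : ∀ p ∈ Om n, w₁ p.2 * ‖f p‖ ^ 2 ≤ c * (w₂ p.2 * ‖g p‖ ^ 2)) : MemLp f 2 (wL n w₁) := by
  refine memLp_of_integrable_sq h₁ hf (((integrable_sq_of_memLp h₂ hg).const_mul c).mono' ?_ ?_)
  · exact ((h₁.meas.comp measurable_snd).aestronglyMeasurable).mul (hf.norm.pow 2)
  · filter_upwards [ae_restrict_mem measurableSet_Om] with p hp
    rw [Real.norm_of_nonneg (mul_nonneg (h₁.pos _ hp).le (sq_nonneg _))]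
    exact h p hp

/-! ### Test functions are dense -/

lemma IsTest.add {η η' : Pt n → ℂ} (hη : IsTest η) (hη' : IsTest η') :
    IsTest fun p => η p + η' p :=
  ⟨hη.smooth.add hη'.smooth, hη.compact.add hη'.compact,
    (tsupport_add η η').trans (union_subset hη.subset hη'.subset)⟩

lemma IsTest.const_mul {η : Pt n → ℂ} (hη : IsTest η) (c : ℂ) : IsTest fun p => c * η p :=
  ⟨contDiff_const.mul hη.smooth, hη.compact.mul_left (f := fun _ => c),
    (tsupport_mul_subset_right (f := fun _ => c)).trans hη.subset⟩

lemma IsTest.mul_left {η : Pt n → ℂ} (hη : IsTest η) {κ : Pt n → ℂ} (hκ : ContDiff ℝ ∞ κ) :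
    IsTest fun p => κ p * η p :=
  ⟨hκ.mul hη.smooth, hη.compact.mul_left (f := κ),
    (tsupport_mul_subset_right (f := κ)).trans hη.subset⟩

lemma IsTest.shift {η : Pt n → ℂ} (hη : IsTest η) {a : Pt n} (ha : a.2 = 0) :
    IsTest fun p => η (p + a) := by
  have h : (fun p => η (p + a)) = η ∘ Homeomorph.addRight a := rfl
  refine ⟨hη.smooth.comp (contDiff_id.add contDiff_const), ?_, ?_⟩
  · rw [h]; exact hη.compact.comp_homeomorph _
  · rw [h, tsupport_comp_eq_preimage]
    intro p hp
    have := hη.subset hp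
    simpa [Om, ha] using this

/-- A vector orthogonal to all these duals has zero integral against every test function, hence
vanishes. -/
lemma dense_dual {w : ℝ → ℝ} (hw : IsWeight w) :
    Dense {G : Lp ℂ 2 (wL n w) | ∃ η, ∃ hη : IsTest η, hη.dual hw = G} := by
  let D : Submodule ℂ (Lp ℂ 2 (wL n w)) :=
    { carrier := {G : Lp ℂ 2 (wL n w) | ∃ η, ∃ hη : IsTest η, hη.dual hw = G}
      add_mem' := by
        rintro _ _ ⟨η, hη, rfl⟩ ⟨η', hη', rfl⟩
        refine ⟨_, hη.add hη', ?_⟩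
        rw [IsTest.dual, IsTest.dual, IsTest.dual, ← MemLp.toLp_add]
        refine MemLp.toLp_congr _ _ (Eventually.of_forall fun p => ?_)
        simp [add_div]
      zero_mem' := by
        refine ⟨fun _ => 0, ⟨contDiff_const, HasCompactSupport.zero, by simp⟩, ?_⟩
        rw [IsTest.dual, ← MemLp.toLp_zero (MemLp.zero' (μ := wL n w) (p := 2) (ε := ℂ))]
        refine MemLp.toLp_congr _ _ (Eventually.of_forall fun p => ?_)
        simp
      smul_mem' := by
        rintro c _ ⟨η, hη, rfl⟩
        refine ⟨_, hη.const_mul (star c), ?_⟩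
        rw [IsTest.dual, IsTest.dual, ← MemLp.toLp_const_smul]
        refine MemLp.toLp_congr _ _ (Eventually.of_forall fun p => ?_)
        simp [mul_div_assoc] }
  have h : D.topologicalClosure = ⊤ := by
    rw [Submodule.topologicalClosure_eq_top_iff, Submodule.eq_bot_iff]
    intro F hF
    rw [Submodule.mem_orthogonal] at hF
    have h0 := ae_eq_of_test (memL2loc_of_wL hw (Lp.memLp F))
      (v := 0) (fun K _ _ => MemLp.zero) fun η hη => by
        rw [← hη.inner_dual hw, hF _ ⟨η, hη, rfl⟩]; simp
    rw [Lp.ext_iff]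
    exact EventuallyEq.trans ((ae_wL hw).2 h0) (Lp.coeFn_zero _ _ _).symm
  exact Submodule.dense_iff_topologicalClosure_eq_top.2 h

lemma norm_le_of_test {w : ℝ → ℝ} (hw : IsWeight w) {F : Lp ℂ 2 (wL n w)} {c : ℝ}
    (hc : 0 ≤ c) (h : ∀ η, ∀ hη : IsTest η, ‖∫ p in Om n, F p * η p‖ ≤ c * ‖hη.dual hw‖) : ‖F‖ ≤ c := by
  have h1 : ∀ G : Lp ℂ 2 (wL n w), ‖inner ℂ G F‖ ≤ c * ‖G‖ := by
    intro G
    refine (dense_dual hw).induction (P := fun G => ‖inner ℂ G F‖ ≤ c * ‖G‖) ?_ ?_ G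
    · rintro _ ⟨η, hη, rfl⟩
      rw [hη.inner_dual hw]; exact h η hη
    · exact isClosed_le (by fun_prop) (by fun_prop)
  have h2 := h1 F
  have e3 : ‖inner ℂ F F‖ = ‖F‖ * ‖F‖ := by
    rw [inner_self_eq_norm_sq_to_K, norm_pow, sq]; simp
  rw [e3] at h2
  rcases eq_or_lt_of_le (norm_nonneg F) with h0 | h0
  · rwa [← h0]
  · exact le_of_mul_le_mul_right h2 h0


/-- Differentiation under the integral sign; the shift stays on the smooth test function, so `U`
need only be locally square integrable. -/
lemma hasDerivAt_integral_shift {U : Pt n → ℂ} (hU : MemL2loc U) {η : Pt n → ℂ} (hη : IsTest η)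
    {e : Pt n} (he : e.2 = 0) (s₀ : ℝ) :
    HasDerivAt (fun s : ℝ => ∫ p in Om n, U p * η (p + s • e))
      (∫ p in Om n, U p * fderiv ℝ η (p + s₀ • e) e) s₀ := by
  have hse : ∀ s : ℝ, (s • e).2 = 0 := fun s => by simp [he]
  obtain ⟨M, hM⟩ := (hη.fderiv e).compact.exists_bound_of_continuous
    (hη.fderiv e).smooth.continuous
  -- This compact set contains the supports of all translates with `|s - s₀| ≤ 1`. It stays inside
  -- `Ω` because `e` is tangential.
  set K : Set (Pt n) := (fun q : Pt n × ℝ => q.1 - q.2 • e) '' (tsupport η ×ˢ Metric.closedBall s₀ 1)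
    with hKdef
  have hK : IsCompact K := (hη.compact.isCompact.prod (isCompact_closedBall s₀ 1)).image (by fun_prop)
  have hKO : K ⊆ Om n := by
    rintro _ ⟨⟨q, s⟩, ⟨hq, -⟩, rfl⟩
    have := hη.subset hq
    simpa [Om, he] using this
  have hUm : AEStronglyMeasurable U (volume.restrict (Om n)) :=
    (memL2loc_locallyIntegrableOn hU).aestronglyMeasurable
  have hsh : ∀ s : ℝ, Continuous fun p : Pt n => p + s • e := fun s => by fun_prop
  refine (hasDerivAt_integral_of_dominated_loc_of_deriv_le (μ := volume.restrict (Om n))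
    (F := fun s p => U p * η (p + s • e)) (F' := fun s p => U p * fderiv ℝ η (p + s • e) e)
    (bound := K.indicator fun p => ‖U p‖ * M) (Metric.ball_mem_nhds s₀ one_pos) ?_ ?_ ?_ ?_ ?_ ?_).2
  · exact Eventually.of_forall fun s => hUm.mul
      (hη.smooth.continuous.comp (hsh s)).aestronglyMeasurable
  · exact hU.integrable_mul_test (hη.shift (hse s₀))
  · exact hUm.mul ((hη.fderiv e).smooth.continuous.comp (hsh s₀)).aestronglyMeasurable
  · refine Eventually.of_forall fun p s hs => ?_
    by_cases hp : p ∈ K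
    · rw [indicator_of_mem hp, norm_mul]
      exact mul_le_mul_of_nonneg_left (hM _) (norm_nonneg _)
    · rw [indicator_of_notMem hp]
      have : p + s • e ∉ tsupport η := fun h => hp
        ⟨(p + s • e, s), ⟨h, Metric.ball_subset_closedBall hs⟩, by simp⟩
      have h2 : fderiv ℝ η (p + s • e) = 0 := fderiv_of_notMem_tsupport ℝ this
      simp [h2]
  · rw [integrable_indicator_iff hK.measurableSet, IntegrableOn,
      Measure.restrict_restrict hK.measurableSet, inter_eq_left.2 hKO]
    exact (((memL2loc_locallyIntegrableOn hU).integrableOn_compact_subset hKO hK).norm).mul_const M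
  · refine Eventually.of_forall fun p s _ => ?_
    have h1 : HasFDerivAt η (fderiv ℝ η (p + s • e)) (p + s • e) :=
      (hη.smooth.differentiable (by simp)).differentiableAt.hasFDerivAt
    have h2 : HasDerivAt (fun s : ℝ => p + s • e) e s := by
      simpa using ((hasDerivAt_id s).smul_const e).const_add p
    exact (h1.comp_hasDerivAt s h2).const_mul (U p)

lemma IsTest.norm_dual_shift {η : Pt n → ℂ} (hη : IsTest η) {w : ℝ → ℝ} (hw : IsWeight w)
    {a : Pt n} (ha : a.2 = 0) : ‖(hη.shift ha).dual hw‖ = ‖hη.dual hw‖ := by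
  rw [IsTest.dual, IsTest.dual, norm_toLp_eq, norm_toLp_eq, Nw, Nw]
  congr 1
  have h := eLpNorm_comp_measurePreserving (p := 2) (hη.memLp_dual hw).1
    (measurePreserving_shift hw ha)
  rw [← h]
  congr 1
  ext p
  simp [ha]

lemma memLp_shift {w : ℝ → ℝ} (hw : IsWeight w) {f : Pt n → ℂ} (hf : MemLp f 2 (wL n w)) {a : Pt n}
    (ha : a.2 = 0) : MemLp (fun p => f (p + a)) 2 (wL n w) :=
  hf.comp_measurePreserving (measurePreserving_shift hw ha)

/-- Difference quotients are controlled by weak derivatives. -/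
lemma Nw_shift_sub_le {w : ℝ → ℝ} (hw : IsWeight w) {U V : Pt n → ℂ} (hU : MemLp U 2 (wL n w))
    (hV : MemLp V 2 (wL n w)) {e : Pt n} (he : e.2 = 0)
    (hweak : ∀ η, IsTest η → ∫ p in Om n, U p * fderiv ℝ η p e = -∫ p in Om n, V p * η p)
    (h : ℝ) : Nw w (fun p => U (p + h • e) - U p) ≤ |h| * Nw w V := by
  have hse : ∀ s : ℝ, (s • e).2 = 0 := fun s => by simp [he]
  have hUs := memLp_shift hw hU (hse h)
  have hU' := memL2loc_of_wL hw hU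
  have hsub : MemLp (fun p => U (p + h • e) - U p) 2 (wL n w) := hUs.sub hU
  rw [← norm_toLp_eq hsub]
  refine norm_le_of_test hw (mul_nonneg (abs_nonneg _) (Nw_nonneg _ _)) fun η hη => ?_
  have e1 : ∫ p in Om n, hsub.toLp _ p * η p =
      (∫ p in Om n, U p * η (p + (-h) • e)) - ∫ p in Om n, U p * η (p + (0 : ℝ) • e) := by
    have e2 : ∫ p in Om n, hsub.toLp _ p * η p =
        ∫ p in Om n, (U (p + h • e) * η p - U p * η p) := by
      refine integral_congr_ae ?_
      filter_upwards [(ae_wL hw).1 hsub.coeFn_toLp] with p hp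
      rw [hp, sub_mul]
    rw [e2, integral_sub ((memL2loc_of_wL hw hUs).integrable_mul_test hη)
      (hU'.integrable_mul_test hη), ← setIntegral_Om_shift (hse h) fun p => U p * η (p + (-h) • e)]
    simp
  -- Paired with `η`, the difference of `U` becomes the increment from `0` to `-h` of this function
  -- of the shift. Its derivative is controlled by the norm of `V`, since the norm of the dual
  -- vector is translation invariant.
  have hd : ∀ s : ℝ, HasDerivAt (fun s : ℝ => ∫ p in Om n, U p * η (p + s • e))
      (-∫ p in Om n, V p * η (p + s • e)) s := by
    intro s
    refine (hasDerivAt_integral_shift hU' hη he s).congr_deriv ?_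
    rw [← hweak _ (hη.shift (hse s))]
    simp only [fderiv_comp_add_right]
  have key := convex_univ.norm_image_sub_le_of_norm_hasDerivWithin_le
    (C := Nw w V * ‖hη.dual hw‖) (fun s _ => (hd s).hasDerivWithinAt) (fun s _ => by
      have := norm_inner_le_norm (𝕜 := ℂ) ((hη.shift (hse s)).dual hw) (hV.toLp V)
      rw [hη.norm_dual_shift hw (hse s), IsTest.inner_dual, norm_toLp_eq, mul_comm] at this
      rw [norm_neg]
      refine le_of_eq_of_le (congrArg norm (integral_congr_ae ?_)) this
      filter_upwards [(ae_wL hw).1 hV.coeFn_toLp] with p hp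
      rw [hp]) (mem_univ (0 : ℝ)) (mem_univ (-h))
  rw [e1]
  refine key.trans_eq ?_
  simp only [sub_zero, Real.norm_eq_abs, abs_neg]
  ring

/-! ### Operations on the energy space -/

lemma IsEn.shift {u : Pt n → ℂ} {v : Option (Fin n) → Pt n → ℂ} (h : IsEn u v) {a : Pt n}
    (ha : a.2 = 0) : IsEn (fun p => u (p + a)) fun j p => v j (p + a) where
  memLp := memLp_shift isWeight_id h.memLp ha
  memLp_deriv j := memLp_shift (isWeight_wt j) (h.memLp_deriv j) ha
  weak j η hη := by
    have ha' : (-a).2 = 0 := by simp [ha]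
    have := h.weak j _ (hη.shift ha')
    rw [← setIntegral_Om_shift ha, ← setIntegral_Om_shift ha fun p => v j p * η (p + -a)] at this
    simpa [fderiv_comp_add_right] using this

lemma IsEn.sub {u u' : Pt n → ℂ} {v v' : Option (Fin n) → Pt n → ℂ} (h : IsEn u v)
    (h' : IsEn u' v') : IsEn (fun p => u p - u' p) fun j p => v j p - v' j p where
  memLp := h.memLp.sub h'.memLp
  memLp_deriv j := (h.memLp_deriv j).sub (h'.memLp_deriv j)
  weak j η hη := by
    simp only [sub_mul]
    rw [integral_sub (h.memL2loc.integrable_mul_test (hη.fderiv _))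
      (h'.memL2loc.integrable_mul_test (hη.fderiv _)),
      integral_sub ((h.isWeakDeriv j).1.integrable_mul_test hη)
      ((h'.isWeakDeriv j).1.integrable_mul_test hη), h.weak j η hη, h'.weak j η hη]
    ring

lemma IsEn.const_mul {u : Pt n → ℂ} {v : Option (Fin n) → Pt n → ℂ} (h : IsEn u v) (c : ℂ) :
    IsEn (fun p => c * u p) fun j p => c * v j p where
  memLp := h.memLp.const_mul c
  memLp_deriv j := (h.memLp_deriv j).const_mul c
  weak j η hη := by
    simp only [mul_assoc, integral_const_mul]
    rw [h.weak j η hη, mul_neg]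

lemma hasFDerivAt_ofReal_comp_snd {κ : ℝ → ℝ} (hκ : ContDiff ℝ ∞ κ) (p : Pt n) :
    HasFDerivAt (fun p : Pt n => (κ p.2 : ℂ))
      (Complex.ofRealCLM ∘L ((fderiv ℝ κ p.2) ∘L ContinuousLinearMap.snd ℝ (Tang n) ℝ)) p := by
  have h1 : HasFDerivAt κ (fderiv ℝ κ p.2) p.2 :=
    (hκ.differentiable (by simp)).differentiableAt.hasFDerivAt
  have h2 : HasFDerivAt (fun p : Pt n => p.2) (ContinuousLinearMap.snd ℝ (Tang n) ℝ) p :=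
    hasFDerivAt_snd
  exact Complex.ofRealCLM.hasFDerivAt.comp p (h1.comp p h2)

/-- Multiplication of weak derivatives by a smooth function of `z`. -/
lemma weak_mul_snd {u v : Pt n → ℂ} (hu : MemL2loc u) (hv : MemL2loc v) {e : Pt n}
    (h : ∀ η, IsTest η → ∫ p in Om n, u p * fderiv ℝ η p e = -∫ p in Om n, v p * η p)
    {κ : ℝ → ℝ} (hκ : ContDiff ℝ ∞ κ) (η : Pt n → ℂ) (hη : IsTest η) :
    ∫ p in Om n, ((κ p.2 : ℂ) * u p) * fderiv ℝ η p e =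
      -∫ p in Om n, ((κ p.2 : ℂ) * v p + ((deriv κ p.2 * e.2 : ℝ) : ℂ) * u p) * η p := by
  have hs : ContDiff ℝ ∞ fun p : Pt n => (κ p.2 : ℂ) :=
    Complex.ofRealCLM.contDiff.comp (hκ.comp contDiff_snd)
  have hs' : ContDiff ℝ ∞ fun p : Pt n => ((deriv κ p.2 * e.2 : ℝ) : ℂ) :=
    Complex.ofRealCLM.contDiff.comp (((contDiff_infty_iff_deriv.1 hκ).2.comp contDiff_snd).mul
      contDiff_const)
  have hη1 := hη.mul_left hs
  have hη2 := hη.mul_left hs'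
  have key := h _ hη1
  have e1 : ∀ p, fderiv ℝ (fun p => (κ p.2 : ℂ) * η p) p e =
      (κ p.2 : ℂ) * fderiv ℝ η p e + ((deriv κ p.2 * e.2 : ℝ) : ℂ) * η p := by
    intro p
    have h1 := hasFDerivAt_ofReal_comp_snd hκ p
    have h2 : HasFDerivAt η (fderiv ℝ η p) p :=
      (hη.smooth.differentiable (by simp)).differentiableAt.hasFDerivAt
    have h12 : HasFDerivAt (fun p => (κ p.2 : ℂ) * η p) _ p := h1.mul h2
    rw [h12.fderiv]
    have h3 : fderiv ℝ κ p.2 e.2 = deriv κ p.2 * e.2 := by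
      rw [fderiv_eq_smul_deriv, smul_eq_mul, mul_comm]
    simp [h3]
    ring
  have e2 : ∀ p, u p * fderiv ℝ (fun p => (κ p.2 : ℂ) * η p) p e =
      ((κ p.2 : ℂ) * u p) * fderiv ℝ η p e + u p * (((deriv κ p.2 * e.2 : ℝ) : ℂ) * η p) := by
    intro p; rw [e1]; ring
  have i1 : Integrable (fun p => ((κ p.2 : ℂ) * u p) * fderiv ℝ η p e) (volume.restrict (Om n)) := by
    refine (hu.integrable_mul_test ((hη.fderiv e).mul_left hs)).congr
      (Eventually.of_forall fun p => ?_)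
    ring
  simp only [e2] at key
  rw [integral_add i1 (hu.integrable_mul_test hη2)] at key
  rw [eq_sub_of_add_eq key]
  have e3 : ∀ p, ((κ p.2 : ℂ) * v p + ((deriv κ p.2 * e.2 : ℝ) : ℂ) * u p) * η p =
      v p * ((κ p.2 : ℂ) * η p) + u p * (((deriv κ p.2 * e.2 : ℝ) : ℂ) * η p) := by
    intro p; ring
  simp only [e3]
  rw [integral_add (hv.integrable_mul_test hη1) (hu.integrable_mul_test hη2)]
  ring


/-! ### Tangential regularity by difference quotients. -/

/-- A smooth cutoff, `1` on `z ≤ 1` and `0` on `z ≥ 2`. -/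
def cut (z : ℝ) : ℝ := 1 - Real.smoothTransition (z - 1)

lemma contDiff_cut : ContDiff ℝ ∞ cut :=
  contDiff_const.sub (Real.smoothTransition.contDiff.comp (contDiff_id.sub contDiff_const))

lemma cut_of_le {z : ℝ} (h : z ≤ 1) : cut z = 1 := by
  rw [cut, Real.smoothTransition.zero_of_nonpos (by linarith), sub_zero]

lemma cut_of_ge {z : ℝ} (h : 2 ≤ z) : cut z = 0 := by
  rw [cut, Real.smoothTransition.one_of_one_le (by linarith), sub_self]

lemma cut_nonneg (z : ℝ) : 0 ≤ cut z := sub_nonneg.2 (Real.smoothTransition.le_one _)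

lemma cut_le_one (z : ℝ) : cut z ≤ 1 := sub_le_self _ (Real.smoothTransition.nonneg _)

lemma contDiff_deriv_cut : ContDiff ℝ ∞ (deriv cut) := (contDiff_infty_iff_deriv.1 contDiff_cut).2

lemma deriv_cut_of_lt {z : ℝ} (h : z < 1) : deriv cut z = 0 := by
  have : cut =ᶠ[𝓝 z] fun _ => 1 := by
    filter_upwards [Iio_mem_nhds h] with x hx using cut_of_le hx.le
  rw [this.deriv_eq, deriv_const]

lemma deriv_cut_of_gt {z : ℝ} (h : 2 < z) : deriv cut z = 0 := by
  have : cut =ᶠ[𝓝 z] fun _ => 0 := by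
    filter_upwards [Ioi_mem_nhds h] with x hx using cut_of_ge hx.le
  rw [this.deriv_eq, deriv_const]

lemma bounded_of_eq_zero {f : ℝ → ℝ} (hf : Continuous f) (h1 : ∀ z < 1, f z = 0)
    (h2 : ∀ z, 2 < z → f z = 0) : ∃ C, 0 ≤ C ∧ ∀ z, |f z| ≤ C := by
  obtain ⟨C, hC⟩ := (isCompact_Icc (a := (1 : ℝ)) (b := 2)).exists_bound_of_continuousOn
    hf.continuousOn
  have hC0 : 0 ≤ C := (norm_nonneg _).trans (hC 1 (by norm_num))
  refine ⟨C, hC0, fun z => ?_⟩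
  rcases lt_or_ge z 1 with h | h
  · rw [h1 z h, abs_zero]; exact hC0
  · rcases lt_or_ge 2 z with h' | h'
    · rw [h2 z h', abs_zero]; exact hC0
    · exact hC z ⟨h, h'⟩

lemma exists_bound_deriv_cut : ∃ C, 0 ≤ C ∧ ∀ z, |deriv cut z| ≤ C :=
  bounded_of_eq_zero contDiff_deriv_cut.continuous (fun _ => deriv_cut_of_lt)
    (fun _ => deriv_cut_of_gt)

lemma memLp_mul_snd {w : ℝ → ℝ} {f : Pt n → ℂ} (hf : MemLp f 2 (wL n w)) {κ : ℝ → ℝ}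
    (hκ : Continuous κ) {C : ℝ} (hC : ∀ z, |κ z| ≤ C) :
    MemLp (fun p => (κ p.2 : ℂ) * f p) 2 (wL n w) := by
  refine hf.of_le_mul (c := C) ?_ (Eventually.of_forall fun p => ?_)
  · exact (Complex.continuous_ofReal.comp (hκ.comp continuous_snd)).aestronglyMeasurable.mul hf.1
  · rw [norm_mul, Complex.norm_real]
    exact mul_le_mul_of_nonneg_right (hC _) (norm_nonneg _)

lemma IsEn.memLp_id {u : Pt n → ℂ} {v : Option (Fin n) → Pt n → ℂ} (h : IsEn u v) :
    MemLp u 2 (wL n fun z => z) := h.memLp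

lemma IsEn.mul_snd {u : Pt n → ℂ} {v : Option (Fin n) → Pt n → ℂ} (h : IsEn u v) {κ : ℝ → ℝ}
    (hκ : ContDiff ℝ ∞ κ) {C : ℝ} (hC : ∀ z, |κ z| ≤ C) {C' : ℝ} (hC' : ∀ z, |deriv κ z| ≤ C') :
    IsEn (fun p => (κ p.2 : ℂ) * u p) fun j p =>
      (κ p.2 : ℂ) * v j p + ((deriv κ p.2 * (dir j : Pt n).2 : ℝ) : ℂ) * u p where
  memLp := memLp_mul_snd (w := fun z => z) h.memLp_id hκ.continuous hC
  memLp_deriv j := by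
    refine (memLp_mul_snd (h.memLp_deriv j) hκ.continuous hC).add ?_
    cases j with
    | none =>
      have := memLp_mul_snd h.memLp_id (contDiff_infty_iff_deriv.1 hκ).2.continuous hC'
      have e : (fun p : Pt n => ((deriv κ p.2 * (dir (none : Option (Fin n)) : Pt n).2 : ℝ) : ℂ) *
          u p) = fun p => ((deriv κ p.2 : ℝ) : ℂ) * u p := by
        ext p; simp [dir, dirZ]
      rw [e]; exact this
    | some i => simp [dir, dirX]
  weak j η hη := weak_mul_snd h.memL2loc (h.isWeakDeriv j).1 (h.weak j) hκ η hη

lemma Nw_const_mul (w : ℝ → ℝ) (c : ℂ) (f : Pt n → ℂ) :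
    Nw w (fun p => c * f p) = ‖c‖ * Nw w f := by
  have := eLpNorm_const_smul c f 2 (wL n w)
  rw [Nw, Nw, ← toReal_enorm, ← ENNReal.toReal_mul, ← this]
  rfl

/-- Summation by parts for difference quotients: the weight depends on `z` only, so it is unaffected
by the tangential change of variables. -/
lemma integral_mul_star_shift {w : ℝ → ℝ} (hw : IsWeight w) {f g : Pt n → ℂ}
    (hf : MemLp f 2 (wL n w)) (hg : MemLp g 2 (wL n w)) {a : Pt n} (ha : a.2 = 0) (t : ℝ) :
    ∫ p in Om n, (w p.2 : ℂ) * (f p * star ((t : ℂ) * (g (p + -a) - g p))) =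
      ∫ p in Om n, (w p.2 : ℂ) * (((t : ℂ) * (f (p + a) - f p)) * star (g p)) := by
  have ha' : (-a).2 = 0 := by simp [ha]
  have i1 := integrable_mul_star hw hf (memLp_shift hw hg ha')
  have i2 := integrable_mul_star hw hf hg
  have i3 := integrable_mul_star hw (memLp_shift hw hf ha) hg
  have e1 : ∀ p : Pt n, (w p.2 : ℂ) * (f p * star ((t : ℂ) * (g (p + -a) - g p))) =
      (t : ℂ) * ((w p.2 : ℂ) * (f p * star (g (p + -a))) - (w p.2 : ℂ) * (f p * star (g p))) := by
    intro p; simp only [star_mul', star_sub, RCLike.star_def, Complex.conj_ofReal]; ring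
  have e2 : ∀ p : Pt n, (w p.2 : ℂ) * (((t : ℂ) * (f (p + a) - f p)) * star (g p)) =
      (t : ℂ) * ((w p.2 : ℂ) * (f (p + a) * star (g p)) - (w p.2 : ℂ) * (f p * star (g p))) := by
    intro p; ring
  simp only [e1, e2]
  rw [integral_const_mul, integral_const_mul, integral_sub i1 i2, integral_sub i3 i2,
    ← setIntegral_Om_shift ha fun p => (w p.2 : ℂ) * (f p * star (g (p + -a)))]
  simp [ha]

/-- On the support of the cutoff the weight of `H` is dominated by the tangential weight, so
tangential derivatives there are controlled in `H`. For `1 ≤ z ≤ 2` the factor `4` comes from `z ≤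
2` and `z⁻¹ ≥ 1/2`. -/
lemma le_four_mul_rpow {z : ℝ} (hz : 0 < z) (hz2 : z ≤ 2) (n : ℕ) :
    z ≤ 4 * z ^ (-(1 : ℝ) / n) := by
  have hn : (1 : ℝ) / n ≤ 1 := by
    rcases n.eq_zero_or_pos with h | h
    · simp [h]
    · exact div_le_one_of_le₀ (by exact_mod_cast h) (by positivity)
  have hn0 : (0 : ℝ) ≤ 1 / n := by positivity
  rcases le_total z 1 with h | h
  · have : 1 ≤ z ^ (-(1 : ℝ) / n) := by
      apply Real.one_le_rpow_of_pos_of_le_one_of_nonpos hz h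
      rw [neg_div]; linarith
    linarith
  · have h1 : z ^ (-1 : ℝ) ≤ z ^ (-(1 : ℝ) / n) := by
      apply Real.rpow_le_rpow_of_exponent_le h
      rw [neg_div]; linarith
    rw [Real.rpow_neg_one] at h1
    have h2 : (2 : ℝ)⁻¹ ≤ z⁻¹ := inv_anti₀ hz hz2
    linarith

/-- Tangential regularity near `z = 0` of the elements of the domain. -/
theorem exists_bound_diffQuotient {u : Pt n → ℂ} {v : Option (Fin n) → Pt n → ℂ} (h : IsEn u v)
    {C : ℝ} (hC : 0 ≤ C) (hD : ∀ u' v', IsEn u' v' →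
      ‖∑ j, ∫ p in Om n, (wt n j p.2 : ℂ) * (v j p * star (v' j p))‖ ≤ C * Nw (fun z => z) u')
    (i : Fin n) : ∃ B, ∀ t : ℝ, t ≠ 0 → Nw (wt n (some i)) (fun p => (cut p.2 : ℂ) *
      (((t⁻¹ : ℝ) : ℂ) * (v (some i) (p + t • dirX i) - v (some i) p))) ≤ B := by
  obtain ⟨M, hM0, hM⟩ := exists_bound_deriv_cut
  set e : Pt n := dirX i with he
  have he2 : e.2 = 0 := rfl
  have hte : ∀ t : ℝ, (t • e).2 = 0 := fun t => by simp [he2]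
  have hwi := isWeight_wt (n := n) (some i)
  have hcc : Continuous cut := contDiff_cut.continuous
  have hcb : ∀ z, |cut z| ≤ 1 := fun z => by rw [abs_of_nonneg (cut_nonneg z)]; exact cut_le_one z
  -- the function `2 χ' u` and its tangential derivative
  let κ₁ : ℝ → ℝ := fun z => 2 * deriv cut z
  have hκ₁ : ContDiff ℝ ∞ κ₁ := contDiff_const.mul contDiff_deriv_cut
  have hκ₁b : ∀ z, |κ₁ z| ≤ 2 * M := fun z => by
    simp only [κ₁, abs_mul, abs_two]; linarith [hM z]
  have hF : MemLp (fun p => (κ₁ p.2 : ℂ) * u p) 2 (wL n fun z => z) :=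
    memLp_mul_snd h.memLp_id hκ₁.continuous hκ₁b
  have hFV : MemLp (fun p => (κ₁ p.2 : ℂ) * v (some i) p) 2 (wL n fun z => z) := by
    refine memLp_of_le (c := (2 * M) ^ 2 * 4) isWeight_id hwi
      ((aestronglyMeasurable_wL hwi).1
        (memLp_mul_snd (h.memLp_deriv (some i)) hκ₁.continuous hκ₁b).1)
      (h.memLp_deriv (some i)) fun p hp => ?_
    rw [norm_mul, Complex.norm_real, Real.norm_eq_abs, mul_pow]
    have h1 := pow_le_pow_left₀ (abs_nonneg _) (hκ₁b p.2) 2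
    have hp0 : 0 < p.2 := hp
    rcases le_or_gt p.2 2 with h2 | h2
    · have h3 := le_four_mul_rpow hp h2 n
      change p.2 ≤ 4 * wt n (some i) p.2 at h3
      have hw0 := (hwi.pos _ hp).le
      calc p.2 * (|κ₁ p.2| ^ 2 * ‖v (some i) p‖ ^ 2)
          ≤ (4 * wt n (some i) p.2) * ((2 * M) ^ 2 * ‖v (some i) p‖ ^ 2) := by gcongr
        _ = _ := by ring
    · have : κ₁ p.2 = 0 := by simp [κ₁, deriv_cut_of_gt h2]
      rw [this]
      have := (hwi.pos _ hp).le
      simp; positivity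
  have hFweak : ∀ η, IsTest η → ∫ p in Om n, ((κ₁ p.2 : ℂ) * u p) * fderiv ℝ η p e =
      -∫ p in Om n, ((κ₁ p.2 : ℂ) * v (some i) p) * η p := by
    intro η hη
    have := weak_mul_snd h.memL2loc (h.isWeakDeriv (some i)).1 (h.weak (some i)) hκ₁ η hη
    simpa [show (dir (some i) : Pt n) = e from rfl, he2] using this
  set C₃ := Nw (fun z => z) fun p => (κ₁ p.2 : ℂ) * v (some i) p with hC₃
  refine ⟨2 * C + C₃, fun t ht => ?_⟩
  set Du : Pt n → ℂ := fun p => ((t⁻¹ : ℝ) : ℂ) * (u (p + t • e) - u p) with hDu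
  set Dv : Option (Fin n) → Pt n → ℂ := fun j p => ((t⁻¹ : ℝ) : ℂ) * (v j (p + t • e) - v j p)
    with hDv
  have hDE : IsEn Du Dv := ((h.shift (hte t)).sub h).const_mul _
  -- The square is chosen so that `κ' = cut · κ₁`: in the cross term one factor `cut` stays with the
  -- difference quotient of `∂_z u`, whose norm can be absorbed.
  let κ : ℝ → ℝ := fun z => cut z ^ 2
  have hκ : ContDiff ℝ ∞ κ := contDiff_cut.pow 2
  have hκd : ∀ z, deriv κ z = cut z * κ₁ z := by
    intro z
    have := ((contDiff_cut.differentiable (by simp)) z).hasDerivAt.pow 2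
    rw [show κ = cut ^ 2 from rfl, this.deriv]
    simp [κ₁]; ring
  have hκb : ∀ z, |κ z| ≤ 1 := fun z => by
    simp only [κ, abs_pow]; exact pow_le_one₀ (abs_nonneg _) (hcb z)
  have hκdb : ∀ z, |deriv κ z| ≤ 1 * (2 * M) := fun z => by
    rw [hκd, abs_mul]
    exact mul_le_mul (hcb z) (hκ₁b z) (abs_nonneg _) zero_le_one
  have hX := hDE.mul_snd hκ hκb hκdb
  set X : Pt n → ℂ := fun p => (κ p.2 : ℂ) * Du p with hXdef
  set X' : Option (Fin n) → Pt n → ℂ := fun j p =>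
    (κ p.2 : ℂ) * Dv j p + ((deriv κ p.2 * (dir j : Pt n).2 : ℝ) : ℂ) * Du p with hX'def
  have hte' : (-(t • e)).2 = 0 := by simp [he2]
  -- Nirenberg's test function: up to sign, `D₋ₜ(χ² Dₜ u)`. Moving the outer difference onto `u`
  -- produces `χ² |Dₜ ∇u|²` and one cross term.
  have hY := ((hX.shift hte').sub hX).const_mul ((t⁻¹ : ℝ) : ℂ)
  have hS := hD _ _ hY
  have hparts : ∀ j, ∫ p in Om n, (wt n j p.2 : ℂ) *
      (v j p * star (((t⁻¹ : ℝ) : ℂ) * (X' j (p + -(t • e)) - X' j p))) =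
      ∫ p in Om n, (wt n j p.2 : ℂ) * (Dv j p * star (X' j p)) := fun j =>
    integral_mul_star_shift (isWeight_wt j) (h.memLp_deriv j) (hX.memLp_deriv j) (hte t) t⁻¹
  simp only [hparts] at hS
  -- the energies of `χ D_t u`
  set a : Option (Fin n) → ℝ := fun j => Nw (wt n j) fun p => (cut p.2 : ℂ) * Dv j p with ha
  have hcv : ∀ j, MemLp (fun p => (cut p.2 : ℂ) * Dv j p) 2 (wL n (wt n j)) := fun j =>
    memLp_mul_snd (hDE.memLp_deriv j) hcc hcb
  have hXi : X' (some i) = fun p => (κ p.2 : ℂ) * Dv (some i) p := by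
    ext p; simp [hX'def, dir, dirX]
  have hXim : MemLp (X' (some i)) 2 (wL n fun z => z) ∧
      Nw (fun z => z) (X' (some i)) ≤ 2 * a (some i) := by
    have hle : ∀ p ∈ Om n, p.2 * ‖X' (some i) p‖ ^ 2 ≤
        2 ^ 2 * (wt n (some i) p.2 * ‖(cut p.2 : ℂ) * Dv (some i) p‖ ^ 2) := by
      intro p hp
      have hp0 : 0 < p.2 := hp
      simp only [hXi, κ, norm_mul, Complex.norm_real, Real.norm_eq_abs, mul_pow, sq_abs]
      rcases le_or_gt p.2 2 with h2 | h2
      · have h3 := le_four_mul_rpow hp h2 n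
        change p.2 ≤ 4 * wt n (some i) p.2 at h3
        have h4 : (cut p.2 ^ 2) ^ 2 ≤ cut p.2 ^ 2 := by
          have := pow_le_one₀ (n := 2) (cut_nonneg p.2) (cut_le_one p.2)
          nlinarith [sq_nonneg (cut p.2)]
        have hw0 := (hwi.pos _ hp).le
        calc p.2 * ((cut p.2 ^ 2) ^ 2 * ‖Dv (some i) p‖ ^ 2)
            ≤ (4 * wt n (some i) p.2) * (cut p.2 ^ 2 * ‖Dv (some i) p‖ ^ 2) := by gcongr
          _ = _ := by ring
      · rw [cut_of_ge h2.le]; simp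
    have hm : MemLp (X' (some i)) 2 (wL n fun z => z) :=
      memLp_of_le isWeight_id hwi ((aestronglyMeasurable_wL hwi).1 (hX.memLp_deriv (some i)).1)
        (hcv (some i)) hle
    exact ⟨hm, Nw_le isWeight_id hwi hm (hcv (some i)) zero_le_two hle⟩
  -- The `H` norm of the test function is at most that of `∂ᵢ(χ² Dₜ u)`, which is part of the energy
  -- to be estimated.
  have hNY : Nw (fun z => z) (fun p => ((t⁻¹ : ℝ) : ℂ) * (X (p + -(t • e)) - X p)) ≤
      2 * a (some i) := by
    rw [Nw_const_mul]
    have h1 := Nw_shift_sub_le isWeight_id hX.memLp_id hXim.1 he2 (hX.weak (some i)) (-t)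
    rw [neg_smul, abs_neg] at h1
    calc _ ≤ ‖((t⁻¹ : ℝ) : ℂ)‖ * (|t| * Nw (fun z => z) (X' (some i))) :=
          mul_le_mul_of_nonneg_left h1 (norm_nonneg _)
      _ = Nw (fun z => z) (X' (some i)) := by
          rw [Complex.norm_real, norm_inv, Real.norm_eq_abs, ← mul_assoc,
            inv_mul_cancel₀ (abs_ne_zero.2 ht), one_mul]
      _ ≤ _ := hXim.2
  have hG : MemLp (fun p => (κ₁ p.2 : ℂ) * Du p) 2 (wL n fun z => z) :=
    memLp_mul_snd hDE.memLp_id hκ₁.continuous hκ₁b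
  -- `κ₁` depends on `z` only, so `κ₁ Dₜ u = Dₜ(κ₁ u)`, bounded by `κ₁ ∂ᵢu` independently of `t`.
  have hNG : Nw (fun z => z) (fun p => (κ₁ p.2 : ℂ) * Du p) ≤ C₃ := by
    have e1 : (fun p : Pt n => (κ₁ p.2 : ℂ) * Du p) = fun p => ((t⁻¹ : ℝ) : ℂ) *
        ((κ₁ (p + t • e).2 : ℂ) * u (p + t • e) - (κ₁ p.2 : ℂ) * u p) := by
      ext p; simp [hDu, he2]; ring
    rw [e1, Nw_const_mul]
    have h1 := Nw_shift_sub_le isWeight_id hF hFV he2 hFweak t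
    calc _ ≤ ‖((t⁻¹ : ℝ) : ℂ)‖ * (|t| * C₃) := mul_le_mul_of_nonneg_left h1 (norm_nonneg _)
      _ = C₃ := by
          rw [Complex.norm_real, norm_inv, Real.norm_eq_abs, ← mul_assoc,
            inv_mul_cancel₀ (abs_ne_zero.2 ht), one_mul]
  have hcross := norm_pair_le isWeight_id (hcv none) hG
  set Q := ∫ p in Om n, (p.2 : ℂ) * (((cut p.2 : ℂ) * Dv none p) * star ((κ₁ p.2 : ℂ) * Du p))
    with hQ
  have hsq : ∀ j, ((a j ^ 2 : ℝ) : ℂ) =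
      ∫ p in Om n, (wt n j p.2 : ℂ) * ((κ p.2 : ℂ) * (Dv j p * star (Dv j p))) := by
    intro j
    rw [ha, Nw_sq (isWeight_wt j) (hcv j), ← integral_complex_ofReal]
    refine integral_congr_ae (Eventually.of_forall fun p => ?_)
    simp only [norm_mul, Complex.norm_real, Real.norm_eq_abs, mul_pow, sq_abs, κ,
      RCLike.star_def, Complex.mul_conj, Complex.normSq_eq_norm_sq]
    push_cast; ring
  have hint : ∀ j, Integrable (fun p => (wt n j p.2 : ℂ) *
      ((κ p.2 : ℂ) * (Dv j p * star (Dv j p)))) (volume.restrict (Om n)) := by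
    intro j
    refine (integrable_mul_star (isWeight_wt j) (memLp_mul_snd (hDE.memLp_deriv j) hκ.continuous hκb)
      (hDE.memLp_deriv j)).congr (Eventually.of_forall fun p => ?_)
    simp only; ring
  have hsplit : ∑ j, ∫ p in Om n, (wt n j p.2 : ℂ) * (Dv j p * star (X' j p)) =
      ((∑ j, a j ^ 2 : ℝ) : ℂ) + Q := by
    rw [Fintype.sum_option, Fintype.sum_option]
    push_cast
    have e1 : ∀ i', ∫ p in Om n, (wt n (some i') p.2 : ℂ) * (Dv (some i') p *
        star (X' (some i') p)) = (a (some i') : ℂ) ^ 2 := by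
      intro i'
      rw [← Complex.ofReal_pow, hsq]
      refine integral_congr_ae (Eventually.of_forall fun p => ?_)
      simp only [hX'def, dir, dirX, mul_zero, Complex.ofReal_zero, zero_mul, add_zero, star_mul',
        RCLike.star_def, Complex.conj_ofReal]
      ring
    have e2 : ∫ p in Om n, (wt n none p.2 : ℂ) * (Dv none p * star (X' none p)) =
        (a none : ℂ) ^ 2 + Q := by
      rw [← Complex.ofReal_pow, hsq, hQ, ← integral_add (hint none)
        (integrable_mul_star isWeight_id (hcv none) hG)]
      refine integral_congr_ae (Eventually.of_forall fun p => ?_)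
      simp only [hX'def, dir, dirZ, mul_one, hκd, star_mul', star_add, Complex.ofReal_mul,
        RCLike.star_def, Complex.conj_ofReal, wt, Complex.ofReal_one]
      ring
    simp only [e1, e2]
    ring
  have hfin : ∑ j, a j ^ 2 ≤ C * (2 * a (some i)) + a none * C₃ := by
    have h1 : ((∑ j, a j ^ 2 : ℝ) : ℂ) =
        (∑ j, ∫ p in Om n, (wt n j p.2 : ℂ) * (Dv j p * star (X' j p))) - Q := by
      rw [hsplit]; ring
    have h2 : ‖((∑ j, a j ^ 2 : ℝ) : ℂ)‖ ≤ C * (2 * a (some i)) + a none * C₃ := by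
      rw [h1]
      refine (norm_sub_le _ _).trans (add_le_add (hS.trans ?_) (hcross.trans ?_))
      · exact mul_le_mul_of_nonneg_left hNY hC
      · exact mul_le_mul_of_nonneg_left hNG (Nw_nonneg _ _)
    rw [Complex.norm_real, Real.norm_of_nonneg (Finset.sum_nonneg fun j _ => sq_nonneg _)] at h2
    exact h2
  have h1 : a (some i) ^ 2 + a none ^ 2 ≤ ∑ j, a j ^ 2 := by
    rw [Fintype.sum_option, add_comm]
    gcongr
    exact Finset.single_le_sum (f := fun j => a (some j) ^ 2) (fun _ _ => sq_nonneg _)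
      (Finset.mem_univ i)
  have hC₃0 : 0 ≤ C₃ := Nw_nonneg _ _
  have hai : 0 ≤ a (some i) := Nw_nonneg _ _
  change a (some i) ≤ 2 * C + C₃
  -- With `x = a (some i)` and `y = a none`, the estimate reads `x² + y² ≤ 2 C x + C₃ y`. Since `C₃
  -- y ≤ y² + C₃²/4`, it follows that `x² ≤ 2 C x + C₃²/4`, which excludes `x > 2 C + C₃`.
  by_contra hcon
  push Not at hcon
  nlinarith [sq_nonneg (a none - C₃ / 2), mul_nonneg hC hai, mul_nonneg hC₃0 hai]


/-! ### A logarithmic ramp -/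

/-- The function with `z β'(z) = 1` on `[a, b)` which is constant on both sides of `[a, b)`
and vanishes for `z ≥ b`. -/
def ramp (a b z : ℝ) : ℝ := Real.log (max a (min z b) / b)

/-- The right derivative of `ramp`. -/
def rampDeriv (a b : ℝ) : ℝ → ℝ := (Ico a b).indicator fun z => z⁻¹

lemma ramp_of_ge {a b z : ℝ} (hb : 0 < b) (hab : a < b) (h : b ≤ z) : ramp a b z = 0 := by
  rw [ramp, min_eq_right h, max_eq_right hab.le, div_self hb.ne', Real.log_one]

lemma continuous_ramp {a b : ℝ} (ha : 0 < a) (hb : 0 < b) : Continuous (ramp a b) := by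
  unfold ramp
  refine Continuous.log (by fun_prop) fun z => ?_
  have : 0 < max a (min z b) := lt_max_of_lt_left ha
  positivity

lemma measurable_rampDeriv (a b : ℝ) : Measurable (rampDeriv a b) :=
  measurable_inv.indicator measurableSet_Ico

lemma hasDerivWithinAt_ramp {a b : ℝ} (ha : 0 < a) (hab : a < b) (z : ℝ) :
    HasDerivWithinAt (ramp a b) (rampDeriv a b z) (Ioi z) z := by
  have hb : 0 < b := ha.trans hab
  rcases lt_or_ge z a with h | h
  · have h1 : rampDeriv a b z = 0 := indicator_of_notMem (fun h' => absurd h'.1 (not_le.2 h)) _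
    have h2 : ramp a b =ᶠ[𝓝 z] fun _ => Real.log (a / b) := by
      filter_upwards [Iio_mem_nhds h] with x hx
      rw [ramp, max_eq_left ((min_le_left _ _).trans (le_of_lt hx))]
    rw [h1]
    exact ((hasDerivAt_const z _).congr_of_eventuallyEq h2).hasDerivWithinAt
  rcases lt_or_ge z b with h' | h'
  · have h1 : rampDeriv a b z = z⁻¹ := indicator_of_mem (show z ∈ Ico a b from ⟨h, h'⟩) _
    have h2 : ∀ x, a ≤ x → x < b → ramp a b x = Real.log (x / b) := fun x hx hxb => by
      rw [ramp, min_eq_left hxb.le, max_eq_right hx]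
    have h3 : ramp a b =ᶠ[𝓝[>] z] fun x => Real.log (x / b) := by
      filter_upwards [self_mem_nhdsWithin, nhdsWithin_le_nhds (Iio_mem_nhds h')] with x hx hx'
      exact h2 x (h.trans (le_of_lt hx)) hx'
    have hz : 0 < z := ha.trans_le h
    have h4 : HasDerivAt (fun x => Real.log (x / b)) z⁻¹ z := by
      refine (((hasDerivAt_id z).div_const b).log (by simp [hz.ne', hb.ne'])).congr_deriv ?_
      simp only [id]; field_simp
    rw [h1]
    exact h4.hasDerivWithinAt.congr_of_eventuallyEq h3 (h2 z h h')
  · have h1 : rampDeriv a b z = 0 := indicator_of_notMem (fun h => absurd h.2 (not_lt.2 h')) _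
    rw [h1]
    refine (hasDerivWithinAt_const z (Ioi z) (0 : ℝ)).congr (fun x hx => ?_) ?_
    · exact ramp_of_ge hb hab (h'.trans (le_of_lt hx))
    · exact ramp_of_ge hb hab h'

/-- The logarithm is bounded by the power `8 (b/z)^(1/8)`; the small exponent keeps the square
integrable against `z^(-1/2)`, and the bound does not depend on `a`. -/
lemma ramp_sq_le {a b z : ℝ} (ha : 0 < a) (hab : a < b) (hz : 0 < z) (hzb : z ≤ b) :
    ramp a b z ^ 2 ≤ 64 * (b ^ (1 / 4 : ℝ) * z ^ (-(1 / 4) : ℝ)) := by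
  have hb : 0 < b := ha.trans hab
  set m := max a (min z b) with hm
  have hm0 : 0 < m := lt_max_of_lt_left ha
  have hmb : m ≤ b := max_le hab.le (min_le_right _ _)
  have hzm : z ≤ m := by rw [hm, min_eq_left hzb]; exact le_max_right _ _
  have h1 : |ramp a b z| = Real.log (b / m) := by
    rw [ramp, ← hm, abs_of_nonpos (Real.log_nonpos (by positivity) ((div_le_one hb).2 hmb)),
      ← Real.log_inv, inv_div]
  have h2 : Real.log (b / m) ≤ Real.log (b / z) := Real.log_le_log (by positivity) (by gcongr)
  have h3 := Real.log_le_rpow_div (x := b / z) (ε := 1 / 8) (by positivity) (by norm_num)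
  have h4 : |ramp a b z| ≤ 8 * (b / z) ^ (1 / 8 : ℝ) := by
    rw [h1]; refine h2.trans (h3.trans (le_of_eq ?_)); ring
  rw [← sq_abs]
  refine (pow_le_pow_left₀ (abs_nonneg _) h4 2).trans (le_of_eq ?_)
  have h5 : ((b / z) ^ (1 / 8 : ℝ)) ^ 2 = b ^ (1 / 4 : ℝ) * z ^ (-(1 / 4) : ℝ) := by
    rw [← Real.rpow_natCast, ← Real.rpow_mul (by positivity), Real.div_rpow hb.le hz.le,
      Real.rpow_neg hz.le]
    norm_num
    rfl
  rw [mul_pow, h5]; norm_num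

lemma le_rpow_neg_half {z : ℝ} (hz : 0 < z) (hz1 : z ≤ 1) : z ≤ z ^ (-(1 / 2) : ℝ) :=
  hz1.trans (Real.one_le_rpow_of_pos_of_le_one_of_nonpos hz hz1 (by norm_num))

/-- This is where `n ≥ 2` enters: the tangential weight is no more singular than `z^(-1/2)`. -/
lemma wt_some_le (hn : 2 ≤ n) {z : ℝ} (hz : 0 < z) (hz1 : z ≤ 1) (i : Fin n) :
    wt n (some i) z ≤ z ^ (-(1 / 2) : ℝ) := by
  refine Real.rpow_le_rpow_of_exponent_ge hz hz1 ?_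
  rw [neg_div, neg_le_neg_iff]
  exact one_div_le_one_div_of_le two_pos (by exact_mod_cast hn)

/-- The integrand is at most `64 b^(1/4) z^(-3/4)` on `(0, b]`, whose integral is `64 b^(1/4) · 4
b^(1/4) = 256 √b`. The bound is uniform in `a`. -/
lemma integrable_ramp_sq {w : ℝ → ℝ} (hw : IsWeight w)
    (hw1 : ∀ z, 0 < z → z ≤ 1 → w z ≤ z ^ (-(1 / 2) : ℝ)) {a b : ℝ} (ha : 0 < a) (hab : a < b)
    (hb1 : b ≤ 1) : IntegrableOn (fun z => w z * ramp a b z ^ 2) (Ioi 0) ∧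
      ∫ z in Ioi 0, w z * ramp a b z ^ 2 ≤ 256 * √b := by
  have hb : 0 < b := ha.trans hab
  set G : ℝ → ℝ := (Ioc 0 b).indicator fun z => 64 * b ^ (1 / 4 : ℝ) * z ^ (-(3 / 4) : ℝ) with hG
  have hint : IntervalIntegrable (fun z : ℝ => z ^ (-(3 / 4) : ℝ)) volume 0 b :=
    intervalIntegral.intervalIntegrable_rpow' (by norm_num)
  have hGi : Integrable G volume := by
    rw [hG, integrable_indicator_iff measurableSet_Ioc]
    exact ((intervalIntegrable_iff_integrableOn_Ioc_of_le hb.le).1 hint).const_mul _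
  have hle : ∀ z ∈ Ioi (0 : ℝ), w z * ramp a b z ^ 2 ≤ G z := by
    intro z hz
    have hz : 0 < z := hz
    rcases le_or_gt z b with h | h
    · rw [hG, indicator_of_mem (show z ∈ Ioc 0 b from ⟨hz, h⟩)]
      calc w z * ramp a b z ^ 2
          ≤ z ^ (-(1 / 2) : ℝ) * (64 * (b ^ (1 / 4 : ℝ) * z ^ (-(1 / 4) : ℝ))) :=
            mul_le_mul (hw1 z hz (h.trans hb1)) (ramp_sq_le ha hab hz h) (sq_nonneg _)
              (by positivity)
        _ = 64 * b ^ (1 / 4 : ℝ) * (z ^ (-(1 / 2) : ℝ) * z ^ (-(1 / 4) : ℝ)) := by ring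
        _ = _ := by rw [← Real.rpow_add hz]; norm_num
    · rw [ramp_of_ge hb hab h.le]
      have : z ∉ Ioc 0 b := fun h' => absurd h'.2 (not_le.2 h)
      rw [hG, indicator_of_notMem this]; simp
  have hm : AEStronglyMeasurable (fun z => w z * ramp a b z ^ 2) (volume.restrict (Ioi 0)) :=
    (hw.meas.mul ((continuous_ramp ha hb).measurable.pow_const 2)).aestronglyMeasurable
  have hi : IntegrableOn (fun z => w z * ramp a b z ^ 2) (Ioi 0) := by
    refine hGi.integrableOn.mono' hm ?_
    filter_upwards [ae_restrict_mem measurableSet_Ioi] with z hz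
    rw [Real.norm_of_nonneg (mul_nonneg (hw.pos z hz).le (sq_nonneg _))]
    exact hle z hz
  refine ⟨hi, (setIntegral_mono_on hi hGi.integrableOn measurableSet_Ioi hle).trans ?_⟩
  have hGn : 0 ≤ G := indicator_nonneg fun z hz => by have := hz.1; positivity
  refine (setIntegral_le_integral hGi (Eventually.of_forall hGn)).trans (le_of_eq ?_)
  rw [hG, integral_indicator measurableSet_Ioc, integral_const_mul,
    ← intervalIntegral.integral_of_le hb.le, integral_rpow (Or.inl (by norm_num)), Real.sqrt_eq_rpow]
  rw [Real.zero_rpow (by norm_num), show (-(3 / 4) + 1 : ℝ) = 1 / 4 by norm_num, sub_zero]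
  have : b ^ (1 / 2 : ℝ) = b ^ (1 / 4 : ℝ) * b ^ (1 / 4 : ℝ) := by
    rw [← Real.rpow_add hb]; norm_num
  rw [this]; ring

lemma integral_ramp_mul_deriv {a b : ℝ} (ha : 0 < a) (hab : a < b) {φ : ℝ → ℂ}
    (hφ : ContDiff ℝ 1 φ) (hc : HasCompactSupport φ) :
    ∫ z, (ramp a b z : ℂ) * deriv φ z = -∫ z, (rampDeriv a b z : ℂ) * φ z := by
  have hb : 0 < b := ha.trans hab
  obtain ⟨R, hR⟩ := hc.isCompact.isBounded.subset_closedBall 0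
  have hR1 : ∀ z, φ z ≠ 0 → |z| ≤ R := fun z hz => by
    simpa using hR (subset_tsupport _ hz)
  have hR2 : ∀ z, deriv φ z ≠ 0 → |z| ≤ R := fun z hz => by
    simpa using hR (tsupport_deriv_subset (subset_tsupport _ hz))
  set L := max R 0 + 1 with hL
  have hRL : R < L := by have := le_max_left R 0; linarith
  have hL0 : 0 < L := by have := le_max_right R 0; linarith
  have hout : ∀ z, |z| ≤ R → z ∈ Ioc (-L) L := fun z hz => by
    have := abs_le.1 hz; constructor <;> linarith
  have e1 : ∫ z in (-L)..L, (ramp a b z : ℂ) * deriv φ z = ∫ z, (ramp a b z : ℂ) * deriv φ z :=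
    intervalIntegral.integral_eq_integral_of_support_subset fun z hz =>
      hout z (hR2 z (right_ne_zero_of_mul hz))
  have e2 : ∫ z in (-L)..L, (rampDeriv a b z : ℂ) * φ z = ∫ z, (rampDeriv a b z : ℂ) * φ z :=
    intervalIntegral.integral_eq_integral_of_support_subset fun z hz =>
      hout z (hR1 z (right_ne_zero_of_mul hz))
  have z1 : φ L = 0 := by
    by_contra h; have := hR1 _ h; rw [abs_of_pos hL0] at this; linarith
  have z2 : φ (-L) = 0 := by
    by_contra h; have := hR1 _ h; rw [abs_neg, abs_of_pos hL0] at this; linarith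
  have hrd : IntervalIntegrable (fun z => (rampDeriv a b z : ℂ)) volume (-L) L := by
    rw [intervalIntegrable_iff]
    refine Measure.integrableOn_of_bounded (M := a⁻¹) (by simp)
      (Complex.measurable_ofReal.comp (measurable_rampDeriv a b)).aestronglyMeasurable
      (Eventually.of_forall fun z => ?_)
    rw [Complex.norm_real, rampDeriv, Real.norm_eq_abs]
    by_cases hz : z ∈ Ico a b
    · rw [indicator_of_mem hz, abs_of_pos (inv_pos.2 (ha.trans_le hz.1))]
      exact inv_anti₀ ha hz.1
    · rw [indicator_of_notMem hz, abs_zero]; positivity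
  -- The ramp has corners at `a` and `b`, so integration by parts uses right derivatives; this is
  -- also why the strips are half-open on the right.
  have key := intervalIntegral.integral_mul_deriv_eq_deriv_mul_of_hasDeriv_right
    (u := fun z => (ramp a b z : ℂ)) (v := φ) (u' := fun z => (rampDeriv a b z : ℂ))
    (v' := deriv φ) (a := -L) (b := L)
    (Complex.continuous_ofReal.comp (continuous_ramp ha hb)).continuousOn hφ.continuous.continuousOn
    (fun z _ => (Complex.ofRealCLM.hasFDerivAt.comp_hasDerivWithinAt z
      (hasDerivWithinAt_ramp ha hab z)))
    (fun z _ => ((hφ.differentiable one_ne_zero) z).hasDerivAt.hasDerivWithinAt) hrd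
    ((hφ.continuous_deriv le_rfl).intervalIntegrable _ _)
  rw [e1, e2, z1, z2] at key
  simpa using key

/-! ### Functions with separated variables -/

lemma volume_restrict_Om : (volume : Measure (Pt n)).restrict (Om n) =
    (volume : Measure (Tang n)).prod (volume.restrict (Ioi 0)) := by
  have : Om n = univ ×ˢ Ioi (0 : ℝ) := by ext p; simp [Om]
  rw [this, Measure.volume_eq_prod, ← Measure.prod_restrict, Measure.restrict_univ]

lemma memLp_prod {w : ℝ → ℝ} (hw : IsWeight w) {α : Tang n → ℂ} (hα : MemLp α 2 volume)
    {β : ℝ → ℝ} (hβ : Measurable β) (hi : IntegrableOn (fun z => w z * β z ^ 2) (Ioi 0)) :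
    MemLp (fun p : Pt n => (β p.2 : ℂ) * α p.1) 2 (wL n w) ∧
      Nw w (fun p : Pt n => (β p.2 : ℂ) * α p.1) ^ 2 =
        (eLpNorm α 2 volume).toReal ^ 2 * ∫ z in Ioi 0, w z * β z ^ 2 := by
  have h1 : Integrable (fun x => ‖α x‖ ^ 2) volume := (memLp_two_iff_integrable_sq_norm hα.1).1 hα
  have e : ∀ p : Pt n, w p.2 * ‖(β p.2 : ℂ) * α p.1‖ ^ 2 = ‖α p.1‖ ^ 2 * (w p.2 * β p.2 ^ 2) := by
    intro p
    rw [norm_mul, Complex.norm_real, mul_pow, Real.norm_eq_abs, sq_abs]; ring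
  have hm : AEStronglyMeasurable (fun p : Pt n => (β p.2 : ℂ) * α p.1)
      (volume.restrict (Om n)) := by
    rw [volume_restrict_Om]
    exact ((Complex.measurable_ofReal.comp (hβ.comp measurable_snd)).aestronglyMeasurable).mul
      hα.1.comp_fst
  have hM : MemLp (fun p : Pt n => (β p.2 : ℂ) * α p.1) 2 (wL n w) := by
    refine memLp_of_integrable_sq hw hm ?_
    simp only [e]
    rw [volume_restrict_Om]
    exact h1.mul_prod hi
  refine ⟨hM, ?_⟩
  rw [Nw_sq hw hM]
  simp only [e]
  rw [volume_restrict_Om, integral_prod_mul (fun x => ‖α x‖ ^ 2) fun z => w z * β z ^ 2]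
  congr 1
  have hself := inner_self_eq_norm_sq_to_K (𝕜 := ℂ) (hα.toLp α)
  rw [Lp.norm_toLp, L2.inner_def] at hself
  have h2 : ∫ x, inner ℂ (hα.toLp α x) (hα.toLp α x) = ((∫ x, ‖α x‖ ^ 2 : ℝ) : ℂ) := by
    rw [← integral_complex_ofReal]
    refine integral_congr_ae ?_
    filter_upwards [hα.coeFn_toLp] with x hx
    rw [hx, inner_self_eq_norm_sq_to_K]; simp
  rw [h2] at hself
  have h3 := congrArg Complex.re hself
  rw [Complex.ofReal_re] at h3
  rw [h3]
  norm_cast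

lemma fderiv_slice_snd {η : Pt n → ℂ} (hη : Differentiable ℝ η) (x : Tang n) (z : ℝ) :
    deriv (fun z => η (x, z)) z = fderiv ℝ η (x, z) (dirZ n) := by
  have h1 : HasDerivAt (fun z : ℝ => (x, z)) ((0 : Tang n), (1 : ℝ)) z :=
    (hasDerivAt_const z x).prodMk (hasDerivAt_id z)
  exact ((hη (x, z)).hasFDerivAt.comp_hasDerivAt z h1).deriv

lemma fderiv_slice_fst {η : Pt n → ℂ} (hη : Differentiable ℝ η) (x e : Tang n) (z : ℝ) :
    fderiv ℝ (fun x => η (x, z)) x e = fderiv ℝ η (x, z) (e, 0) := by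
  have h1 : HasFDerivAt (fun x : Tang n => (x, z)) (ContinuousLinearMap.inl ℝ (Tang n) ℝ) x :=
    hasFDerivAt_prodMk_left x z
  have h2 := (hη (x, z)).hasFDerivAt.comp x h1
  change fderiv ℝ (η ∘ fun x => (x, z)) x e = _
  rw [h2.fderiv]
  simp

lemma HasCompactSupport.slice_snd {η : Pt n → ℂ} (hη : HasCompactSupport η) (x : Tang n) :
    HasCompactSupport fun z => η (x, z) :=
  HasCompactSupport.intro (hη.isCompact.image continuous_snd) fun _ hz =>
    image_eq_zero_of_notMem_tsupport fun h => hz ⟨_, h, rfl⟩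

lemma HasCompactSupport.slice_fst {η : Pt n → ℂ} (hη : HasCompactSupport η) (z : ℝ) :
    HasCompactSupport fun x => η (x, z) :=
  HasCompactSupport.intro (hη.isCompact.image continuous_fst) fun _ hx =>
    image_eq_zero_of_notMem_tsupport fun h => hx ⟨_, h, rfl⟩

lemma IsTest.setIntegral_eq {η : Pt n → ℂ} (hη : IsTest η) (f : Pt n → ℂ) :
    ∫ p in Om n, f p * η p = ∫ p, f p * η p :=
  setIntegral_eq_integral_of_forall_compl_eq_zero fun p hp => by
    simp [image_eq_zero_of_notMem_tsupport fun h => hp (hη.subset h)]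

lemma IsTest.integral_mul {η : Pt n → ℂ} (hη : IsTest η) {f : Pt n → ℂ} (hf : MemL2loc f) :
    Integrable (fun p => f p * η p) ((volume : Measure (Tang n)).prod volume) := by
  rw [← Measure.volume_eq_prod]
  refine (integrableOn_iff_integrable_of_support_subset (s := Om n) fun p hp => ?_).1
    (hf.integrable_mul_test hη)
  exact hη.subset (subset_tsupport _ (right_ne_zero_of_mul hp))

/-- The element `θ(x) β(z)` of the energy space, where `β` is a logarithmic ramp. -/
lemma isEn_ramp (hn : 2 ≤ n) {a b : ℝ} (ha : 0 < a) (hab : a < b) (hb1 : b ≤ 1) {θ : Tang n → ℂ}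
    (hθ : ContDiff ℝ ∞ θ) (hc : HasCompactSupport θ) :
    IsEn (fun p : Pt n => (ramp a b p.2 : ℂ) * θ p.1) fun j p => match j with
      | none => (rampDeriv a b p.2 : ℂ) * θ p.1
      | some i => (ramp a b p.2 : ℂ) * fderiv ℝ θ p.1 (EuclideanSpace.single i 1) := by
  have hb : 0 < b := ha.trans hab
  have hm := (continuous_ramp ha hb).measurable
  have hθL : MemLp θ 2 volume := hθ.continuous.memLp_of_hasCompactSupport hc
  have hdc : ∀ e, Continuous fun x => fderiv ℝ θ x e := fun e =>
    (hθ.continuous_fderiv (by simp)).clm_apply continuous_const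
  have hdL : ∀ e, MemLp (fun x => fderiv ℝ θ x e) 2 volume := fun e =>
    (hdc e).memLp_of_hasCompactSupport (hc.fderiv_apply ℝ e)
  have m1 : MemLp (fun p : Pt n => (ramp a b p.2 : ℂ) * θ p.1) 2 (wL n fun z => z) :=
    (memLp_prod isWeight_id hθL hm (integrable_ramp_sq isWeight_id
      (fun z hz hz1 => le_rpow_neg_half hz hz1) ha hab hb1).1).1
  -- Here `z β'² = z⁻¹ ≤ a⁻¹` on `[a, b)`. This depends on `a`, but only membership in the energy
  -- space is needed, not a bound on the norm.
  have hrd : IntegrableOn (fun z => z * rampDeriv a b z ^ 2) (Ioi 0) := by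
    have h1 : Integrable ((Ico a b).indicator fun _ => a⁻¹) volume :=
      (integrable_indicator_iff measurableSet_Ico).2 (integrableOn_const (by simp) (by simp))
    refine h1.integrableOn.mono'
      (measurable_id.mul ((measurable_rampDeriv a b).pow_const 2)).aestronglyMeasurable
      (Eventually.of_forall fun z => ?_)
    by_cases hz : z ∈ Ico a b
    · have hz0 : 0 < z := ha.trans_le hz.1
      rw [rampDeriv, indicator_of_mem hz, indicator_of_mem hz, Real.norm_of_nonneg (by positivity)]
      calc z * z⁻¹ ^ 2 = z⁻¹ := by field_simp
        _ ≤ a⁻¹ := inv_anti₀ ha hz.1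
    · rw [rampDeriv, indicator_of_notMem hz, indicator_of_notMem hz]; simp
  have m2 : MemLp (fun p : Pt n => (rampDeriv a b p.2 : ℂ) * θ p.1) 2 (wL n fun z => z) :=
    (memLp_prod isWeight_id hθL (measurable_rampDeriv a b) hrd).1
  have m3 : ∀ i : Fin n, MemLp (fun p : Pt n => (ramp a b p.2 : ℂ) *
      fderiv ℝ θ p.1 (EuclideanSpace.single i 1)) 2 (wL n (wt n (some i))) := fun i =>
    (memLp_prod (isWeight_wt _) (hdL _) hm (integrable_ramp_sq (isWeight_wt (some i))
      (fun z hz hz1 => wt_some_le hn hz hz1 i) ha hab hb1).1).1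
  refine ⟨by rw [wMeasure_eq]; exact m1, fun j => ?_, fun j η hη => ?_⟩
  · cases j with
    | none => exact m2
    | some i => exact m3 i
  have hηd : Differentiable ℝ η := hη.smooth.differentiable (by simp)
  have l1 := memL2loc_of_wL isWeight_id m1
  rw [(hη.fderiv (dir j)).setIntegral_eq, hη.setIntegral_eq, Measure.volume_eq_prod]
  cases j with
  | none =>
    change ∫ p : Pt n, ((ramp a b p.2 : ℂ) * θ p.1) * fderiv ℝ η p (dirZ n) ∂_ =
      -∫ p : Pt n, ((rampDeriv a b p.2 : ℂ) * θ p.1) * η p ∂_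
    rw [integral_prod _ ((hη.fderiv (dirZ n)).integral_mul l1),
      integral_prod _ (hη.integral_mul (memL2loc_of_wL isWeight_id m2)), ← integral_neg]
    refine integral_congr_ae (Eventually.of_forall fun x => ?_)
    have h1 := integral_ramp_mul_deriv ha hab (φ := fun z => η (x, z))
      ((hη.smooth.comp (contDiff_const.prodMk contDiff_id)).of_le (by simp))
      (HasCompactSupport.slice_snd hη.compact x)
    simp only [fderiv_slice_snd hηd] at h1
    calc ∫ z, ((ramp a b z : ℂ) * θ x) * fderiv ℝ η (x, z) (dirZ n)
        = θ x * ∫ z, (ramp a b z : ℂ) * fderiv ℝ η (x, z) (dirZ n) := by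
          rw [← integral_const_mul]; congr 1; ext z; ring
      _ = -∫ z, ((rampDeriv a b z : ℂ) * θ x) * η (x, z) := by
          rw [h1, mul_neg, ← integral_const_mul]; congr 2; ext z; ring
  | some i =>
    change ∫ p : Pt n, ((ramp a b p.2 : ℂ) * θ p.1) * fderiv ℝ η p (dirX i) ∂_ =
      -∫ p : Pt n, ((ramp a b p.2 : ℂ) * fderiv ℝ θ p.1 (EuclideanSpace.single i 1)) * η p ∂_
    rw [integral_prod_symm _ ((hη.fderiv (dirX i)).integral_mul l1),
      integral_prod_symm _ (hη.integral_mul (memL2loc_of_wL (isWeight_wt _) (m3 i))),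
      ← integral_neg]
    refine integral_congr_ae (Eventually.of_forall fun z => ?_)
    set e : Tang n := EuclideanSpace.single i 1
    have hs : ContDiff ℝ ∞ fun x => η (x, z) := hη.smooth.comp (contDiff_id.prodMk contDiff_const)
    have hsc := HasCompactSupport.slice_fst hη.compact z
    have h1 := integral_mul_fderiv_eq_neg_fderiv_mul_of_integrable (μ := volume)
      (f := θ) (g := fun x => η (x, z)) (v := e)
      (((hdc e).mul hs.continuous).integrable_of_hasCompactSupport hsc.mul_left)
      ((hθ.continuous.mul ((hs.continuous_fderiv (by simp)).clm_apply
        continuous_const)).integrable_of_hasCompactSupport hc.mul_right)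
      ((hθ.continuous.mul hs.continuous).integrable_of_hasCompactSupport hsc.mul_left)
      (fun x _ => hθ.differentiable (by simp) x) fun x _ => hs.differentiable (by simp) x
    simp only [fderiv_slice_fst hηd] at h1
    calc ∫ x, ((ramp a b z : ℂ) * θ x) * fderiv ℝ η (x, z) (dirX i)
        = (ramp a b z : ℂ) * ∫ x, θ x * fderiv ℝ η (x, z) (e, 0) := by
          rw [← integral_const_mul]; congr 1; ext x; simp only [mul_assoc]; rfl
      _ = -∫ x, ((ramp a b z : ℂ) * fderiv ℝ θ x e) * η (x, z) := by
          rw [h1, mul_neg, ← integral_const_mul]; congr 2; ext x; ring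


/-! ### The strip estimate for the normal derivative. -/

lemma integrable_mul_star_prod {w : ℝ → ℝ} (hw : IsWeight w) {f : Pt n → ℂ}
    (hf : MemLp f 2 (wL n w)) {β : ℝ → ℝ} (hβ : Measurable β)
    (hi : IntegrableOn (fun z => w z * β z ^ 2) (Ioi 0)) {α : Tang n → ℂ} (hα : MemLp α 2 volume) :
    Integrable (fun p : Pt n => (w p.2 : ℂ) * (f p * star ((β p.2 : ℂ) * α p.1)))
      (volume.restrict (Om n)) :=
  integrable_mul_star hw hf (memLp_prod hw hα hβ hi).1

lemma hasDerivAt_integral_mul_shift {w : ℝ → ℝ} (hw : IsWeight w) {f : Pt n → ℂ}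
    (hf : MemLp f 2 (wL n w)) {β : ℝ → ℝ} (hβ : Measurable β)
    (hi : IntegrableOn (fun z => w z * β z ^ 2) (Ioi 0)) {θ : Tang n → ℂ}
    (hθ : ContDiff ℝ ∞ θ) (hc : HasCompactSupport θ) (e : Tang n) (s₀ : ℝ) :
    HasDerivAt (fun s : ℝ => ∫ p in Om n,
        (w p.2 : ℂ) * (f p * star ((β p.2 : ℂ) * θ (p.1 + s • e))))
      (∫ p in Om n, (w p.2 : ℂ) * (f p * star ((β p.2 : ℂ) * fderiv ℝ θ (p.1 + s₀ • e) e))) s₀ := by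
  have hdc : Continuous fun x => fderiv ℝ θ x e :=
    (hθ.continuous_fderiv (by simp)).clm_apply continuous_const
  obtain ⟨M, hM⟩ := (hc.fderiv_apply ℝ e).exists_bound_of_continuous hdc
  set K : Set (Tang n) := (fun q : Tang n × ℝ => q.1 - q.2 • e) ''
    (tsupport θ ×ˢ Metric.closedBall s₀ 1) with hKdef
  have hK : IsCompact K := (hc.isCompact.prod (isCompact_closedBall s₀ 1)).image (by fun_prop)
  have hsh : ∀ s : ℝ, MemLp (fun x => θ (x + s • e)) 2 volume := fun s =>
    (hθ.continuous.comp (by fun_prop : Continuous fun x => x + s • e)).memLp_of_hasCompactSupport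
      (hc.comp_homeomorph (Homeomorph.addRight (s • e)))
  have hb : MemLp (K.indicator fun _ => (M : ℂ)) 2 (volume : Measure (Tang n)) :=
    memLp_indicator_const 2 hK.measurableSet _ (Or.inr hK.measure_lt_top.ne)
  have hd0 : ∀ s : ℝ, MemLp (fun x => fderiv ℝ θ (x + s • e) e) 2 volume := fun s =>
    (hdc.comp (by fun_prop : Continuous fun x => x + s • e)).memLp_of_hasCompactSupport
      ((hc.fderiv_apply ℝ e).comp_homeomorph (Homeomorph.addRight (s • e)))
  have hdiff : ∀ (p : Pt n) (s : ℝ), HasDerivAt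
      (fun s : ℝ => (w p.2 : ℂ) * (f p * star ((β p.2 : ℂ) * θ (p.1 + s • e))))
      ((w p.2 : ℂ) * (f p * star ((β p.2 : ℂ) * fderiv ℝ θ (p.1 + s • e) e))) s := by
    intro p s
    have h1 : HasFDerivAt θ (fderiv ℝ θ (p.1 + s • e)) (p.1 + s • e) :=
      (hθ.differentiable (by simp)).differentiableAt.hasFDerivAt
    have h2 : HasDerivAt (fun s : ℝ => p.1 + s • e) e s := by
      simpa using ((hasDerivAt_id s).smul_const e).const_add p.1
    have h3 := (h1.comp_hasDerivAt s h2).const_mul (β p.2 : ℂ)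
    have h4 := (Complex.conjCLE.toContinuousLinearMap.hasFDerivAt.comp_hasDerivAt s h3)
    exact (h4.const_mul (f p)).const_mul (w p.2 : ℂ)
  have hbd : ∀ (p : Pt n) (s : ℝ), s ∈ Metric.ball s₀ 1 →
      ‖(w p.2 : ℂ) * (f p * star ((β p.2 : ℂ) * fderiv ℝ θ (p.1 + s • e) e))‖ ≤
      ‖(w p.2 : ℂ) * (f p * star ((β p.2 : ℂ) * K.indicator (fun _ => (M : ℂ)) p.1))‖ := by
    intro p s hs
    simp only [norm_mul, norm_star]
    gcongr
    by_cases hp : p.1 ∈ K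
    · rw [indicator_of_mem hp, Complex.norm_real]
      exact (hM _).trans (le_abs_self M)
    · have : p.1 + s • e ∉ tsupport θ := fun h => hp
        ⟨(p.1 + s • e, s), ⟨h, Metric.ball_subset_closedBall hs⟩, by simp⟩
      have h2 : fderiv ℝ θ (p.1 + s • e) = 0 := fderiv_of_notMem_tsupport ℝ this
      simp [h2, hp]
  set F : ℝ → Pt n → ℂ := fun s p =>
    (w p.2 : ℂ) * (f p * star ((β p.2 : ℂ) * θ (p.1 + s • e))) with hF
  set F' : ℝ → Pt n → ℂ := fun s p =>
    (w p.2 : ℂ) * (f p * star ((β p.2 : ℂ) * fderiv ℝ θ (p.1 + s • e) e)) with hF'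
  have hF0 : AEStronglyMeasurable (F' s₀) (volume.restrict (Om n)) :=
    (integrable_mul_star_prod hw hf hβ hi (hd0 s₀)).1
  have hFi : ∀ s, Integrable (F s) (volume.restrict (Om n)) := fun s => by
    have := integrable_mul_star_prod hw hf hβ hi (hsh s)
    exact this
  exact (hasDerivAt_integral_of_dominated_loc_of_deriv_le (F := F) (F' := F')
    (Metric.ball_mem_nhds s₀ one_pos) (Eventually.of_forall fun s => (hFi s).1) (hFi s₀) hF0
    (Eventually.of_forall hbd) (integrable_mul_star_prod hw hf hβ hi hb).norm
    (Eventually.of_forall fun p s _ => hdiff p s)).2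

/-- The tangential derivative is moved from `θ` onto `f` through difference quotients, so only the
norm of `β θ` remains and no derivative of `θ` enters the bound. -/
lemma norm_integral_ramp_fderiv_le (hn : 2 ≤ n) (i : Fin n) {f : Pt n → ℂ}
    (hf : MemLp f 2 (wL n (wt n (some i)))) {B : ℝ} (hB : ∀ t : ℝ, t ≠ 0 →
      Nw (wt n (some i)) (fun p => (cut p.2 : ℂ) *
        (((t⁻¹ : ℝ) : ℂ) * (f (p + t • dirX i) - f p))) ≤ B)
    {a b : ℝ} (ha : 0 < a) (hab : a < b) (hb1 : b ≤ 1) {θ : Tang n → ℂ}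
    (hθ : ContDiff ℝ ∞ θ) (hc : HasCompactSupport θ) :
    ‖∫ p in Om n, (wt n (some i) p.2 : ℂ) *
        (f p * star ((ramp a b p.2 : ℂ) * fderiv ℝ θ p.1 (EuclideanSpace.single i 1)))‖ ≤
      B * Nw (wt n (some i)) (fun p => (ramp a b p.2 : ℂ) * θ p.1) := by
  set w := wt n (some i)
  have hw : IsWeight w := isWeight_wt _
  have hb : 0 < b := ha.trans hab
  have hm := (continuous_ramp ha hb).measurable
  have hi := (integrable_ramp_sq hw (fun z hz hz1 => wt_some_le hn hz hz1 i) ha hab hb1).1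
  have hB0 : 0 ≤ B := (Nw_nonneg _ _).trans (hB 1 one_ne_zero)
  set e : Tang n := EuclideanSpace.single i 1
  have hθL : MemLp θ 2 volume := hθ.continuous.memLp_of_hasCompactSupport hc
  set g : Pt n → ℂ := fun p => (ramp a b p.2 : ℂ) * θ p.1 with hg
  have hgL : MemLp g 2 (wL n w) := (memLp_prod hw hθL hm hi).1
  have hd := hasDerivAt_integral_mul_shift hw hf hm hi hθ hc e 0
  simp only [zero_smul, add_zero] at hd
  -- The integral is the derivative at `0` of a function of the shift, so it is bounded by any
  -- Lipschitz constant of that function at `0`.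
  refine hd.le_of_lip'
    (mul_nonneg hB0 (Nw_nonneg _ _)) (Eventually.of_forall fun s => ?_)
  rcases eq_or_ne s 0 with rfl | hs
  · simp
  have ha2 : ((-s) • dirX i : Pt n).2 = 0 := by simp [dirX]
  have hsh : ∀ p : Pt n, g (p + -((-s) • dirX i)) = (ramp a b p.2 : ℂ) * θ (p.1 + s • e) := by
    intro p; simp [hg, dirX, e]
  have hgs : MemLp (fun p : Pt n => (ramp a b p.2 : ℂ) * θ (p.1 + s • e)) 2 (wL n w) := by
    simp only [← hsh]
    exact memLp_shift hw hgL (by simp [dirX])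
  have e1 : (∫ p in Om n, (w p.2 : ℂ) * (f p * star ((ramp a b p.2 : ℂ) * θ (p.1 + s • e)))) -
      ∫ p in Om n, (w p.2 : ℂ) * (f p * star ((ramp a b p.2 : ℂ) * θ (p.1 + (0 : ℝ) • e))) =
      ∫ p in Om n, (w p.2 : ℂ) *
        (f p * star (((1 : ℝ) : ℂ) * (g (p + -((-s) • dirX i)) - g p))) := by
    simp only [zero_smul, add_zero, hsh]
    rw [← integral_sub (integrable_mul_star hw hf hgs) (integrable_mul_star hw hf hgL)]
    congr 1; ext p; simp only [hg, star_sub, Complex.ofReal_one, one_mul]; ring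
  rw [e1, integral_mul_star_shift hw hf hgL ha2]
  have hdf : MemLp (fun p : Pt n => (cut p.2 : ℂ) *
      ((((-s)⁻¹ : ℝ) : ℂ) * (f (p + (-s) • dirX i) - f p))) 2 (wL n w) :=
    memLp_mul_snd (((memLp_shift hw hf ha2).sub hf).const_mul _) contDiff_cut.continuous
      fun z => by rw [abs_of_nonneg (cut_nonneg z)]; exact cut_le_one z
  -- The ramp vanishes for `z ≥ b` and `b ≤ 1`, where the cutoff is still `1`; inserting the cutoff
  -- changes nothing.
  have e2 : ∫ p in Om n, (w p.2 : ℂ) *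
      ((((1 : ℝ) : ℂ) * (f (p + (-s) • dirX i) - f p)) * star (g p)) =
      ((-s : ℝ) : ℂ) * ∫ p in Om n, (w p.2 : ℂ) * (((cut p.2 : ℂ) *
        ((((-s)⁻¹ : ℝ) : ℂ) * (f (p + (-s) • dirX i) - f p))) * star (g p)) := by
    rw [← integral_const_mul]
    congr 1; ext p
    have hs' : (s : ℂ) ≠ 0 := by exact_mod_cast hs
    rcases le_or_gt p.2 1 with h | h
    · rw [cut_of_le h]
      push_cast
      field_simp
    · simp [hg, ramp_of_ge hb hab (hb1.trans h.le)]
  rw [e2, norm_mul, Complex.norm_real, norm_neg, sub_zero, mul_comm]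
  gcongr
  exact (norm_pair_le hw hdf hgL).trans (by gcongr; exacts [Nw_nonneg _ _, hB _ (neg_ne_zero.2 hs)])

lemma Nw_ramp_le {w : ℝ → ℝ} (hw : IsWeight w)
    (hw1 : ∀ z, 0 < z → z ≤ 1 → w z ≤ z ^ (-(1 / 2) : ℝ)) {a b : ℝ} (ha : 0 < a) (hab : a < b)
    (hb1 : b ≤ 1) {θ : Tang n → ℂ} (hθ : MemLp θ 2 volume) :
    Nw w (fun p : Pt n => (ramp a b p.2 : ℂ) * θ p.1) ≤ 16 * √(√b) * (eLpNorm θ 2 volume).toReal := by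
  have hi := integrable_ramp_sq hw hw1 ha hab hb1
  refine le_of_sq_le_sq ?_ (by positivity)
  rw [(memLp_prod hw hθ (continuous_ramp ha (ha.trans hab)).measurable hi.1).2, mul_pow, mul_pow,
    Real.sq_sqrt (Real.sqrt_nonneg _), mul_comm]
  gcongr
  linarith [hi.2]

/-- The `z`-derivative of an element of the domain is small on thin strips near `z = 0`. -/
theorem exists_strip_bound (hn : 2 ≤ n) {u : Pt n → ℂ} {v : Option (Fin n) → Pt n → ℂ}
    (h : IsEn u v) {C : ℝ} (hC : 0 ≤ C) (hD : ∀ u' v', IsEn u' v' →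
      ‖∑ j, ∫ p in Om n, (wt n j p.2 : ℂ) * (v j p * star (v' j p))‖ ≤ C * Nw (fun z => z) u') :
    ∃ K, 0 ≤ K ∧ ∀ a b : ℝ, 0 < a → a < b → b ≤ 1 → ∀ θ : Tang n → ℂ, ContDiff ℝ ∞ θ →
      HasCompactSupport θ → ‖∫ p in {p : Pt n | p.2 ∈ Ico a b}, v none p * star (θ p.1)‖ ≤
        K * √(√b) * (eLpNorm θ 2 volume).toReal := by
  choose B hB using exists_bound_diffQuotient h hC hD
  have hB0 : ∀ i, 0 ≤ B i := fun i => (Nw_nonneg _ _).trans (hB i 1 one_ne_zero)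
  have hBs : 0 ≤ ∑ i, B i := Finset.sum_nonneg fun i _ => hB0 i
  refine ⟨16 * (C + ∑ i, B i), by positivity, fun a b ha hab hb1 θ hθ hc => ?_⟩
  have hθL : MemLp θ 2 volume := hθ.continuous.memLp_of_hasCompactSupport hc
  have h1 := hD _ _ (isEn_ramp hn ha hab hb1 hθ hc)
  rw [Fintype.sum_option] at h1
  -- The weight `z` and `β' = 1/z` cancel exactly, leaving the unweighted integral of `∂_z u` over
  -- the strip.
  have e1 : ∫ p in Om n, (wt n none p.2 : ℂ) * (v none p * star ((rampDeriv a b p.2 : ℂ) * θ p.1)) =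
      ∫ p in {p : Pt n | p.2 ∈ Ico a b}, v none p * star (θ p.1) := by
    have hS : {p : Pt n | p.2 ∈ Ico a b} ⊆ Om n := fun p hp => ha.trans_le hp.1
    have hM : MeasurableSet {p : Pt n | p.2 ∈ Ico a b} := measurable_snd measurableSet_Ico
    rw [← inter_eq_right.2 hS, ← setIntegral_indicator hM]
    refine setIntegral_congr_fun measurableSet_Om fun p hp => ?_
    by_cases hp' : p.2 ∈ Ico a b
    · have h0 : (p.2 : ℂ) ≠ 0 := by exact_mod_cast (ha.trans_le hp'.1).ne'
      simp only [wt, rampDeriv, indicator_of_mem hp', star_mul', RCLike.star_def,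
        Complex.conj_ofReal]
      rw [indicator_of_mem (show p ∈ {p : Pt n | p.2 ∈ Ico a b} from hp')]
      push_cast
      field_simp
    · rw [indicator_of_notMem (show p ∉ {p : Pt n | p.2 ∈ Ico a b} from hp')]
      simp [rampDeriv, indicator_of_notMem hp']
  have h2 : ∀ i : Fin n, ‖∫ p in Om n, (wt n (some i) p.2 : ℂ) * (v (some i) p *
      star ((ramp a b p.2 : ℂ) * fderiv ℝ θ p.1 (EuclideanSpace.single i 1)))‖ ≤
      B i * (16 * √(√b) * (eLpNorm θ 2 volume).toReal) := fun i =>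
    (norm_integral_ramp_fderiv_le hn i (h.memLp_deriv _) (hB i) ha hab hb1 hθ hc).trans
      (mul_le_mul_of_nonneg_left (Nw_ramp_le (isWeight_wt _)
        (fun z hz hz1 => wt_some_le hn hz hz1 i) ha hab hb1 hθL) (hB0 i))
  have h3 := Nw_ramp_le (n := n) isWeight_id (fun z hz hz1 => le_rpow_neg_half hz hz1) ha hab hb1 hθL
  rw [← e1]
  have h4 := norm_sum_le_of_le Finset.univ fun i (_ : i ∈ Finset.univ) => h2 i
  rw [← Finset.sum_mul] at h4
  have h5 := norm_sub_le_norm_add (∫ p in Om n, (wt n none p.2 : ℂ) *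
    (v none p * star ((rampDeriv a b p.2 : ℂ) * θ p.1))) (∑ i, ∫ p in Om n, (wt n (some i) p.2 : ℂ) *
    (v (some i) p * star ((ramp a b p.2 : ℂ) * fderiv ℝ θ p.1 (EuclideanSpace.single i 1))))
  have h6 := mul_le_mul_of_nonneg_left h3 hC
  calc _ ≤ C * (16 * √(√b) * (eLpNorm θ 2 volume).toReal) +
        (∑ i, B i) * (16 * √(√b) * (eLpNorm θ 2 volume).toReal) := by
        linarith [h5.trans h1]
    _ = _ := by ring


/-! ### Integration over the normal variable -/

lemma volume_restrict_snd (I : Set ℝ) : (volume : Measure (Pt n)).restrict {p | p.2 ∈ I} =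
    (volume : Measure (Tang n)).prod (volume.restrict I) := by
  have : {p : Pt n | p.2 ∈ I} = univ ×ˢ I := by ext p; simp
  rw [this, Measure.volume_eq_prod, ← Measure.prod_restrict, Measure.restrict_univ]

/-- The Cauchy–Schwarz inequality, read off from the nonnegative integral of `((b - a) f - m)²`,
where `m` is the integral of `f`. -/
lemma sq_integral_le {a b : ℝ} (hab : a < b) {f : ℝ → ℝ} (hf : IntegrableOn f (Ioc a b))
    (hf2 : IntegrableOn (fun z => f z ^ 2) (Ioc a b)) :
    (∫ z in Ioc a b, f z) ^ 2 ≤ (b - a) * ∫ z in Ioc a b, f z ^ 2 := by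
  set m := ∫ z in Ioc a b, f z with hm
  have h0 : 0 ≤ ∫ z in Ioc a b, ((b - a) * f z - m) ^ 2 := integral_nonneg fun z => sq_nonneg _
  have e : ∀ z, ((b - a) * f z - m) ^ 2 =
      (b - a) ^ 2 * f z ^ 2 - 2 * (b - a) * m * f z + m ^ 2 := fun z => by ring
  simp only [e] at h0
  have i1 : IntegrableOn (fun z => (b - a) ^ 2 * f z ^ 2) (Ioc a b) := hf2.const_mul _
  have i2 : IntegrableOn (fun z => 2 * (b - a) * m * f z) (Ioc a b) := hf.const_mul _
  have i3 : IntegrableOn (fun z => (b - a) ^ 2 * f z ^ 2 - 2 * (b - a) * m * f z) (Ioc a b) :=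
    i1.sub i2
  rw [integral_add i3 (integrable_const _), integral_sub i1 i2, integral_const_mul, integral_const_mul,
    integral_const, ← hm] at h0
  simp only [measureReal_restrict_apply_univ, Real.volume_real_Ioc_of_le hab.le, smul_eq_mul] at h0
  have hba : 0 < b - a := sub_pos.2 hab
  have : 0 ≤ (b - a) * ((b - a) * (∫ z in Ioc a b, f z ^ 2) - m ^ 2) := by linarith
  linarith [nonneg_of_mul_nonneg_right this hba]

lemma memLp_integral_strip {a b : ℝ} (hab : a < b) {G : Pt n → ℂ}
    (hG : MemLp G 2 (volume.restrict {p : Pt n | p.2 ∈ Ioc a b})) :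
    MemLp (fun x => ∫ z in Ioc a b, G (x, z)) 2 volume := by
  rw [volume_restrict_snd] at hG
  have h1 : Integrable (fun p => ‖G p‖ ^ 2) _ := (memLp_two_iff_integrable_sq_norm hG.1).1 hG
  have hm : AEStronglyMeasurable (fun x => ∫ z in Ioc a b, G (x, z)) volume :=
    hG.1.integral_prod_right'
  refine (memLp_two_iff_integrable_sq_norm hm).2
    ((h1.integral_prod_left.const_mul (b - a)).mono' (hm.norm.pow 2) ?_)
  filter_upwards [h1.prod_right_ae, hG.1.prodMk_left] with x hx hx'
  rw [Real.norm_of_nonneg (sq_nonneg _)]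
  have hL : MemLp (fun z => G (x, z)) 2 (volume.restrict (Ioc a b)) :=
    (memLp_two_iff_integrable_sq_norm hx').2 hx
  have hi := hL.integrable one_le_two
  exact (pow_le_pow_left₀ (norm_nonneg _) (norm_integral_le_integral_norm _) 2).trans
    (sq_integral_le hab hi.norm hx)

lemma integrable_strip_mul {a b : ℝ} {G : Pt n → ℂ}
    (hG : MemLp G 2 (volume.restrict {p : Pt n | p.2 ∈ Ioc a b})) {θ : Tang n → ℂ}
    (hθ : MemLp θ 2 volume) :
    IntegrableOn (fun p : Pt n => G p * θ p.1) {p : Pt n | p.2 ∈ Ioc a b} := by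
  rw [IntegrableOn, volume_restrict_snd] at *
  have h2 : MemLp (fun p : Pt n => θ p.1) 2
      ((volume : Measure (Tang n)).prod (volume.restrict (Ioc a b))) := by
    refine (memLp_two_iff_integrable_sq_norm hθ.1.comp_fst).2 ?_
    exact Integrable.comp_fst ((memLp_two_iff_integrable_sq_norm hθ.1).1 hθ) _
  exact hG.integrable_mul h2

lemma integral_integral_strip_mul {a b : ℝ} {G : Pt n → ℂ}
    (hG : MemLp G 2 (volume.restrict {p : Pt n | p.2 ∈ Ioc a b})) {θ : Tang n → ℂ}
    (hθ : MemLp θ 2 volume) :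
    ∫ x, (∫ z in Ioc a b, G (x, z)) * θ x = ∫ p in {p : Pt n | p.2 ∈ Ioc a b}, G p * θ p.1 := by
  have hi := integrable_strip_mul hG hθ
  rw [IntegrableOn, volume_restrict_snd] at hi
  rw [volume_restrict_snd, integral_prod _ hi]
  simp only [integral_mul_const]

/-! ### Green's formula on `{z > z₀}` -/

/-- Green's formula for functions vanishing on the hyperplane `{z = z₀}`. -/
lemma integral_eq_zero_of_vanish {u v : Pt n → ℂ} (hu : MemL2loc u) (hv : MemL2loc v)
    (h : ∀ η, IsTest η → ∫ p in Om n, u p * fderiv ℝ η p (dirZ n) = -∫ p in Om n, v p * η p)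
    {z₀ : ℝ} (hz₀ : 0 < z₀) {ζ : Pt n → ℂ} (hζ : ContDiff ℝ ∞ ζ) (hc : HasCompactSupport ζ)
    (h0 : ∀ x, ζ (x, z₀) = 0) :
    ∫ p in {p : Pt n | z₀ < p.2}, (u p * fderiv ℝ ζ p (dirZ n) + v p * ζ p) = 0 := by
  obtain ⟨M, hM0, hM⟩ := exists_bound_deriv_cut
  obtain ⟨L, hL⟩ := (hc.fderiv ℝ).exists_bound_of_continuous (hζ.continuous_fderiv (by simp))
  obtain ⟨N, hN⟩ := hc.exists_bound_of_continuous hζ.continuous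
  obtain ⟨L', hL'⟩ := (hc.fderiv_apply ℝ (dirZ n)).exists_bound_of_continuous
    ((hζ.continuous_fderiv (by simp)).clm_apply continuous_const)
  have hL0 : 0 ≤ L := (norm_nonneg _).trans (hL 0)
  have hζd : Differentiable ℝ ζ := hζ.differentiable (by simp)
  have hlip : ∀ p : Pt n, ‖ζ p‖ ≤ L * |p.2 - z₀| := by
    intro p
    have h1 := convex_univ.norm_image_sub_le_of_norm_fderiv_le (𝕜 := ℝ) (f := ζ) (x := (p.1, z₀))
      (y := p) (fun x _ => hζd x) (fun x _ => hL x) (mem_univ _) (mem_univ _)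
    rw [h0, sub_zero] at h1
    refine h1.trans_eq ?_
    congr 1
    have : p - (p.1, z₀) = (0, p.2 - z₀) := by ext <;> simp
    rw [this]; simp
  -- the cutoffs
  let χ : ℕ → ℝ → ℝ := fun k z => 1 - cut (k * (z - z₀) + 1)
  have hχ : ∀ k, ContDiff ℝ ∞ (χ k) := fun k => contDiff_const.sub
    (contDiff_cut.comp ((contDiff_const.mul (contDiff_id.sub contDiff_const)).add contDiff_const))
  have hχd : ∀ k z, deriv (χ k) z = -(deriv cut (k * (z - z₀) + 1) * k) := by
    intro k z
    have h1 : HasDerivAt (fun z : ℝ => (k : ℝ) * (z - z₀) + 1) k z := by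
      simpa using (((hasDerivAt_id z).sub_const z₀).const_mul (k : ℝ)).add_const 1
    have h2 := ((contDiff_cut.differentiable (by simp)) (k * (z - z₀) + 1)).hasDerivAt.comp z h1
    exact (h2.const_sub 1).deriv
  have hχ0 : ∀ k z, z ≤ z₀ → χ k z = 0 := by
    intro k z hz
    have : (k : ℝ) * (z - z₀) + 1 ≤ 1 := by
      have := mul_nonneg (Nat.cast_nonneg (α := ℝ) k) (sub_nonneg.2 hz); linarith
    simp [χ, cut_of_le this]
  have hχ1 : ∀ k z, |χ k z| ≤ 1 := fun k z => by
    have h1 := cut_nonneg (k * (z - z₀) + 1)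
    have h2 := cut_le_one (k * (z - z₀) + 1)
    rw [abs_le]; constructor <;> simp only [χ] <;> linarith
  -- The derivative of the cutoff is of size `k`, but it lives where `|z - z₀| ≤ 1/k`, and there `ζ`
  -- is at most `L/k` because it vanishes on the hyperplane. This makes dominated convergence
  -- possible.
  have hχζ : ∀ k (p : Pt n), ‖((deriv (χ k) p.2 : ℝ) : ℂ) * ζ p‖ ≤ M * L := by
    intro k p
    rw [norm_mul, Complex.norm_real, hχd, norm_neg, norm_mul, Real.norm_natCast, Real.norm_eq_abs]
    rcases lt_or_ge ((k : ℝ) * (p.2 - z₀) + 1) 1 with h1 | h1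
    · rw [deriv_cut_of_lt h1]; simp; positivity
    rcases lt_or_ge 2 ((k : ℝ) * (p.2 - z₀) + 1) with h2 | h2
    · rw [deriv_cut_of_gt h2]; simp; positivity
    have h3 : (k : ℝ) * |p.2 - z₀| ≤ 1 := by
      rw [← Nat.abs_cast k, ← abs_mul, abs_le]; constructor <;> linarith
    calc |deriv cut (k * (p.2 - z₀) + 1)| * k * ‖ζ p‖
        ≤ M * k * (L * |p.2 - z₀|) := by gcongr; exacts [hM _, hlip p]
      _ = M * L * (k * |p.2 - z₀|) := by ring
      _ ≤ M * L * 1 := by gcongr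
      _ = M * L := mul_one _
  have hχs : ∀ k, ContDiff ℝ ∞ fun p : Pt n => (χ k p.2 : ℂ) := fun k =>
    Complex.ofRealCLM.contDiff.comp ((hχ k).comp contDiff_snd)
  have hcl : IsClosed {p : Pt n | z₀ ≤ p.2} := isClosed_le continuous_const continuous_snd
  set K : Set (Pt n) := tsupport ζ ∩ {p | z₀ ≤ p.2} with hKdef
  have hK : IsCompact K := hc.isCompact.inter_right hcl
  have hKO : K ⊆ Om n := fun p hp => hz₀.trans_le hp.2
  have htest : ∀ k, IsTest fun p => (χ k p.2 : ℂ) * ζ p := by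
    intro k
    refine ⟨(hχs k).mul hζ, hc.mul_left (f := fun p : Pt n => (χ k p.2 : ℂ)), ?_⟩
    refine Subset.trans (closure_minimal (fun p hp => ?_) hcl) fun p hp => hz₀.trans_le hp
    by_contra hcon
    refine hp ?_
    simp [hχ0 k p.2 (not_le.1 hcon).le]
  have hfd : ∀ k p, fderiv ℝ (fun p => (χ k p.2 : ℂ) * ζ p) p (dirZ n) =
      ((deriv (χ k) p.2 : ℝ) : ℂ) * ζ p + (χ k p.2 : ℂ) * fderiv ℝ ζ p (dirZ n) := by
    intro k p
    have h1 := hasFDerivAt_ofReal_comp_snd (hχ k) p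
    have h12 : HasFDerivAt (fun p => (χ k p.2 : ℂ) * ζ p) _ p := h1.mul (hζd p).hasFDerivAt
    rw [h12.fderiv]
    simp [dirZ]; ring
  let F : ℕ → Pt n → ℂ := fun k p =>
    u p * fderiv ℝ (fun p => (χ k p.2 : ℂ) * ζ p) p (dirZ n) + v p * ((χ k p.2 : ℂ) * ζ p)
  have hFi : ∀ k, Integrable (F k) (volume.restrict (Om n)) := fun k =>
    (hu.integrable_mul_test ((htest k).fderiv _)).add (hv.integrable_mul_test (htest k))
  have hF0 : ∀ k, ∫ p in Om n, F k p = 0 := by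
    intro k
    rw [integral_add (hu.integrable_mul_test ((htest k).fderiv _))
      (hv.integrable_mul_test (htest k)), h _ (htest k), neg_add_cancel]
  have hS : {p : Pt n | z₀ < p.2} ⊆ Om n := fun p hp => hz₀.trans hp
  have hSm : MeasurableSet {p : Pt n | z₀ < p.2} := measurableSet_lt measurable_const measurable_snd
  have key : Tendsto (fun k => ∫ p in Om n, F k p) atTop
      (𝓝 (∫ p in Om n, {p : Pt n | z₀ < p.2}.indicator
        (fun p => u p * fderiv ℝ ζ p (dirZ n) + v p * ζ p) p)) := by
    refine tendsto_integral_of_dominated_convergence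
      (K.indicator fun p => ‖u p‖ * (M * L + L') + ‖v p‖ * N) (fun k => (hFi k).1) ?_ ?_ ?_
    · rw [integrable_indicator_iff hK.measurableSet, IntegrableOn,
        Measure.restrict_restrict hK.measurableSet, inter_eq_left.2 hKO]
      exact ((((memL2loc_locallyIntegrableOn hu).integrableOn_compact_subset hKO hK).norm).mul_const
        _).add ((((memL2loc_locallyIntegrableOn hv).integrableOn_compact_subset hKO
          hK).norm).mul_const _)
    · refine fun k => Eventually.of_forall fun p => ?_
      by_cases hp : p ∈ K
      · rw [indicator_of_mem hp]
        refine (norm_add_le _ _).trans (add_le_add ?_ ?_)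
        · rw [norm_mul, hfd]
          refine mul_le_mul_of_nonneg_left ((norm_add_le _ _).trans
            (add_le_add (hχζ k p) ?_)) (norm_nonneg _)
          rw [norm_mul, Complex.norm_real, Real.norm_eq_abs]
          exact (mul_le_of_le_one_left (norm_nonneg _) (hχ1 k _)).trans (hL' p)
        · rw [norm_mul, norm_mul, Complex.norm_real, Real.norm_eq_abs]
          exact mul_le_mul_of_nonneg_left ((mul_le_of_le_one_left (norm_nonneg _)
            (hχ1 k _)).trans (hN p)) (norm_nonneg _)
      · rw [indicator_of_notMem hp]
        have hz : p ∉ tsupport ζ ∨ p.2 < z₀ := by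
          by_contra! hcon
          exact hp ⟨hcon.1, hcon.2⟩
        have : F k p = 0 := by
          rcases hz with hz | hz
          · have h1 : ζ p = 0 := image_eq_zero_of_notMem_tsupport hz
            have h2 : fderiv ℝ ζ p = 0 := fderiv_of_notMem_tsupport ℝ hz
            simp only [F, hfd, h1, h2]; simp
          · have h1 : deriv (χ k) p.2 = 0 := by
              have : χ k =ᶠ[𝓝 p.2] fun _ => 0 := by
                filter_upwards [Iio_mem_nhds hz] with z hz' using hχ0 k z (le_of_lt hz')
              rw [this.deriv_eq, deriv_const]
            simp only [F, hfd, h1, hχ0 k _ hz.le]; simp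
        rw [this, norm_zero]
    · refine Eventually.of_forall fun p => ?_
      refine tendsto_const_nhds.congr' ?_
      rcases lt_trichotomy p.2 z₀ with hz | hz | hz
      · refine Eventually.of_forall fun k => ?_
        have h1 : deriv (χ k) p.2 = 0 := by
          have : χ k =ᶠ[𝓝 p.2] fun _ => 0 := by
            filter_upwards [Iio_mem_nhds hz] with z hz' using hχ0 k z (le_of_lt hz')
          rw [this.deriv_eq, deriv_const]
        rw [indicator_of_notMem (show p ∉ {p : Pt n | z₀ < p.2} from not_lt.2 hz.le)]
        simp only [F, hfd, h1, hχ0 k _ hz.le]; simp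
      · refine Eventually.of_forall fun k => ?_
        rw [indicator_of_notMem (show p ∉ {p : Pt n | z₀ < p.2} from not_lt.2 hz.le)]
        have h1 : ζ p = 0 := by rw [← h0 p.1, ← hz]
        simp only [F, hfd, h1, hχ0 k _ hz.le]; simp
      · rw [indicator_of_mem (show p ∈ {p : Pt n | z₀ < p.2} from hz)]
        obtain ⟨k₀, hk₀⟩ := exists_nat_gt (1 / (p.2 - z₀))
        filter_upwards [eventually_ge_atTop k₀] with k hk
        have hpos : 0 < p.2 - z₀ := sub_pos.2 hz
        have h2 : 2 < (k : ℝ) * (p.2 - z₀) + 1 := by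
          have h3 : 1 / (p.2 - z₀) < k := hk₀.trans_le (by exact_mod_cast hk)
          rw [div_lt_iff₀ hpos] at h3
          linarith
        have h4 : χ k p.2 = 1 := by simp [χ, cut_of_ge h2.le]
        have h5 : deriv (χ k) p.2 = 0 := by rw [hχd, deriv_cut_of_gt h2]; simp
        simp only [F, hfd, h4, h5]; simp
  simp only [hF0] at key
  rw [setIntegral_indicator hSm, inter_eq_right.2 hS] at key
  exact tendsto_nhds_unique key tendsto_const_nhds


/-! ### Traces -/

/-- The integrand of the trace: `∂_z (ψ u)`, where `v = ∂_z u`. -/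
def traceFun (u v : Pt n → ℂ) (ψ : ℝ → ℝ) (p : Pt n) : ℂ :=
  ((deriv ψ p.2 : ℝ) : ℂ) * u p + (ψ p.2 : ℂ) * v p

lemma memLp_traceFun {u v : Pt n → ℂ} (hu : MemLp u 2 (wL n fun z => z))
    (hv : MemLp v 2 (wL n fun z => z)) {ψ : ℝ → ℝ} (hψ : ContDiff ℝ ∞ ψ)
    (hc : HasCompactSupport ψ) {a b : ℝ} (ha : 0 < a) :
    MemLp (traceFun u v ψ) 2 (volume.restrict {p : Pt n | p.2 ∈ Ioc a b}) := by
  obtain ⟨M, hM⟩ := hc.exists_bound_of_continuous hψ.continuous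
  obtain ⟨M', hM'⟩ := hc.deriv.exists_bound_of_continuous (contDiff_infty_iff_deriv.1 hψ).2.continuous
  have h := (memLp_mul_snd hu (contDiff_infty_iff_deriv.1 hψ).2.continuous hM').add
    (memLp_mul_snd hv hψ.continuous hM)
  exact memLp_restrict_of_wL isWeight_id (measurable_snd measurableSet_Ioc)
    (fun p hp => ha.trans hp.1) ha (fun p hp => hp.1.le) h

/-- Green's formula on `{z > z₀}`. -/
lemma green {u v : Pt n → ℂ} (hu : MemLp u 2 (wL n fun z => z)) (hv : MemLp v 2 (wL n fun z => z))
    (h : ∀ η, IsTest η → ∫ p in Om n, u p * fderiv ℝ η p (dirZ n) = -∫ p in Om n, v p * η p)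
    {ψ : ℝ → ℝ} (hψ : ContDiff ℝ ∞ ψ) (hc : HasCompactSupport ψ) {z₀ b : ℝ} (hz₀ : 0 < z₀)
    (h1 : ψ z₀ = 1) (hb : ∀ z, b < z → ψ z = 0) {η : Pt n → ℂ} (hη : IsTest η) :
    ∫ p in {p : Pt n | z₀ < p.2}, (u p * fderiv ℝ η p (dirZ n) + v p * η p) =
      ∫ x, (∫ z in Ioc z₀ b, traceFun u v ψ (x, z)) * η (x, z₀) := by
  have lu := memL2loc_of_wL isWeight_id hu
  have lv := memL2loc_of_wL isWeight_id hv
  have hηd : Differentiable ℝ η := hη.smooth.differentiable (by simp)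
  have hθs : ContDiff ℝ ∞ fun x => η (x, z₀) := hη.smooth.comp (contDiff_id.prodMk contDiff_const)
  have hθc := HasCompactSupport.slice_fst hη.compact z₀
  have hθ : MemLp (fun x => η (x, z₀)) 2 volume := hθs.continuous.memLp_of_hasCompactSupport hθc
  have hψs : ContDiff ℝ ∞ fun p : Pt n => (ψ p.2 : ℂ) :=
    Complex.ofRealCLM.contDiff.comp (hψ.comp contDiff_snd)
  have hθ' : ContDiff ℝ ∞ fun p : Pt n => η (p.1, z₀) := hθs.comp contDiff_fst
  -- Subtracting the extension `ψ(z) η(x, z₀)` of the boundary values leaves a function vanishing on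
  -- the hyperplane, to which the preceding case applies.
  set ζ : Pt n → ℂ := fun p => η p - (ψ p.2 : ℂ) * η (p.1, z₀) with hζ
  have hζs : ContDiff ℝ ∞ ζ := hη.smooth.sub (hψs.mul hθ')
  have hζc : HasCompactSupport ζ := by
    refine hη.compact.sub (HasCompactSupport.intro
      (hθc.isCompact.prod hc.isCompact) fun p hp => ?_)
    by_cases h1 : p.1 ∈ tsupport fun x => η (x, z₀)
    · have : p.2 ∉ tsupport ψ := fun h2 => hp ⟨h1, h2⟩
      simp [image_eq_zero_of_notMem_tsupport this]
    · have := image_eq_zero_of_notMem_tsupport h1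
      simp [this]
  have hζ0 : ∀ x, ζ (x, z₀) = 0 := fun x => by simp [hζ, h1]
  have hfd : ∀ p, fderiv ℝ ζ p (dirZ n) =
      fderiv ℝ η p (dirZ n) - ((deriv ψ p.2 : ℝ) : ℂ) * η (p.1, z₀) := by
    rintro ⟨x, z⟩
    rw [← fderiv_slice_snd (hζs.differentiable (by simp)), ← fderiv_slice_snd hηd]
    have d1 : HasDerivAt (fun z => (ψ z : ℂ)) ((deriv ψ z : ℝ) : ℂ) z :=
      ((hψ.differentiable (by simp)) z).hasDerivAt.ofReal_comp
    have d2 : DifferentiableAt ℝ (fun z => η (x, z)) z :=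
      (hηd (x, z)).comp z ((differentiableAt_const x).prodMk differentiableAt_id)
    have d3 : HasDerivAt (fun z => ζ (x, z))
        (deriv (fun z => η (x, z)) z - ((deriv ψ z : ℝ) : ℂ) * η (x, z₀)) z :=
      d2.hasDerivAt.sub (d1.mul_const (η (x, z₀)))
    exact d3.deriv
  have key := integral_eq_zero_of_vanish lu lv h hz₀ hζs hζc hζ0
  have hS : {p : Pt n | z₀ < p.2} ⊆ Om n := fun p hp => hz₀.trans hp
  have hSm : MeasurableSet {p : Pt n | z₀ < p.2} := measurableSet_lt measurable_const measurable_snd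
  have hG := memLp_traceFun hu hv hψ hc (b := b) hz₀
  have hGi := integrable_strip_mul hG hθ
  rw [integral_integral_strip_mul hG hθ]
  have hTm : MeasurableSet {p : Pt n | p.2 ∈ Ioc z₀ b} := measurable_snd measurableSet_Ioc
  have hTS : {p : Pt n | p.2 ∈ Ioc z₀ b} ⊆ {p : Pt n | z₀ < p.2} := fun p hp => hp.1
  have hd0 : ∀ z, b < z → deriv ψ z = 0 := by
    intro z hz
    have : ψ =ᶠ[𝓝 z] fun _ => 0 := by filter_upwards [Ioi_mem_nhds hz] with y hy using hb y hy
    rw [this.deriv_eq, deriv_const]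
  have hind : {p : Pt n | p.2 ∈ Ioc z₀ b}.indicator (fun p => traceFun u v ψ p * η (p.1, z₀)) =
      {p : Pt n | z₀ < p.2}.indicator fun p => traceFun u v ψ p * η (p.1, z₀) := by
    ext p
    by_cases hp : z₀ < p.2
    · rw [indicator_of_mem (show p ∈ {p : Pt n | z₀ < p.2} from hp)]
      by_cases hp' : p.2 ≤ b
      · rw [indicator_of_mem (show p ∈ {p : Pt n | p.2 ∈ Ioc z₀ b} from ⟨hp, hp'⟩)]
      · rw [indicator_of_notMem fun h' => hp' h'.2]
        rw [traceFun, hd0 _ (not_le.1 hp'), hb _ (not_le.1 hp')]; simp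
    · rw [indicator_of_notMem fun h' => hp h'.1,
        indicator_of_notMem (show p ∉ {p : Pt n | z₀ < p.2} from hp)]
  have hGi' : IntegrableOn (fun p : Pt n => traceFun u v ψ p * η (p.1, z₀))
      {p : Pt n | z₀ < p.2} := by
    rw [← integrable_indicator_iff hSm, ← hind]
    exact (integrable_indicator_iff hTm).2 hGi
  have hIe : ∫ p in {p : Pt n | p.2 ∈ Ioc z₀ b}, traceFun u v ψ p * η (p.1, z₀) =
      ∫ p in {p : Pt n | z₀ < p.2}, traceFun u v ψ p * η (p.1, z₀) := by
    rw [← integral_indicator hTm, hind, integral_indicator hSm]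
  have hi : IntegrableOn (fun p => u p * fderiv ℝ η p (dirZ n) + v p * η p)
      {p : Pt n | z₀ < p.2} :=
    IntegrableOn.mono_set ((lu.integrable_mul_test (hη.fderiv _)).add (lv.integrable_mul_test hη)) hS
  rw [hIe, ← sub_eq_zero, ← integral_sub hi hGi', ← key]
  congr 1; ext p
  rw [hfd, hζ, traceFun]; ring

/-- The traces of an element of the domain converge as `z → 0`. -/
theorem exists_trace_tendsto {u v : Pt n → ℂ} (hu : MemLp u 2 (wL n fun z => z))
    (hv : MemLp v 2 (wL n fun z => z))
    (h : ∀ η, IsTest η → ∫ p in Om n, u p * fderiv ℝ η p (dirZ n) = -∫ p in Om n, v p * η p)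
    {K : ℝ} (hK : 0 ≤ K) (hb : ∀ a b : ℝ, 0 < a → a < b → b ≤ 1 → ∀ θ : Tang n → ℂ,
      ContDiff ℝ ∞ θ → HasCompactSupport θ →
      ‖∫ p in {p : Pt n | p.2 ∈ Ico a b}, v p * star (θ p.1)‖ ≤
        K * √(√b) * (eLpNorm θ 2 volume).toReal) :
    ∃ T : ℝ → Lp ℂ 2 (volume : Measure (Tang n)),
      (∀ z₀, 0 < z₀ → ∀ η, IsTest η →
        ∫ p in {p : Pt n | z₀ < p.2}, (u p * fderiv ℝ η p (dirZ n) + v p * η p) =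
          -∫ x, T z₀ x * η (x, z₀)) ∧
      ∃ L, Tendsto T (𝓝[>] 0) (𝓝 L) := by
  -- The trace at `z₀` is minus the integral of `∂_z(ψ u)` over `z > z₀`, with `ψ = 1` on `(0, R
  -- z₀]` and `ψ = 0` beyond `R z₀ + 1`. Taking `R z₀ ≥ 2` gives all `z₀ ≤ 1` the same cutoff.
  let R : ℝ → ℝ := fun z₀ => max 2 z₀
  have hR : ∀ z₀, 0 < R z₀ := fun z₀ => lt_max_of_lt_left two_pos
  let ψ : ∀ z₀ : ℝ, ContDiffBump (0 : ℝ) := fun z₀ => ⟨R z₀, R z₀ + 1, hR z₀, lt_add_one _⟩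
  have hψs : ∀ z₀, ContDiff ℝ ∞ (ψ z₀) := fun z₀ => (ψ z₀).contDiff
  have hψ1 : ∀ z₀ z, 0 < z → z ≤ R z₀ → ψ z₀ z = 1 := fun z₀ z hz hz' =>
    (ψ z₀).one_of_mem_closedBall (by simpa [abs_of_pos hz] using hz')
  have hψ0 : ∀ z₀ z, R z₀ + 1 < z → ψ z₀ z = 0 := fun z₀ z hz =>
    (ψ z₀).zero_of_le_dist (by
      have : 0 < z := by linarith [hR z₀]
      simpa [abs_of_pos this] using hz.le)
  have hab : ∀ z₀, z₀ < R z₀ + 1 := fun z₀ => (le_max_right _ _).trans_lt (lt_add_one _)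
  have hG : ∀ z₀, ∀ a b : ℝ, 0 < a →
      MemLp (traceFun u v (ψ z₀)) 2 (volume.restrict {p : Pt n | p.2 ∈ Ioc a b}) :=
    fun z₀ a b ha => memLp_traceFun hu hv (hψs z₀) (ψ z₀).hasCompactSupport ha
  have hex : ∀ z₀, ∃ T : Lp ℂ 2 (volume : Measure (Tang n)), 0 < z₀ →
      T =ᵐ[volume] fun x => -∫ z in Ioc z₀ (R z₀ + 1), traceFun u v (ψ z₀) (x, z) := by
    intro z₀
    rcases lt_or_ge 0 z₀ with hz | hz
    · have hm := (memLp_integral_strip (hab z₀) (hG z₀ z₀ (R z₀ + 1) hz)).neg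
      exact ⟨hm.toLp _, fun _ => hm.coeFn_toLp⟩
    · exact ⟨0, fun h => absurd h (not_lt.2 hz)⟩
  choose T hT using hex
  have hTθ : ∀ z₀, 0 < z₀ → ∀ θ : Tang n → ℂ, MemLp θ 2 volume → ∫ x, T z₀ x * θ x =
      -∫ p in {p : Pt n | p.2 ∈ Ioc z₀ (R z₀ + 1)}, traceFun u v (ψ z₀) p * θ p.1 := by
    intro z₀ hz₀ θ hθ
    rw [← integral_integral_strip_mul (hG _ _ _ hz₀) hθ, ← integral_neg]
    refine integral_congr_ae ?_
    filter_upwards [hT z₀ hz₀] with x hx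
    rw [hx, neg_mul]
  refine ⟨T, fun z₀ hz₀ η hη => ?_, ?_⟩
  · have hθ : MemLp (fun x => η (x, z₀)) 2 (volume : Measure (Tang n)) :=
      (hη.smooth.continuous.comp (continuous_id.prodMk continuous_const)).memLp_of_hasCompactSupport
        (HasCompactSupport.slice_fst hη.compact z₀)
    rw [hTθ z₀ hz₀ _ hθ, neg_neg, ← integral_integral_strip_mul (hG _ _ _ hz₀) hθ]
    exact green hu hv h (hψs z₀) (ψ z₀).hasCompactSupport hz₀
      (hψ1 _ _ hz₀ (le_max_right _ _)) (hψ0 z₀) hη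
  -- Between two heights below `1` the common cutoff is `1`, so the difference of the traces is the
  -- integral of `∂_z u` over the strip, and the strip bound applies.
  have hdist : ∀ z₀ z₁, 0 < z₀ → z₀ < z₁ → z₁ ≤ 1 → ‖T z₁ - T z₀‖ ≤ K * √(√z₁) := by
    intro z₀ z₁ hz₀ hz hz1
    have hR0 : R z₀ = 2 := max_eq_left (by linarith)
    have hR1 : R z₁ = 2 := max_eq_left (by linarith)
    have hψe : ψ z₁ = ψ z₀ := by simp only [ψ, hR0, hR1]
    have hz₁ := hz₀.trans hz
    have hθb : ∀ θ : Tang n → ℂ, ContDiff ℝ ∞ θ → HasCompactSupport θ →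
        ‖∫ x, (T z₁ x - T z₀ x) * star (θ x)‖ ≤ K * √(√z₁) * (eLpNorm θ 2 volume).toReal := by
      intro θ hθ hc
      have hθL : MemLp (fun x => star (θ x)) 2 (volume : Measure (Tang n)) :=
        (hθ.continuous.memLp_of_hasCompactSupport hc).star
      have i0 : ∀ z, Integrable (fun x => T z x * star (θ x)) volume := fun z =>
        (Lp.memLp (T z)).integrable_mul hθL
      refine le_of_eq_of_le ?_ (hb z₀ z₁ hz₀ hz hz1 θ hθ hc)
      congr 1
      simp only [sub_mul]
      rw [integral_sub (i0 _) (i0 _), hTθ z₁ hz₁ _ hθL, hTθ z₀ hz₀ _ hθL, hR0, hR1, hψe]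
      have hU : {p : Pt n | p.2 ∈ Ioc z₀ (2 + 1)} =
          {p : Pt n | p.2 ∈ Ioc z₀ z₁} ∪ {p : Pt n | p.2 ∈ Ioc z₁ (2 + 1)} := by
        rw [← Ioc_union_Ioc_eq_Ioc hz.le (by linarith : z₁ ≤ 2 + 1)]; rfl
      have hM : MeasurableSet {p : Pt n | p.2 ∈ Ioc z₁ (2 + 1)} := measurable_snd measurableSet_Ioc
      rw [hU, setIntegral_union _ hM (integrable_strip_mul (hG _ _ _ hz₀) hθL)
        (integrable_strip_mul (hG _ _ _ hz₁) hθL)]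
      -- The strips of the two statements are half-open at opposite ends and differ by a null set.
      · rw [volume_restrict_snd (Ico z₀ z₁), restrict_Ico_eq_restrict_Ioc, ← volume_restrict_snd,
          neg_sub_neg, add_sub_cancel_right]
        refine setIntegral_congr_fun (measurable_snd measurableSet_Ioc) fun p hp => ?_
        have hp0 : 0 < p.2 := hz₀.trans hp.1
        have hp2 : p.2 < 2 := by linarith [hp.2]
        have d1 : deriv (ψ z₀) p.2 = 0 := by
          have : (ψ z₀ : ℝ → ℝ) =ᶠ[𝓝 p.2] fun _ => 1 := by
            filter_upwards [Ioo_mem_nhds hp0 hp2] with y hy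
            exact hψ1 _ _ hy.1 (by rw [hR0]; exact hy.2.le)
          rw [this.deriv_eq, deriv_const]
        simp only [traceFun, d1, hψ1 z₀ p.2 hp0 (by rw [hR0]; exact hp2.le)]
        simp
      · rw [disjoint_left]
        rintro p hp hp'
        exact absurd hp.2 (not_le.2 hp'.1)
    -- Smooth compactly supported functions are dense in `L²`, so the bound extends to all `G`; the
    -- choice `G = T z₁ - T z₀` gives the norm.
    have hG' : ∀ G : Lp ℂ 2 (volume : Measure (Tang n)),
        ‖inner ℂ G (T z₁ - T z₀)‖ ≤ K * √(√z₁) * ‖G‖ := by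
      intro G
      refine (Lp.dense_hasCompactSupport_contDiff (F := ℂ) (μ := (volume : Measure (Tang n)))
        (p := 2) (by simp)).induction
        (P := fun G => ‖inner ℂ G (T z₁ - T z₀)‖ ≤ K * √(√z₁) * ‖G‖) ?_ ?_ G
      · rintro G ⟨θ, hGθ, hc, hθ⟩
        rw [Lp.norm_def, eLpNorm_congr_ae hGθ, L2.inner_def]
        refine le_of_eq_of_le ?_ (hθb θ hθ hc)
        congr 1
        refine integral_congr_ae ?_
        filter_upwards [hGθ, Lp.coeFn_sub (T z₁) (T z₀)] with x hx hx'
        rw [hx, hx', Pi.sub_apply]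
        rfl
      · exact isClosed_le (by fun_prop) (by fun_prop)
    have h1 := hG' (T z₁ - T z₀)
    rw [inner_self_eq_norm_sq_to_K, norm_pow, RCLike.norm_ofReal, abs_norm, sq] at h1
    rcases (norm_nonneg (T z₁ - T z₀)).eq_or_lt with h2 | h2
    · rw [← h2]; positivity
    · exact le_of_mul_le_mul_right h1 h2
  have hcauchy : Cauchy (map T (𝓝[>] 0)) := by
    rw [Metric.cauchy_iff]
    refine ⟨inferInstance, fun ε hε => ?_⟩
    have hlim : Tendsto (fun z => K * √(√z)) (𝓝 0) (𝓝 0) := by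
      have : Continuous fun z => K * √(√z) := by fun_prop
      simpa using this.tendsto 0
    have hev : ∀ᶠ z in 𝓝[>] (0 : ℝ), K * √(√z) < ε ∧ z ≤ 1 ∧ 0 < z := by
      filter_upwards [nhdsWithin_le_nhds (hlim.eventually (gt_mem_nhds hε)),
        nhdsWithin_le_nhds (Iic_mem_nhds one_pos), self_mem_nhdsWithin] with z h1 h2 h3
      exact ⟨h1, h2, h3⟩
    refine ⟨T '' {z | K * √(√z) < ε ∧ z ≤ 1 ∧ 0 < z}, image_mem_map hev, ?_⟩
    rintro _ ⟨z, hz, rfl⟩ _ ⟨z', hz', rfl⟩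
    rw [dist_eq_norm]
    rcases lt_trichotomy z z' with hlt | rfl | hlt
    · rw [norm_sub_rev]; exact (hdist z z' hz.2.2 hlt hz'.2.1).trans_lt hz'.1
    · simpa using hε
    · exact (hdist z' z hz'.2.2 hlt hz.2.1).trans_lt hz.1
  obtain ⟨L, hL⟩ := CompleteSpace.complete hcauchy
  exact ⟨L, hL⟩


/-! ### Traces for the domain and the main theorem. -/

/-- The elements of the domain have traces which converge as `z → 0`. -/
theorem exists_trace_of_mem_domainA (hn : 2 ≤ n) {φ : H n} (hφ : φ ∈ domainA n) :
    ∃ T : ℝ → Lp ℂ 2 (volume : Measure (Tang n)), (∀ z, 0 < z → IsTrace φ z (T z)) ∧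
      ∃ L, Tendsto T (𝓝[>] 0) (𝓝 L) := by
  obtain ⟨hE, C, hC, hD⟩ := hφ
  obtain ⟨e, rfl⟩ := exists_emb_eq hE
  have h := isEn_En e
  -- The domain condition is restated for arbitrary representatives and weak gradients, since the
  -- regularity arguments work with concrete functions.
  have hD' : ∀ u' v', IsEn u' v' → ‖∑ j, ∫ p in Om n,
      (wt n j p.2 : ℂ) * (gradE j e p * star (v' j p))‖ ≤ C * Nw (fun z => z) u' := by
    intro u' v' h'
    obtain ⟨e', he', hg'⟩ := h'.exists_En
    have h1 := hD _ (emb_mem_energySpace e')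
    rw [bform_emb, inner_En, add_sub_cancel_left, Lp.norm_def, eLpNorm_congr_ae he'] at h1
    refine le_of_eq_of_le (congrArg norm (Finset.sum_congr rfl fun j _ => ?_)) h1
    rw [inner_Lp_wL (isWeight_wt j)]
    refine integral_congr_ae ?_
    filter_upwards [(ae_wL (isWeight_wt j)).1 (hg' j)] with p hp
    rw [hp]
  obtain ⟨K, hK, hb⟩ := exists_strip_bound hn h hC.le hD'
  obtain ⟨T, hT, hL⟩ := exists_trace_tendsto h.memLp_id (h.memLp_deriv none) (h.weak none) hK hb
  refine ⟨T, fun z hz η hη => ?_, hL⟩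
  rw [← hT z hz η hη]
  have hS : {p : Pt n | z < p.2} ⊆ Om n := fun p hp => hz.trans hp
  refine integral_congr_ae ?_
  filter_upwards [ae_restrict_of_ae_restrict_of_subset hS (weakDeriv_emb e none)] with p hp
  have hp' : weakDeriv (emb n e) (dirZ n) p = gradE none e p := hp
  rw [hp']

end Taub

end

theorem mainTheorem6 (n : ℕ) (hn : 2 ≤ n) (f g : Taub.H n)
    (hf : f ∈ Taub.domainA n) (hg : g ∈ Taub.energySpace n) :
    ∃ φ : ℝ → Taub.H n,
      Taub.IsSolution f g φ ∧
      (∀ φ' : ℝ → Taub.H n, Taub.IsSolution f g φ' → EqOn φ' φ (Ici 0)) ∧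
      ∀ t : ℝ, 0 < t →
        ∃ T : ℝ → Lp ℂ 2 (volume : Measure (Taub.Tang n)),
          (∀ z : ℝ, 0 < z → Taub.IsTrace (φ t) z (T z)) ∧
          ∃ L : Lp ℂ 2 (volume : Measure (Taub.Tang n)),
            Tendsto T (𝓝[>] 0) (𝓝 L) := by
  obtain ⟨φ, hφ, huniq, hdom⟩ := Taub.exists_unique_solution hf hg
  exact ⟨φ, hφ, huniq, fun t _ => Taub.exists_trace_of_mem_domainA hn (hdom t)⟩
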